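/- Let $\beta_0,\beta_1,\beta_\infty\in(-1,0]$, $|\pmb\beta|=\beta_0+\beta_1+\beta_\infty$, and let $m_{\pmb\beta}=e^{2\phi}|dz|^2$ be the unit area metric of constant Gaussian curvature $2\pi(|\pmb\beta|+2)$ on $\overline{\mathbb C}_z=\mathbb C\cup\{\infty\}$ with conical singularities of orders $\beta_0,\beta_1,\beta_\infty$ at $0,1,\infty$. That is, $\phi$ is real-valued and smooth on $\mathbb C\setminus\{0,1\}$, $e^{-2\phi}(-4\partial_z\partial_{\bar z}\phi)=2\pi(|\pmb\beta|+2)$ there, $\int_{\mathbb C}e^{2\phi}=1$ (Lebesgue measure), and for some constants $\phi_0,\phi_1,\phi_\infty$ one has $\phi(z)=\beta_0\log|z|+\phi_0+o(1)$ as $z\to0$, $\phi(z)=\beta_1\log|z-1|+\phi_1+o(1)$ as $z\to1$, $\phi(z)=-(\beta_\infty+2)\log|z|+\phi_\infty+o(1)$ as $z\to\infty$. Put $\mathfrak s_j=-\beta_j(2+\beta_j)$ for $j\in\{0,1,\infty\}$ and $$\mathfrak h_0=-\mathfrak h_1=\tfrac12(\mathfrak s_0+\mathfrak s_1-\mathfrak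 s_\infty),\qquad \mathfrak h_\infty=\tfrac12(\mathfrak s_1+\mathfrak s_\infty-\mathfrak s_0).$$ For a real potential $\varphi$ write $T_\varphi=2(\partial_x^2\varphi-(\partial_x\varphi)^2)$, where $\partial_x$ is the Wirtinger derivative in the complex variable $x$. Let $f:\overline{\mathbb C}_x\to\overline{\mathbb C}_z$ be a nonconstant rational function that is unramified outside of $f^{-1}(\{0,1,\infty\})$ and satisfies $f(\infty)\in\{0,1,\infty\}$. Let $x_1,\dots,x_n$ be the preimages of $0,1,\infty$ under $f$, let $\operatorname{ord}_kf+1\ge1$ be the local multiplicity of $f$ at $x_k$, and let $$(f^*\pmb\beta)_k=(\operatorname{ord}_kf+1)(\beta_{f(x_k)}+1)-1,\qquad s_k=-(f^*\pmb\beta)_k\bigl((f^*\pmb\beta)_k+2\bigr).$$ Let $f^*\phi=\phi\circ f+\log|f'|$ be the potential of the pullback metric $f^*m_{\pmb\beta}=e^{2f^*\phi}|dx|^2$. Then $n=\deg f+2$, and there are numbers $h_k\in\mathbb C$, $k=1,\dots,n$, such that $$T_{f^*\phi}(x)=\sum_{k:\,x_k\ne\infty}\left(\frac{s_k}{2(x-x_k)^2}+\frac{h_k}{x-x_k}\right),\qquad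 x\in\mathbb C\setminus\{x_1,\dots,x_n\},$$ $$T_{f^*\phi}(x)=\frac{s_k}{2x^2}+\frac{h_k}{x^3}+O(x^{-4}),\qquad x\to x_k=\infty,$$ and the accessory parameters $h_k$ are given as follows. 1. If $x_k$ is not a pole of $f$, then $$h_k=\begin{cases}\dfrac{d_k}{c_k}\,\mathfrak s_{f(x_k)}+c_k\,\mathfrak h_{f(x_k)},&\operatorname{ord}_kf=0,\\[2mm] -\dfrac{d_k}{c_k}\,\dfrac{(f^*\pmb\beta)_k((f^*\pmb\beta)_k+2)}{\operatorname{ord}_kf+1},&\operatorname{ord}_kf>0,\end{cases}$$ where $c_k\ne0$ and $d_k$ are the coefficients in the expansion $$f(x)-f(x_k)=c_kx^{-\operatorname{ord}_kf-1}\left(1+\frac{d_k}{c_k}\frac1x+O(x^{-2})\right)\quad\text{as }x\to x_k,\text{ if }x_k=\infty,$$ $$f(x)-f(x_k)=c_k(x-x_k)^{\operatorname{ord}_kf+1}\left(1+\frac{d_k}{c_k}(x-x_k)+O((x-x_k)^2)\right)\quad\text{as }x\to x_k,\text{ if }x_k\ne\infty.$$ 2. If $x_k$ is a pole of $f$, then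 $$h_k=\begin{cases}-\dfrac{d_k}{c_k}\,\mathfrak s_\infty+\dfrac1{c_k}\,\mathfrak h_\infty,&\operatorname{ord}_kf=0,\\[2mm] \dfrac{d_k}{c_k}\,\dfrac{(f^*\pmb\beta)_k((f^*\pmb\beta)_k+2)}{\operatorname{ord}_kf+1},&\operatorname{ord}_kf>0,\end{cases}$$ where $c_k\ne0$ and $d_k$ are the coefficients in the expansion $$f(x)=c_kx^{\operatorname{ord}_kf+1}\left(1+\frac{d_k}{c_k}\frac1x+O(x^{-2})\right)\quad\text{as }x\to x_k,\text{ if }x_k=\infty,$$ $$f(x)=c_k(x-x_k)^{-\operatorname{ord}_kf-1}\left(1+\frac{d_k}{c_k}(x-x_k)+O((x-x_k)^2)\right)\quad\text{as }x\to x_k,\text{ if }x_k\ne\infty.$$ -/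

import Mathlib

open Filter Topology Asymptotics Polynomial OnePoint

noncomputable section

namespace ConicalSphere

/-! ### Wirtinger derivatives and the stress-energy tensor -/

/-- The Wirtinger derivative `∂_z g = (∂_x g - i ∂_y g) / 2` of a function `g` of `z = x + i y`. -/
def dz (g : ℂ → ℂ) (z : ℂ) : ℂ :=
  (fderiv ℝ g z 1 - Complex.I * fderiv ℝ g z Complex.I) / 2

/-- The Wirtinger derivative `∂_{z̄} g = (∂_x g + i ∂_y g) / 2`. -/
def dzbar (g : ℂ → ℂ) (z : ℂ) : ℂ :=
  (fderiv ℝ g z 1 + Complex.I * fderiv ℝ g z Complex.I) / 2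

/-- The classical stress-energy tensor `T_φ = 2 (∂_z² φ - (∂_z φ)²)` of a real potential `φ`. -/
def stressEnergy (φ : ℂ → ℝ) (z : ℂ) : ℂ :=
  2 * (dz (dz fun w => (φ w : ℂ)) z - (dz (fun w => (φ w : ℂ)) z) ^ 2)

/-! ### The constant curvature metric with three conical singularities -/

/-- The divisor `β₀ · 0 + β₁ · 1 + β_∞ · ∞` on the Riemann sphere. -/
structure TriDivisor where
  /-- the order at `0` -/
  b0 : ℝ
  /-- the order at `1` -/
  b1 : ℝ
  /-- the order at `∞` -/
  binf : ℝ

/-- The degree `|β| = β₀ + β₁ + β_∞`. -/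
def TriDivisor.degree (β : TriDivisor) : ℝ := β.b0 + β.b1 + β.binf

open Classical in
/-- The coefficient `β_p` of the divisor at the point `p` of the Riemann sphere. -/
def TriDivisor.at (β : TriDivisor) (p : OnePoint ℂ) : ℝ :=
  if p = ((0 : ℂ) : OnePoint ℂ) then β.b0
  else if p = ((1 : ℂ) : OnePoint ℂ) then β.b1
  else if p = ∞ then β.binf
  else 0

/-- The weight `𝔰_p = -β_p (2 + β_p)`. -/
def TriDivisor.weight (β : TriDivisor) (p : OnePoint ℂ) : ℝ := -β.at p * (2 + β.at p)

open Classical in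
/-- Schwarz's accessory parameters of the three-point metric:
`𝔥₀ = -𝔥₁ = (𝔰₀ + 𝔰₁ - 𝔰_∞) / 2` and `𝔥_∞ = (𝔰₁ + 𝔰_∞ - 𝔰₀) / 2`
(by convention `0` at the other points). -/
def TriDivisor.schwarzParam (β : TriDivisor) (p : OnePoint ℂ) : ℝ :=
  let s0 := β.weight ((0 : ℂ) : OnePoint ℂ)
  let s1 := β.weight ((1 : ℂ) : OnePoint ℂ)
  let sinf := β.weight ∞
  if p = ((0 : ℂ) : OnePoint ℂ) then (s0 + s1 - sinf) / 2
  else if p = ((1 : ℂ) : OnePoint ℂ) then -((s0 + s1 - sinf) / 2)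
  else if p = ∞ then (s1 + sinf - s0) / 2
  else 0

/-- `φ` is the potential of the unit area constant curvature metric `m_β = e^{2φ} |dz|²` on the
Riemann sphere that represents the divisor `β`: `φ` is smooth on `ℂ ∖ {0, 1}`, solves there the
Liouville equation with Gaussian curvature `2π(|β| + 2)`, and has conical singularities of orders
`β₀`, `β₁`, `β_∞` at `0`, `1`, `∞`. -/
structure IsTriPotential (β : TriDivisor) (φ : ℂ → ℝ) : Prop where
  smooth : ContDiffOn ℝ (⊤ : ℕ∞) φ {0, 1}ᶜ
  liouville : ∀ z : ℂ, z ≠ 0 → z ≠ 1 →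
    (Real.exp (-2 * φ z) : ℂ) * (-4 * dz (dzbar fun w => (φ w : ℂ)) z)
      = ((2 * Real.pi * (β.degree + 2) : ℝ) : ℂ)
  asymp_zero : ∃ φ0 : ℝ,
    Tendsto (fun z => φ z - β.b0 * Real.log ‖z‖) (𝓝[≠] (0 : ℂ)) (𝓝 φ0)
  asymp_one : ∃ φ1 : ℝ,
    Tendsto (fun z => φ z - β.b1 * Real.log ‖z - 1‖) (𝓝[≠] (1 : ℂ)) (𝓝 φ1)
  asymp_infty : ∃ φinf : ℝ,
    Tendsto (fun z => φ z + (β.binf + 2) * Real.log ‖z‖) (Bornology.cobounded ℂ) (𝓝 φinf)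
  area : ∫ z : ℂ, Real.exp (2 * φ z) = 1

/-! ### Rational functions as maps of the Riemann sphere -/

/-- The rational function `f` as a function on `ℂ` (meaningful off the poles). -/
def ratFun (f : RatFunc ℂ) (x : ℂ) : ℂ := f.eval (RingHom.id ℂ) x

/-- The map of the Riemann sphere `ℂ ∪ {∞}` to itself given by a rational function. -/
def sphereMap (f : RatFunc ℂ) : OnePoint ℂ → OnePoint ℂ
  | ∞ =>
    if f.denom.natDegree < f.num.natDegree then ∞
    else ((f.num.coeff f.denom.natDegree / f.denom.leadingCoeff : ℂ) : OnePoint ℂ)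
  | (a : ℂ) => if f.denom.eval a = 0 then ∞ else ((ratFun f a : ℂ) : OnePoint ℂ)

/-- The degree `max (deg P) (deg Q)` of `f = P / Q` with coprime `P`, `Q`. -/
def ratDegree (f : RatFunc ℂ) : ℕ := max f.num.natDegree f.denom.natDegree

/-- The local multiplicity of a nonconstant rational function `f = P / Q` at a point of the Riemann
sphere: the multiplicity of the pole, or the order of vanishing of
`f - v = (P - v Q) / Q` where `v` is the finite value of `f` at the point
(the order in `1 / x` if the point is `∞`). -/
def mult (f : RatFunc ℂ) (p : OnePoint ℂ) : ℕ :=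
  match p, sphereMap f p with
  | ∞, ∞ => f.num.natDegree - f.denom.natDegree
  | ∞, (v : ℂ) => f.denom.natDegree - (f.num - C v * f.denom).natDegree
  | (a : ℂ), ∞ => f.denom.rootMultiplicity a
  | (a : ℂ), (v : ℂ) => (f.num - C v * f.denom).rootMultiplicity a

/-- The ramification order of `f` at `p` (the local multiplicity is at least `1` for
nonconstant `f`). -/
def ramOrd (f : RatFunc ℂ) (p : OnePoint ℂ) : ℕ := mult f p - 1

/-- The set `{0, 1, ∞}` on the Riemann sphere. -/
def threePoints : Set (OnePoint ℂ) := {((0 : ℂ) : OnePoint ℂ), ((1 : ℂ) : OnePoint ℂ), ∞}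

/-- The preimages `x_k` of the points `0`, `1`, `∞` under `f`. -/
def marked (f : RatFunc ℂ) : Set (OnePoint ℂ) := sphereMap f ⁻¹' threePoints

/-- `f` is a Belyi function on the Riemann sphere: a nonconstant rational function, unramified
outside of the preimages of `{0, 1, ∞}`. -/
def IsBelyi (f : RatFunc ℂ) : Prop :=
  1 ≤ ratDegree f ∧ ∀ p : OnePoint ℂ, sphereMap f p ∉ threePoints → ramOrd f p = 0

/-- `c` and `d` are the first two coefficients of the Taylor or Laurent expansion of `f` at `p`.
With `N = ramOrd f p + 1`:
`f(x) = c x^N (1 + (d/c) / x + O(x⁻²))` if `p = ∞` is a pole,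
`f(x) - v = c x^{-N} (1 + (d/c) / x + O(x⁻²))` if `p = ∞` and `f(∞) = v ≠ ∞`,
`f(x) = c (x - a)^{-N} (1 + (d/c) (x - a) + O((x - a)²))` if `p = a ≠ ∞` is a pole,
`f(x) - v = c (x - a)^N (1 + (d/c) (x - a) + O((x - a)²))` if `p = a ≠ ∞` and `f(a) = v ≠ ∞`. -/
def HasCoeffs (f : RatFunc ℂ) (p : OnePoint ℂ) (c d : ℂ) : Prop :=
  let N : ℤ := (ramOrd f p : ℤ) + 1
  c ≠ 0 ∧
  match p, sphereMap f p with
  | ∞, ∞ =>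
    (fun x : ℂ => ratFun f x - c * x ^ N * (1 + d / c * x⁻¹))
      =O[Bornology.cobounded ℂ] fun x : ℂ => x ^ (N - 2)
  | ∞, (v : ℂ) =>
    (fun x : ℂ => ratFun f x - v - c * x ^ (-N) * (1 + d / c * x⁻¹))
      =O[Bornology.cobounded ℂ] fun x : ℂ => x ^ (-N - 2)
  | (a : ℂ), ∞ =>
    (fun x : ℂ => ratFun f x - c * (x - a) ^ (-N) * (1 + d / c * (x - a)))
      =O[𝓝[≠] a] fun x : ℂ => (x - a) ^ (-N + 2)
  | (a : ℂ), (v : ℂ) =>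
    (fun x : ℂ => ratFun f x - v - c * (x - a) ^ N * (1 + d / c * (x - a)))
      =O[𝓝[≠] a] fun x : ℂ => (x - a) ^ (N + 2)

/-! ### The pullback metric -/

/-- The potential `f^*φ = φ ∘ f + log |f'|` of the pullback metric
`f^* m_β = e^{2 f^*φ} |dx|²`. -/
def pullPotential (f : RatFunc ℂ) (φ : ℂ → ℝ) (x : ℂ) : ℝ :=
  φ (ratFun f x) + Real.log ‖deriv (ratFun f) x‖

/-- The order `(f^*β)_p = (ord_p f + 1) (β_{f(p)} + 1) - 1` of the pullback metric at `p`. -/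
def pullOrder (f : RatFunc ℂ) (β : TriDivisor) (p : OnePoint ℂ) : ℝ :=
  ((ramOrd f p : ℝ) + 1) * (β.at (sphereMap f p) + 1) - 1

/-- The weight `s_p = -(f^*β)_p ((f^*β)_p + 2)` of the pullback metric at `p`. -/
def pullWeight (f : RatFunc ℂ) (β : TriDivisor) (p : OnePoint ℂ) : ℝ :=
  -pullOrder f β p * (pullOrder f β p + 2)

end ConicalSphere

end

open ConicalSphere

noncomputable section

namespace ConicalSphere

open scoped ComplexConjugate

/-! ### Wirtinger calculus -/

/-! The Liouville equation makes the stress-energy tensor `T_φ` holomorphic off the singularities: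
`∂∂̄φ = κ e^{2φ}` gives `∂̄T_φ = 0` (`differentiableAt_stressEnergy_of_liouville`). For three
conical points this determines `T_φ`. It has at most double poles at `0` and `1` and decays like
`z⁻²` at infinity, so `z²(z-1)²T_φ` is a quadratic polynomial, and its three coefficients are fixed
by the three leading coefficients `𝔰_j / 2` (`eq_triTensor_of_tendsto`). Schwarz's parameters are
then read off from partial fractions.

The analytic difficulty is the leading coefficients: the asymptotics of `φ` are only `C⁰`, while
`T_φ` involves two derivatives. Put `ψ(w) = φ(zw) + log|z|`, so that `z² T_φ(z) = T_ψ(1)`. As `z`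
tends to the singularity, `ψ` differs from `γ log|w| + const` by a uniformly small `u` on a fixed
disc, and `∂∂̄ψ` tends to `0` because the cone order exceeds `-1`. Averaging the holomorphic tensor
against a radial test function moves the linear derivatives of `u` onto the test function; the
quadratic term is controlled by a Caccioppoli estimate (`norm_integral_sq_dz_mul_bump_le`,
`stressEnergy_estimate`, `tendsto_sq_mul_stressEnergy`).

Pullback obeys `T_{f^*φ} = (T_φ ∘ f) f'² + S(f)` with `S` the Schwarzian (`stressEnergy_pull`). If
`f - v = (x-a)^N g(x)` with `g(a) ≠ 0`, expanding both terms gives the double and simple pole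
coefficients at `a` (`pullTensor_expansion`). Poles of `f` and the point `x = ∞` reduce to this case
by inversion, whose Schwarzian vanishes. Away from the marked points `f` is unramified, so the
tensor is holomorphic there; subtracting the principal parts leaves an entire function vanishing at
infinity, hence zero (`eq_sum_of_local_expansions`).

The number of marked points is a Riemann–Hurwitz count. With `f = P/Q`, each root of `PQ(P-Q)` has
multiplicity one more than in the Wronskian `P'Q - PQ'`, which has no other roots; comparing degrees
leaves `deg f + 1` finite marked points, besides `∞`. -/

theorem fderiv_apply_eq_dz_dzbar (g : ℂ → ℂ) (z v : ℂ) :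
    fderiv ℝ g z v = dz g z * v + dzbar g z * conj v := by
  have hv : v = v.re • (1 : ℂ) + v.im • Complex.I := by
    simp
  have hc : conj v = v.re - v.im * Complex.I := by
    apply Complex.ext <;> simp
  have h2 : v = v.re + v.im * Complex.I := (Complex.re_add_im v).symm
  have h1 : fderiv ℝ g z v = v.re * fderiv ℝ g z 1 + v.im * fderiv ℝ g z Complex.I := by
    conv_lhs => rw [hv]
    rw [map_add, _root_.map_smul, _root_.map_smul, Complex.real_smul, Complex.real_smul]
  rw [h1, dz, dzbar, hc]
  generalize (v.re : ℂ) = a at h2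
  generalize (v.im : ℂ) = b at h2
  rw [h2]
  linear_combination (b * fderiv ℝ g z Complex.I) * Complex.I_sq

theorem dz_congr {f g : ℂ → ℂ} {z : ℂ} (h : f =ᶠ[𝓝 z] g) : dz f z = dz g z := by
  simp [dz, h.fderiv_eq]

theorem dzbar_congr {f g : ℂ → ℂ} {z : ℂ} (h : f =ᶠ[𝓝 z] g) : dzbar f z = dzbar g z := by
  simp [dzbar, h.fderiv_eq]

section
variable {f g : ℂ → ℂ} {z : ℂ}

theorem dz_add (hf : DifferentiableAt ℝ f z) (hg : DifferentiableAt ℝ g z) :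
    dz (fun w => f w + g w) z = dz f z + dz g z := by
  simp only [dz, fderiv_fun_add hf hg, add_apply]; ring

theorem dz_mul (hf : DifferentiableAt ℝ f z) (hg : DifferentiableAt ℝ g z) :
    dz (fun w => f w * g w) z = dz f z * g z + f z * dz g z := by
  simp only [dz, fderiv_fun_mul hf hg, add_apply,
    smul_apply, smul_eq_mul]; ring

theorem dz_const (c : ℂ) : dz (fun _ => c) z = 0 := by simp [dz]

theorem dz_const_mul (c : ℂ) (hf : DifferentiableAt ℝ f z) :
    dz (fun w => c * f w) z = c * dz f z := by
  rw [dz_mul (by fun_prop) hf, dz_const]; ring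

theorem dzbar_add (hf : DifferentiableAt ℝ f z) (hg : DifferentiableAt ℝ g z) :
    dzbar (fun w => f w + g w) z = dzbar f z + dzbar g z := by
  simp only [dzbar, fderiv_fun_add hf hg, add_apply]; ring

theorem dzbar_sub (hf : DifferentiableAt ℝ f z) (hg : DifferentiableAt ℝ g z) :
    dzbar (fun w => f w - g w) z = dzbar f z - dzbar g z := by
  simp only [dzbar, fderiv_fun_sub hf hg, sub_apply]; ring

theorem dzbar_mul (hf : DifferentiableAt ℝ f z) (hg : DifferentiableAt ℝ g z) :
    dzbar (fun w => f w * g w) z = dzbar f z * g z + f z * dzbar g z := by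
  simp only [dzbar, fderiv_fun_mul hf hg, add_apply,
    smul_apply, smul_eq_mul]; ring

theorem dzbar_const (c : ℂ) : dzbar (fun _ => c) z = 0 := by simp [dzbar]

theorem dzbar_const_mul (c : ℂ) (hf : DifferentiableAt ℝ f z) :
    dzbar (fun w => c * f w) z = c * dzbar f z := by
  rw [dzbar_mul (by fun_prop) hf, dzbar_const]; ring

theorem fderiv_real_apply_of_differentiableAt (hf : DifferentiableAt ℂ f z) (v : ℂ) :
    fderiv ℝ f z v = deriv f z * v := by
  rw [hf.hasDerivAt.complexToReal_fderiv.fderiv]; simp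

theorem dz_of_differentiableAt (hf : DifferentiableAt ℂ f z) : dz f z = deriv f z := by
  simp only [dz, fderiv_real_apply_of_differentiableAt hf]
  linear_combination (-deriv f z / 2) * Complex.I_sq

theorem dzbar_of_differentiableAt (hf : DifferentiableAt ℂ f z) : dzbar f z = 0 := by
  simp only [dzbar, fderiv_real_apply_of_differentiableAt hf]
  linear_combination (deriv f z / 2) * Complex.I_sq

theorem differentiableAt_of_dzbar_eq_zero (hf : DifferentiableAt ℝ f z) (h : dzbar f z = 0) :
    DifferentiableAt ℂ f z := by
  rw [differentiableAt_complex_iff_differentiableAt_real]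
  refine ⟨hf, ?_⟩
  rw [fderiv_apply_eq_dz_dzbar, fderiv_apply_eq_dz_dzbar, h]
  simp [mul_comm]

theorem dz_comp_holomorphic (hg : DifferentiableAt ℝ g (f z)) (hf : DifferentiableAt ℂ f z) :
    dz (fun w => g (f w)) z = dz g (f z) * deriv f z := by
  have h : ∀ v, fderiv ℝ (fun w => g (f w)) z v = fderiv ℝ g (f z) (deriv f z * v) := fun v => by
    rw [← fderiv_real_apply_of_differentiableAt hf, ← ContinuousLinearMap.comp_apply,
      ← fderiv_comp z hg hf.real_of_complex]; rfl
  rw [dz, h, h, fderiv_apply_eq_dz_dzbar, fderiv_apply_eq_dz_dzbar]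
  simp only [map_mul, mul_one, Complex.conj_I]
  linear_combination (-dz g (f z) * deriv f z / 2 + dzbar g (f z) * conj (deriv f z) / 2) *
    Complex.I_sq

theorem dzbar_comp_holomorphic (hg : DifferentiableAt ℝ g (f z)) (hf : DifferentiableAt ℂ f z) :
    dzbar (fun w => g (f w)) z = dzbar g (f z) * conj (deriv f z) := by
  have h : ∀ v, fderiv ℝ (fun w => g (f w)) z v = fderiv ℝ g (f z) (deriv f z * v) := fun v => by
    rw [← fderiv_real_apply_of_differentiableAt hf, ← ContinuousLinearMap.comp_apply,
      ← fderiv_comp z hg hf.real_of_complex]; rfl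
  rw [dzbar, h, h, fderiv_apply_eq_dz_dzbar, fderiv_apply_eq_dz_dzbar]
  simp only [map_mul, mul_one, Complex.conj_I]
  linear_combination (dz g (f z) * deriv f z / 2 - dzbar g (f z) * conj (deriv f z) / 2) *
    Complex.I_sq

theorem dz_holomorphic_comp (hg : DifferentiableAt ℂ g (f z)) (hf : DifferentiableAt ℝ f z) :
    dz (fun w => g (f w)) z = deriv g (f z) * dz f z := by
  have h : ∀ v, fderiv ℝ (fun w => g (f w)) z v = deriv g (f z) * fderiv ℝ f z v := fun v => by
    rw [← fderiv_real_apply_of_differentiableAt hg, ← ContinuousLinearMap.comp_apply,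
      ← fderiv_comp z hg.real_of_complex hf]; rfl
  rw [dz, dz, h, h]; ring

theorem dz_conj (hf : DifferentiableAt ℝ f z) :
    dz (fun w => conj (f w)) z = conj (dzbar f z) := by
  have h : ∀ v, fderiv ℝ (fun w => conj (f w)) z v = conj (fderiv ℝ f z v) := fun v => by
    have := (Complex.conjCLE.toContinuousLinearMap.hasFDerivAt.comp z hf.hasFDerivAt).fderiv
    have h2 : fderiv ℝ (fun w => conj (f w)) z = _ := this
    rw [h2]; simp
  rw [dz, dzbar, h, h]
  simp [Complex.conj_ofNat, sub_eq_add_neg]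

theorem dzbar_eq_conj_dz_ofReal {φ : ℂ → ℝ} (hf : DifferentiableAt ℝ (fun w => (φ w : ℂ)) z) :
    dzbar (fun w => (φ w : ℂ)) z = conj (dz (fun w => (φ w : ℂ)) z) := by
  have := dz_conj hf
  simp only [Complex.conj_ofReal] at this
  rw [this, Complex.conj_conj]

theorem contDiffAt_dz {n m : WithTop ℕ∞} (hf : ContDiffAt ℝ n f z) (h : m + 1 ≤ n) :
    ContDiffAt ℝ m (dz f) z := by
  have := hf.fderiv_right h
  unfold dz
  fun_prop

theorem contDiffAt_dzbar {n m : WithTop ℕ∞} (hf : ContDiffAt ℝ n f z) (h : m + 1 ≤ n) :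
    ContDiffAt ℝ m (dzbar f) z := by
  have := hf.fderiv_right h
  unfold dzbar
  fun_prop

theorem dz_dzbar_comm (hf : ContDiffAt ℝ 2 f z) : dz (dzbar f) z = dzbar (dz f) z := by
  have hs : IsSymmSndFDerivAt ℝ f z := hf.isSymmSndFDerivAt (by simp)
  have hd : DifferentiableAt ℝ (fderiv ℝ f) z :=
    (hf.fderiv_right (m := 1) (by norm_num)).differentiableAt (by norm_num)
  have h : ∀ v w, fderiv ℝ (fun x => fderiv ℝ f x v) z w = fderiv ℝ (fderiv ℝ f) z w v := by
    intro v w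
    rw [fderiv_clm_apply hd (by fun_prop)]; simp
  have hd1 : ∀ v, DifferentiableAt ℝ (fun x => fderiv ℝ f x v) z := fun v => by fun_prop
  have e1 : ∀ w, fderiv ℝ (dzbar f) z w = (fderiv ℝ (fderiv ℝ f) z w 1 +
      Complex.I * fderiv ℝ (fderiv ℝ f) z w Complex.I) / 2 := by
    intro w
    unfold dzbar
    simp only [div_eq_mul_inv]
    rw [fderiv_mul_const (by fun_prop), fderiv_fun_add (by fun_prop) (by fun_prop),
      fderiv_const_mul (by fun_prop)]
    simp [h]; ring
  have e2 : ∀ w, fderiv ℝ (dz f) z w = (fderiv ℝ (fderiv ℝ f) z w 1 -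
      Complex.I * fderiv ℝ (fderiv ℝ f) z w Complex.I) / 2 := by
    intro w
    unfold dz
    simp only [div_eq_mul_inv]
    rw [fderiv_mul_const (by fun_prop), fderiv_fun_sub (by fun_prop) (by fun_prop),
      fderiv_const_mul (by fun_prop)]
    simp [h]; ring
  rw [dz, dzbar, e1, e1, e2, e2, hs.eq Complex.I 1]
  ring

theorem dz_log_norm (hz : z ≠ 0) : dz (fun w => ((Real.log ‖w‖ : ℝ) : ℂ)) z = 1 / (2 * z) := by
  have h1 : HasFDerivAt (fun w : ℂ => ‖w‖ ^ 2) (2 • innerSL ℝ z) z :=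
    (hasStrictFDerivAt_norm_sq z).hasFDerivAt
  have h2 := (h1.log (pow_ne_zero 2 (norm_ne_zero_iff.2 hz))).const_mul (1 / 2 : ℝ)
  have h3 := Complex.ofRealCLM.hasFDerivAt.comp z h2
  -- The squared norm is smooth with derivative `2⟨z, ·⟩`, so `log‖w‖` is differentiated as half of
  -- `log ‖w‖²`.
  have h4 : (fun w : ℂ => ((Real.log ‖w‖ : ℝ) : ℂ)) =
      Complex.ofRealCLM ∘ (fun w : ℂ => 1 / 2 * Real.log (‖w‖ ^ 2)) := by
    ext w; simp [Real.log_pow]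
  have h5 : ((‖z‖ ^ 2 : ℝ) : ℂ) = z * conj z := by
    rw [Complex.mul_conj, Complex.normSq_eq_norm_sq]
  have hc : conj z ≠ 0 := by simpa using hz
  have h6 : conj z = z.re - z.im * Complex.I := by apply Complex.ext <;> simp
  rw [dz, h4, h3.fderiv]
  simp [Complex.inner]
  simp only [← Complex.ofReal_pow, h5]
  field_simp
  rw [h6, mul_comm]

theorem contDiffAt_log_norm {n : WithTop ℕ∞} (hz : z ≠ 0) :
    ContDiffAt ℝ n (fun w => ((Real.log ‖w‖ : ℝ) : ℂ)) z := by
  have : ContDiffAt ℝ n (fun w : ℂ => Real.log ‖w‖) z :=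
    (contDiffAt_norm ℝ hz).log (norm_ne_zero_iff.2 hz)
  exact Complex.ofRealCLM.contDiff.contDiffAt.comp z this

end
end ConicalSphere
end

noncomputable section

namespace ConicalSphere

open scoped ComplexConjugate

/-! ### The transformation law of the stress-energy tensor -/

/-- The Schwarzian derivative `(f''/f')' - (f''/f')² / 2`. -/
def schwarzian (f : ℂ → ℂ) (x : ℂ) : ℂ :=
  deriv (logDeriv (deriv f)) x - logDeriv (deriv f) x ^ 2 / 2

theorem analyticAt_logDeriv {f : ℂ → ℂ} {x : ℂ} (hf : AnalyticAt ℂ f x) (h : f x ≠ 0) :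
    AnalyticAt ℂ (logDeriv f) x :=
  hf.deriv.div hf h

/-- The first derivative is `(∂φ ∘ f) f' + (1/2) f''/f'`. On differentiating again and subtracting
the square, the cross terms `∂φ(f) f''` cancel, and what involves `f''/f'` alone is the Schwarzian.
-/
theorem stressEnergy_pull {φ : ℂ → ℝ} {f : ℂ → ℂ} {x : ℂ}
    (hφ : ContDiffAt ℝ 2 (fun w => (φ w : ℂ)) (f x)) (hf : AnalyticAt ℂ f x)
    (hf' : deriv f x ≠ 0) :
    stressEnergy (fun w => φ (f w) + Real.log ‖deriv f w‖) x =
      stressEnergy φ (f x) * deriv f x ^ 2 + schwarzian f x := by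
  have hL : AnalyticAt ℂ (logDeriv (deriv f)) x := analyticAt_logDeriv hf.deriv hf'
  set Φ : ℂ → ℂ := fun w => (φ w : ℂ) with hΦ
  have h1 : ∀ᶠ w in 𝓝 x, dz (fun w => ((φ (f w) + Real.log ‖deriv f w‖ : ℝ) : ℂ)) w =
      dz Φ (f w) * deriv f w + (1 / 2) * logDeriv (deriv f) w := by
    have e1 : ∀ᶠ w in 𝓝 x, ContDiffAt ℝ 2 Φ (f w) :=
      hf.continuousAt.eventually (hφ.eventually (by simp))
    filter_upwards [e1, hf.eventually_analyticAt, hf.deriv.continuousAt.eventually_ne hf']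
      with w hw1 hw2 hw3
    have hd1 : DifferentiableAt ℝ Φ (f w) := hw1.differentiableAt (by simp)
    have hd2 : DifferentiableAt ℝ (fun w : ℂ => ((Real.log ‖w‖ : ℝ) : ℂ)) (deriv f w) :=
      (contDiffAt_log_norm (n := 1) hw3).differentiableAt (by simp)
    have e : (fun w => ((φ (f w) + Real.log ‖deriv f w‖ : ℝ) : ℂ)) =
        fun w => Φ (f w) + (fun w : ℂ => ((Real.log ‖w‖ : ℝ) : ℂ)) (deriv f w) := by
      ext w; simp [hΦ]
    rw [e, dz_add, dz_comp_holomorphic hd1 hw2.differentiableAt,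
      dz_comp_holomorphic hd2 hw2.deriv.differentiableAt, dz_log_norm hw3, logDeriv_apply]
    · field_simp
    · exact hd1.comp w hw2.differentiableAt.real_of_complex
    · exact hd2.comp w hw2.deriv.differentiableAt.real_of_complex
  have hdd : DifferentiableAt ℝ (dz Φ) (f x) :=
    (contDiffAt_dz hφ (m := 1) (by norm_num)).differentiableAt (by simp)
  have hA : DifferentiableAt ℝ (fun w => dz Φ (f w)) x :=
    hdd.comp x hf.differentiableAt.real_of_complex
  have hB : DifferentiableAt ℝ (deriv f) x := hf.deriv.differentiableAt.real_of_complex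
  have hC : DifferentiableAt ℝ (logDeriv (deriv f)) x := hL.differentiableAt.real_of_complex
  rw [stressEnergy, dz_congr h1, h1.self_of_nhds, dz_add (hA.fun_mul hB) (hC.const_mul _),
    dz_mul hA hB, dz_const_mul _ hC, dz_of_differentiableAt hL.differentiableAt,
    dz_of_differentiableAt hf.deriv.differentiableAt,
    dz_comp_holomorphic hdd hf.differentiableAt, stressEnergy, schwarzian]
  have : deriv (deriv f) x = logDeriv (deriv f) x * deriv f x := by
    rw [logDeriv_apply]; field_simp
  rw [this]
  ring

/-- Commuting derivatives, `∂̄∂²φ = ∂(κ e^{2φ}) = 2κ e^{2φ} ∂φ`, which is exactly `∂̄((∂φ)²)`. -/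
theorem differentiableAt_stressEnergy_of_liouville {φ : ℂ → ℝ} {z κ : ℂ}
    (hφ : ContDiffAt ℝ 4 (fun w => (φ w : ℂ)) z)
    (h : ∀ᶠ w in 𝓝 z, dz (dzbar fun w => (φ w : ℂ)) w = κ * Complex.exp (2 * φ w)) :
    DifferentiableAt ℂ (stressEnergy φ) z := by
  set Φ : ℂ → ℂ := fun w => (φ w : ℂ) with hΦ
  have hd1 : ContDiffAt ℝ 3 (dz Φ) z := contDiffAt_dz hφ (by norm_num)
  have hd2 : ContDiffAt ℝ 2 (dz (dz Φ)) z := contDiffAt_dz hd1 (by norm_num)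
  have hΦd : DifferentiableAt ℝ Φ z := hφ.differentiableAt (by simp)
  have h1 : DifferentiableAt ℝ (dz Φ) z := hd1.differentiableAt (by simp)
  have h2 : DifferentiableAt ℝ (dz (dz Φ)) z := hd2.differentiableAt (by simp)
  have e1 : dzbar (dz Φ) =ᶠ[𝓝 z] fun w => κ * Complex.exp (2 * Φ w) := by
    filter_upwards [h, hφ.eventually (by simp)] with w hw hw2
    rw [← hw, dz_dzbar_comm (hw2.of_le (by norm_num))]
  have e2 : dzbar (dz (dz Φ)) z = κ * Complex.exp (2 * Φ z) * (2 * dz Φ z) := by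
    rw [← dz_dzbar_comm (hd1.of_le (by norm_num)), dz_congr e1,
      dz_holomorphic_comp (g := fun w => κ * Complex.exp (2 * w)) (f := Φ) (by fun_prop) hΦd]
    have : HasDerivAt (fun w => κ * Complex.exp (2 * w)) (κ * (Complex.exp (2 * Φ z) * (2 * 1)))
      (Φ z) := (((hasDerivAt_id (Φ z)).const_mul 2).cexp).const_mul κ
    rw [this.deriv]; ring
  have hT : stressEnergy φ = fun w => 2 * (dz (dz Φ) w - dz Φ w * dz Φ w) := by
    ext w; simp [stressEnergy, hΦ, sq]
  rw [hT]
  refine differentiableAt_of_dzbar_eq_zero ((h2.fun_sub (h1.fun_mul h1)).const_mul 2) ?_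
  rw [dzbar_const_mul _ (h2.fun_sub (h1.fun_mul h1)), dzbar_sub h2 (h1.fun_mul h1), dzbar_mul h1 h1, e2,
    e1.self_of_nhds]
  ring

end ConicalSphere
end

noncomputable section

namespace ConicalSphere

open scoped ComplexConjugate
open MeasureTheory

/-! ### Integration by parts against test functions -/

section
variable {U : Set ℂ} {F χ : ℂ → ℂ}

/-- The function `F` may be arbitrary off `U`: there the product vanishes. This lets potentials that
are regular only on a disc enter integrals over the whole plane. -/
theorem continuous_mul_of_tsupport_subset (hU : IsOpen U) (hF : ∀ w ∈ U, ContinuousAt F w)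
    (hχ : Continuous χ) (hs : tsupport χ ⊆ U) : Continuous fun w => F w * χ w := by
  have hFo : ContinuousOn F U := fun w hw => (hF w hw).continuousWithinAt
  refine (hFo.mul hχ.continuousOn).continuous_of_tsupport_subset hU ?_
  exact (tsupport_mul_subset_right (f := F) (g := χ)).trans hs

theorem integrable_mul_of_tsupport_subset (hU : IsOpen U) (hF : ∀ w ∈ U, ContinuousAt F w)
    (hχ : Continuous χ) (hc : HasCompactSupport χ) (hs : tsupport χ ⊆ U) :
    Integrable fun w => F w * χ w :=
  (continuous_mul_of_tsupport_subset hU hF hχ hs).integrable_of_hasCompactSupport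
    (hc.mul_left (f := F))

theorem tsupport_fderiv_apply_subset' (v : ℂ) :
    tsupport (fun w => fderiv ℝ χ w v) ⊆ tsupport χ :=
  tsupport_fderiv_apply_subset ℝ v

theorem hasCompactSupport_fderiv_apply (hc : HasCompactSupport χ) (v : ℂ) :
    HasCompactSupport fun w => fderiv ℝ χ w v :=
  hc.mono' (subset_closure.trans (tsupport_fderiv_apply_subset' v))

theorem integral_fderiv_mul (hU : IsOpen U) (hF : ∀ w ∈ U, ContDiffAt ℝ 1 F w)
    (hχ : ContDiff ℝ 1 χ) (hc : HasCompactSupport χ) (hs : tsupport χ ⊆ U) (v : ℂ) :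
    Integrable (fun w => fderiv ℝ F w v * χ w) ∧ Integrable (fun w => F w * fderiv ℝ χ w v) ∧
    ∫ w, fderiv ℝ F w v * χ w = -∫ w, F w * fderiv ℝ χ w v := by
  have hχ' : Continuous fun w => fderiv ℝ χ w v :=
    (hχ.continuous_fderiv (by simp)).clm_apply continuous_const
  have hF' : ∀ w ∈ U, ContinuousAt (fun w => fderiv ℝ F w v) w := fun w hw =>
    (((hF w hw).fderiv_right (m := 0) (by simp)).clm_apply contDiffAt_const).continuousAt
  have i1 := integrable_mul_of_tsupport_subset hU hF' hχ.continuous hc hs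
  have i2 := integrable_mul_of_tsupport_subset hU (fun w hw => (hF w hw).continuousAt) hχ'
    (hasCompactSupport_fderiv_apply hc v) ((tsupport_fderiv_apply_subset' v).trans hs)
  refine ⟨i1, i2, ?_⟩
  rw [integral_mul_fderiv_eq_neg_fderiv_mul_of_integrable i1 i2
    (integrable_mul_of_tsupport_subset hU (fun w hw => (hF w hw).continuousAt)
      hχ.continuous hc hs)
    (fun w hw => (hF w (hs hw)).differentiableAt (by simp))
    (fun w _ => (hχ.differentiable (by simp)) w), neg_neg]

theorem integral_dz_mul (hU : IsOpen U) (hF : ∀ w ∈ U, ContDiffAt ℝ 1 F w)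
    (hχ : ContDiff ℝ 1 χ) (hc : HasCompactSupport χ) (hs : tsupport χ ⊆ U) :
    ∫ w, dz F w * χ w = -∫ w, F w * dz χ w := by
  obtain ⟨a1, b1, c1⟩ := integral_fderiv_mul hU hF hχ hc hs 1
  obtain ⟨a2, b2, c2⟩ := integral_fderiv_mul hU hF hχ hc hs Complex.I
  have e1 : (fun w => dz F w * χ w) = fun w => 2⁻¹ * (fderiv ℝ F w 1 * χ w) -
      Complex.I / 2 * (fderiv ℝ F w Complex.I * χ w) := by
    ext w; simp only [dz]; ring
  have e2 : (fun w => F w * dz χ w) = fun w => 2⁻¹ * (F w * fderiv ℝ χ w 1) -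
      Complex.I / 2 * (F w * fderiv ℝ χ w Complex.I) := by
    ext w; simp only [dz]; ring
  rw [e1, e2, integral_sub (a1.const_mul _) (a2.const_mul _),
    integral_sub (b1.const_mul _) (b2.const_mul _)]
  simp only [integral_const_mul, c1, c2]
  ring

theorem integral_dzbar_mul (hU : IsOpen U) (hF : ∀ w ∈ U, ContDiffAt ℝ 1 F w)
    (hχ : ContDiff ℝ 1 χ) (hc : HasCompactSupport χ) (hs : tsupport χ ⊆ U) :
    ∫ w, dzbar F w * χ w = -∫ w, F w * dzbar χ w := by
  obtain ⟨a1, b1, c1⟩ := integral_fderiv_mul hU hF hχ hc hs 1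
  obtain ⟨a2, b2, c2⟩ := integral_fderiv_mul hU hF hχ hc hs Complex.I
  have e1 : (fun w => dzbar F w * χ w) = fun w => 2⁻¹ * (fderiv ℝ F w 1 * χ w) +
      Complex.I / 2 * (fderiv ℝ F w Complex.I * χ w) := by
    ext w; simp only [dzbar]; ring
  have e2 : (fun w => F w * dzbar χ w) = fun w => 2⁻¹ * (F w * fderiv ℝ χ w 1) +
      Complex.I / 2 * (F w * fderiv ℝ χ w Complex.I) := by
    ext w; simp only [dzbar]; ring
  rw [e1, e2, integral_add (a1.const_mul _) (a2.const_mul _),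
    integral_add (b1.const_mul _) (b2.const_mul _)]
  simp only [integral_const_mul, c1, c2]
  ring

theorem tsupport_dz_subset : tsupport (dz χ) ⊆ tsupport χ := by
  refine closure_minimal (fun w hw => ?_) (isClosed_tsupport χ)
  by_contra h
  refine hw ?_
  have := dz_congr (notMem_tsupport_iff_eventuallyEq.1 h)
  rw [this]; exact dz_const 0

theorem tsupport_dzbar_subset : tsupport (dzbar χ) ⊆ tsupport χ := by
  refine closure_minimal (fun w hw => ?_) (isClosed_tsupport χ)
  by_contra h
  refine hw ?_
  have := dzbar_congr (notMem_tsupport_iff_eventuallyEq.1 h)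
  rw [this]; exact dzbar_const 0

theorem contDiff_dz {n m : WithTop ℕ∞} (h : ContDiff ℝ n χ) (hm : m + 1 ≤ n) :
    ContDiff ℝ m (dz χ) :=
  contDiff_iff_contDiffAt.2 fun _ => contDiffAt_dz h.contDiffAt hm

theorem contDiff_dzbar {n m : WithTop ℕ∞} (h : ContDiff ℝ n χ) (hm : m + 1 ≤ n) :
    ContDiff ℝ m (dzbar χ) :=
  contDiff_iff_contDiffAt.2 fun _ => contDiffAt_dzbar h.contDiffAt hm

theorem norm_integral_mul_le {a : ℝ} (hF : ∀ w ∈ U, ‖F w‖ ≤ a)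
    (hχ : Continuous χ) (hc : HasCompactSupport χ) (hs : tsupport χ ⊆ U) :
    ‖∫ w, F w * χ w‖ ≤ a * ∫ w, ‖χ w‖ := by
  rw [← integral_const_mul]
  refine norm_integral_le_of_norm_le
    ((hχ.integrable_of_hasCompactSupport hc).norm.const_mul a) (Eventually.of_forall fun w => ?_)
  by_cases hw : w ∈ U
  · rw [norm_mul]
    exact mul_le_mul_of_nonneg_right (hF w hw) (norm_nonneg _)
  · have : χ w = 0 := image_eq_zero_of_notMem_tsupport fun h => hw (hs h)
    simp [this]

end

/-! ### A radial test function at the point `1` -/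

/-- A smooth radial function with `dzbar bumpPot w = 8 (w - 1) bump w`, supported near `1`. -/
def bumpPot (w : ℂ) : ℂ := ((Real.smoothTransition (8 * ‖w - 1‖ ^ 2) - 1 : ℝ) : ℂ)

/-- A nonnegative smooth radial test function supported near `1`. -/
def bump (w : ℂ) : ℝ := deriv Real.smoothTransition (8 * ‖w - 1‖ ^ 2)

theorem contDiff_smoothTransition_top : ContDiff ℝ (⊤ : ℕ∞) Real.smoothTransition :=
  Real.smoothTransition.contDiff

theorem contDiff_bumpPot : ContDiff ℝ (⊤ : ℕ∞) bumpPot := by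
  have h1 : ContDiff ℝ (⊤ : ℕ∞) fun w : ℂ => 8 * ‖w - 1‖ ^ 2 := by
    have := (contDiff_id (𝕜 := ℝ) (E := ℂ)).sub (contDiff_const (c := (1 : ℂ))) (n := (⊤ : ℕ∞))
    exact contDiff_const.mul (this.norm_sq ℝ)
  exact Complex.ofRealCLM.contDiff.comp
    ((contDiff_smoothTransition_top.comp h1).sub contDiff_const)

theorem contDiff_bump : ContDiff ℝ (⊤ : ℕ∞) bump := by
  have h1 : ContDiff ℝ (⊤ : ℕ∞) fun w : ℂ => 8 * ‖w - 1‖ ^ 2 := by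
    have := (contDiff_id (𝕜 := ℝ) (E := ℂ)).sub (contDiff_const (c := (1 : ℂ))) (n := (⊤ : ℕ∞))
    exact contDiff_const.mul (this.norm_sq ℝ)
  have h2 : ContDiff ℝ (⊤ : ℕ∞) (deriv Real.smoothTransition) :=
    (contDiff_infty_iff_deriv.1 contDiff_smoothTransition_top).2
  exact h2.comp h1

theorem contDiff_bump_ofReal : ContDiff ℝ (⊤ : ℕ∞) fun w => (bump w : ℂ) :=
  Complex.ofRealCLM.contDiff.comp contDiff_bump

theorem bump_nonneg (w : ℂ) : 0 ≤ bump w :=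
  Real.smoothTransition.monotone.deriv_nonneg

/-- The transition function is constant beyond argument `1`, and `8 (3/8)² = 9/8`; the radius `3/8`
therefore contains both supports while staying below `1/2`. -/
theorem one_lt_of_notMem_closedBall {w : ℂ} (hw : w ∉ Metric.closedBall (1 : ℂ) (3 / 8)) :
    1 < 8 * ‖w - 1‖ ^ 2 := by
  simp only [Metric.mem_closedBall, dist_eq_norm, not_le] at hw
  nlinarith

theorem tsupport_bump : tsupport (fun w => (bump w : ℂ)) ⊆ Metric.closedBall 1 (3 / 8) := by
  refine closure_minimal (fun w hw => ?_) Metric.isClosed_closedBall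
  by_contra h
  refine hw ?_
  have h1 := one_lt_of_notMem_closedBall h
  have : Real.smoothTransition =ᶠ[𝓝 (8 * ‖w - 1‖ ^ 2)] fun _ => 1 := by
    filter_upwards [lt_mem_nhds h1] with s hs
    exact Real.smoothTransition.one_of_one_le hs.le
  simp [bump, this.deriv_eq]

theorem tsupport_bumpPot : tsupport bumpPot ⊆ Metric.closedBall 1 (3 / 8) := by
  refine closure_minimal (fun w hw => ?_) Metric.isClosed_closedBall
  by_contra h
  refine hw ?_
  simp [bumpPot, Real.smoothTransition.one_of_one_le (one_lt_of_notMem_closedBall h).le]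

theorem hasCompactSupport_bump : HasCompactSupport fun w => (bump w : ℂ) :=
  (isCompact_closedBall _ _).of_isClosed_subset (isClosed_tsupport _) tsupport_bump

theorem hasCompactSupport_bumpPot : HasCompactSupport bumpPot :=
  (isCompact_closedBall _ _).of_isClosed_subset (isClosed_tsupport _) tsupport_bumpPot

theorem closedBall_subset : Metric.closedBall (1 : ℂ) (3 / 8) ⊆ Metric.ball 1 (1 / 2) :=
  Metric.closedBall_subset_ball (by norm_num)

theorem dzbar_bumpPot (w : ℂ) : dzbar bumpPot w = 8 * (w - 1) * bump w := by
  have h1 : HasFDerivAt (fun w : ℂ => ‖w - 1‖ ^ 2) (2 • innerSL ℝ (w - 1)) w := by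
    have := ((hasStrictFDerivAt_norm_sq (w - 1)).hasFDerivAt).comp w
      ((hasFDerivAt_id (𝕜 := ℝ) w).sub_const 1)
    rwa [ContinuousLinearMap.comp_id] at this
  have h0 : HasDerivAt Real.smoothTransition (bump w) (8 * ‖w - 1‖ ^ 2) :=
    ((contDiff_smoothTransition_top.differentiable (by simp)) _).hasDerivAt
  have h2 := (h0.comp_hasFDerivAt w (h1.const_mul 8)).sub_const 1
  have h3 := Complex.ofRealCLM.hasFDerivAt.comp w h2
  have h4 : fderiv ℝ bumpPot w = _ := h3.fderiv
  have h6 : w - 1 = (w - 1).re + (w - 1).im * Complex.I := (Complex.re_add_im _).symm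
  rw [dzbar, h4]
  conv_rhs => rw [h6]
  simp [Complex.inner]
  ring

theorem integral_bump_pos : 0 < ∫ w, bump w := by
  -- The transition rises from `0` to `1` on the unit interval, so its slope is `1` at some `s`. The
  -- point at distance `√(s/8)` from the centre then has `bump` equal to `1`.
  obtain ⟨s, hs, hs'⟩ : ∃ s ∈ Set.Ioo (0 : ℝ) 1, deriv Real.smoothTransition s =
      (Real.smoothTransition 1 - Real.smoothTransition 0) / (1 - 0) :=
    exists_deriv_eq_slope _ one_pos Real.smoothTransition.continuous.continuousOn
      (contDiff_smoothTransition_top.differentiable (by simp)).differentiableOn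
  have hc : HasCompactSupport bump := by
    have h := hasCompactSupport_bump.comp_left (g := Complex.re) rfl
    simpa [Function.comp_def] using h
  refine contDiff_bump.continuous.integral_pos_of_hasCompactSupport_nonneg_nonzero hc
    bump_nonneg (x := 1 + (Real.sqrt (s / 8) : ℂ)) ?_
  have : (8 * ‖(1 + (Real.sqrt (s / 8) : ℂ)) - 1‖ ^ 2) = s := by
    rw [add_sub_cancel_left, Complex.norm_real, Real.norm_eq_abs, sq_abs,
      Real.sq_sqrt (by linarith [hs.1])]
    ring
  rw [bump, this, hs']
  simp

/-- A mean value property. Write `H - H(1) = (w-1) k` with `k` holomorphic; since `8(w-1) bump = ∂̄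
bumpPot`, integration by parts gives `∫ k ∂̄ bumpPot = -∫ (∂̄k) bumpPot = 0`. -/
theorem integral_holomorphic_mul_bump {H : ℂ → ℂ}
    (hH : DifferentiableOn ℂ H (Metric.ball 1 (1 / 2))) :
    ∫ w, H w * bump w = H 1 * ∫ w, (bump w : ℂ) := by
  have hU : IsOpen (Metric.ball (1 : ℂ) (1 / 2)) := Metric.isOpen_ball
  have h1 : (1 : ℂ) ∈ Metric.ball (1 : ℂ) (1 / 2) := by simp
  have hk : DifferentiableOn ℂ (dslope H 1) (Metric.ball 1 (1 / 2)) :=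
    (Complex.differentiableOn_dslope (hU.mem_nhds h1)).2 hH
  have hk' : ∀ w ∈ Metric.ball (1 : ℂ) (1 / 2), ContDiffAt ℝ 1 (dslope H 1) w := fun w hw =>
    (hk.analyticAt (hU.mem_nhds hw)).contDiffAt.restrict_scalars ℝ
  have e0 := integral_dzbar_mul hU hk' (contDiff_bumpPot.of_le (by simp))
    hasCompactSupport_bumpPot (tsupport_bumpPot.trans closedBall_subset)
  have e1 : (fun w => dzbar (dslope H 1) w * bumpPot w) = fun _ => 0 := by
    ext w
    by_cases hw : w ∈ Metric.ball (1 : ℂ) (1 / 2)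
    · rw [dzbar_of_differentiableAt (hk.differentiableAt (hU.mem_nhds hw)), zero_mul]
    · rw [image_eq_zero_of_notMem_tsupport
        fun h => hw (closedBall_subset (tsupport_bumpPot h)), mul_zero]
  have e2 : (fun w => dslope H 1 w * dzbar bumpPot w) =
      fun w => 8 * (H w * bump w - H 1 * bump w) := by
    ext w
    have := sub_smul_dslope H 1 w
    rw [smul_eq_mul] at this
    rw [dzbar_bumpPot]
    linear_combination (8 * (bump w : ℂ)) * this
  have hb := hasCompactSupport_bump
  have hbc : Continuous fun w => (bump w : ℂ) := contDiff_bump_ofReal.continuous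
  rw [e1, e2, integral_const_mul, integral_sub, integral_const_mul, integral_zero] at e0
  · linear_combination (1 / 8 : ℂ) * e0
  · exact integrable_mul_of_tsupport_subset hU
      (fun w hw => (hH.differentiableAt (hU.mem_nhds hw)).continuousAt) hbc hb
      (tsupport_bump.trans closedBall_subset)
  · exact (hbc.integrable_of_hasCompactSupport hb).const_mul _

end ConicalSphere
end

noncomputable section

namespace ConicalSphere

open scoped ComplexConjugate
open MeasureTheory

/-! ### Interior estimate for the stress-energy tensor -/

/-- A Caccioppoli estimate: for real `u`, `∂∂̄(u²) = 2|∂u|² + 2u ∂∂̄u`. Testing against `bump` and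
moving both derivatives of `u²` onto it bounds `∫ |∂u|² bump` by the sizes of `u` and `∂∂̄u` alone.
-/
theorem norm_integral_sq_dz_mul_bump_le : ∃ C : ℝ, 0 ≤ C ∧ ∀ (u : ℂ → ℝ) (ε δ : ℝ),
    (∀ w ∈ Metric.ball (1 : ℂ) (1 / 2), ContDiffAt ℝ 3 (fun w => (u w : ℂ)) w) →
    (∀ w ∈ Metric.ball (1 : ℂ) (1 / 2), |u w| ≤ ε) →
    (∀ w ∈ Metric.ball (1 : ℂ) (1 / 2), ‖dz (dzbar fun w => (u w : ℂ)) w‖ ≤ δ) →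
    ‖∫ w, (w ^ 2 * dz (fun w => (u w : ℂ)) w ^ 2) * bump w‖ ≤ C * (ε ^ 2 + ε * δ) := by
  set X : ℂ → ℂ := fun w => (bump w : ℂ) with hX
  have hXs : ContDiff ℝ (⊤ : ℕ∞) X := contDiff_bump_ofReal
  have hXc : HasCompactSupport X := hasCompactSupport_bump
  have hXt : tsupport X ⊆ Metric.ball 1 (1 / 2) := tsupport_bump.trans closedBall_subset
  have hU : IsOpen (Metric.ball (1 : ℂ) (1 / 2)) := Metric.isOpen_ball
  have hY1 : ContDiff ℝ 2 (dz X) := contDiff_dz (contDiff_infty.1 hXs 3) (by norm_num)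
  have hY : ContDiff ℝ 1 (dzbar (dz X)) := contDiff_dzbar hY1 (by norm_num)
  have hY1t : tsupport (dz X) ⊆ tsupport X := tsupport_dz_subset
  have hYt : tsupport (dzbar (dz X)) ⊆ tsupport X := tsupport_dzbar_subset.trans hY1t
  have hY1c : HasCompactSupport (dz X) := hXc.of_isClosed_subset (isClosed_tsupport _) hY1t
  have hYc : HasCompactSupport (dzbar (dz X)) :=
    hXc.of_isClosed_subset (isClosed_tsupport _) hYt
  refine ⟨9 / 4 * ((∫ w, ‖dzbar (dz X) w‖) + ∫ w, ‖X w‖), by positivity, ?_⟩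
  intro u ε δ hu hε hδ
  set V : ℂ → ℂ := fun w => (u w : ℂ) with hV
  have hε0 : 0 ≤ ε := (abs_nonneg _).trans (hε 1 (by simp))
  have hδ0 : 0 ≤ δ := (norm_nonneg _).trans (hδ 1 (by simp))
  have hu1 : ∀ w ∈ Metric.ball (1 : ℂ) (1 / 2), ContDiffAt ℝ 2 (dz V) w := fun w hw =>
    contDiffAt_dz (hu w hw) (by norm_num)
  have hu2 : ∀ w ∈ Metric.ball (1 : ℂ) (1 / 2), ContDiffAt ℝ 2 (dzbar V) w := fun w hw =>
    contDiffAt_dzbar (hu w hw) (by norm_num)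
  have hQ : ∀ w ∈ Metric.ball (1 : ℂ) (1 / 2), ContDiffAt ℝ 3 (fun w => V w * V w) w :=
    fun w hw => (hu w hw).mul (hu w hw)
  have hQ1 : ∀ w ∈ Metric.ball (1 : ℂ) (1 / 2),
      ContDiffAt ℝ 2 (dzbar fun w => V w * V w) w :=
    fun w hw => contDiffAt_dzbar (hQ w hw) (by norm_num)
  have key : ∀ w ∈ Metric.ball (1 : ℂ) (1 / 2), dz (dzbar fun w => V w * V w) w =
      2 * ((‖dz V w‖ ^ 2 : ℝ) : ℂ) + 2 * (V w * dz (dzbar V) w) := by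
    intro w hw
    have d1 : DifferentiableAt ℝ V w := (hu w hw).differentiableAt (by simp)
    have d2 : DifferentiableAt ℝ (dzbar V) w := (hu2 w hw).differentiableAt (by simp)
    have e : (dzbar fun w => V w * V w) =ᶠ[𝓝 w] fun w => 2 * (V w * dzbar V w) := by
      filter_upwards [hU.mem_nhds hw] with x hx
      have d : DifferentiableAt ℝ V x := (hu x hx).differentiableAt (by simp)
      rw [dzbar_mul d d]; ring
    rw [dz_congr e, dz_const_mul _ (d1.fun_mul d2), dz_mul d1 d2, dzbar_eq_conj_dz_ofReal d1,
      Complex.mul_conj, Complex.normSq_eq_norm_sq]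
    ring
  have i1 := integral_dz_mul hU (fun w hw => (hQ1 w hw).of_le (by norm_num))
    (hXs.of_le (by simp)) hXc hXt
  have i2 := integral_dzbar_mul hU (fun w hw => (hQ w hw).of_le (by norm_num))
    (hY1.of_le (by norm_num)) hY1c (hY1t.trans hXt)
  have hN : ∀ w ∈ Metric.ball (1 : ℂ) (1 / 2),
      ContinuousAt (fun w => ((‖dz V w‖ ^ 2 : ℝ) : ℂ)) w := fun w hw =>
    (Complex.continuous_ofReal.continuousAt).comp (((hu1 w hw).continuousAt.norm).pow 2)
  have hN1 := integrable_mul_of_tsupport_subset hU hN hXs.continuous hXc hXt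
  have hM : ∀ w ∈ Metric.ball (1 : ℂ) (1 / 2),
      ContinuousAt (fun w => V w * dz (dzbar V) w) w := fun w hw =>
    (hu w hw).continuousAt.mul (contDiffAt_dz (m := 1) (hu2 w hw) (by norm_num)).continuousAt
  have hM1 := integrable_mul_of_tsupport_subset hU hM hXs.continuous hXc hXt
  have e1 : (fun w => dz (dzbar fun w => V w * V w) w * X w) = fun w =>
      2 * (((‖dz V w‖ ^ 2 : ℝ) : ℂ) * X w) + 2 * ((V w * dz (dzbar V) w) * X w) := by
    ext w
    by_cases hw : w ∈ Metric.ball (1 : ℂ) (1 / 2)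
    · rw [key w hw]; ring
    · rw [image_eq_zero_of_notMem_tsupport (f := X) fun h => hw (hXt h)]; ring
  rw [e1, integral_add (hN1.const_mul _) (hM1.const_mul _), integral_const_mul,
    integral_const_mul] at i1
  have E : ∫ w, ((‖dz V w‖ ^ 2 : ℝ) : ℂ) * X w =
      1 / 2 * (∫ w, (V w * V w) * dzbar (dz X) w) - ∫ w, (V w * dz (dzbar V) w) * X w := by
    linear_combination (1 / 2 : ℂ) * i1 - (1 / 2 : ℂ) * i2
  have b1 : ‖∫ w, (V w * V w) * dzbar (dz X) w‖ ≤ ε ^ 2 * ∫ w, ‖dzbar (dz X) w‖ := by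
    refine norm_integral_mul_le (fun w hw => ?_) hY.continuous hYc (hYt.trans hXt)
    rw [norm_mul, sq]
    have : ‖V w‖ ≤ ε := by simpa [hV] using hε w hw
    gcongr
  have b2 : ‖∫ w, (V w * dz (dzbar V) w) * X w‖ ≤ (ε * δ) * ∫ w, ‖X w‖ := by
    refine norm_integral_mul_le (fun w hw => ?_) hXs.continuous hXc hXt
    rw [norm_mul]
    have : ‖V w‖ ≤ ε := by simpa [hV] using hε w hw
    have := hδ w hw
    gcongr
  -- The factor `9/4` bounds `‖w‖²` on the disc, where `‖w‖ ≤ 3/2`; nonnegativity of `bump` makes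
  -- the integral on the right its own absolute value.
  have b3 : ‖∫ w, (w ^ 2 * dz V w ^ 2) * X w‖ ≤
      9 / 4 * ‖∫ w, ((‖dz V w‖ ^ 2 : ℝ) : ℂ) * X w‖ := by
    have e3 : (fun w => ((‖dz V w‖ ^ 2 : ℝ) : ℂ) * X w) =
        fun w => ((‖dz V w‖ ^ 2 * bump w : ℝ) : ℂ) := by ext w; simp [hX]
    have hre : Integrable fun w => ‖dz V w‖ ^ 2 * bump w := by
      rw [e3] at hN1
      exact hN1.re
    rw [e3, integral_complex_ofReal, Complex.norm_real, Real.norm_of_nonneg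
      (integral_nonneg fun w => mul_nonneg (sq_nonneg _) (bump_nonneg w)), ← integral_const_mul]
    refine norm_integral_le_of_norm_le (hre.const_mul _) (Eventually.of_forall fun w => ?_)
    by_cases hw : w ∈ Metric.ball (1 : ℂ) (1 / 2)
    · have hw1 : ‖w‖ ≤ 3 / 2 := by
        rw [Metric.mem_ball, dist_eq_norm] at hw
        have := norm_le_norm_add_norm_sub' w 1
        simp at this
        linarith
      have hw2 : ‖w‖ ^ 2 ≤ 9 / 4 := by nlinarith [norm_nonneg w]
      have hb := bump_nonneg w
      rw [norm_mul, norm_mul, norm_pow, norm_pow, hX, Complex.norm_real,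
        Real.norm_of_nonneg hb, ← mul_assoc]
      gcongr
    · have : bump w = 0 := by
        have := image_eq_zero_of_notMem_tsupport (f := X) fun h => hw (hXt h)
        simpa [hX] using this
      simp [hX, this]
  refine b3.trans ?_
  rw [E]
  have t := norm_sub_le (1 / 2 * (∫ w, (V w * V w) * dzbar (dz X) w))
    (∫ w, (V w * dz (dzbar V) w) * X w)
  rw [norm_mul] at t
  norm_num at t
  have n1 : 0 ≤ ∫ w, ‖dzbar (dz X) w‖ := integral_nonneg fun _ => norm_nonneg _
  have n2 : 0 ≤ ∫ w, ‖X w‖ := integral_nonneg fun _ => norm_nonneg _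
  have p1 : 0 ≤ ε ^ 2 * ∫ w, ‖dzbar (dz X) w‖ := by positivity
  have p2 : 0 ≤ ε ^ 2 * ∫ w, ‖X w‖ := by positivity
  have p3 : 0 ≤ (ε * δ) * ∫ w, ‖dzbar (dz X) w‖ := by positivity
  norm_num
  linarith

/-- Interior stability of the model potential `γ log|w| + c`, whose tensor is `-γ(γ+2)/(2w²)`.
Holomorphy of the tensor upgrades uniform closeness of the potentials to closeness of the tensors at
`1`, by averaging against `bump`. The constant depends only on `γ`, which is what the rescaling
argument needs. -/
theorem stressEnergy_estimate (γ : ℝ) : ∃ C : ℝ, 0 ≤ C ∧ ∀ (ψ : ℂ → ℝ) (c ε δ : ℝ),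
    (∀ w ∈ Metric.ball (1 : ℂ) (1 / 2), ContDiffAt ℝ 3 (fun w => (ψ w : ℂ)) w) →
    DifferentiableOn ℂ (stressEnergy ψ) (Metric.ball (1 : ℂ) (1 / 2)) →
    (∀ w ∈ Metric.ball (1 : ℂ) (1 / 2), |ψ w - γ * Real.log ‖w‖ - c| ≤ ε) →
    (∀ w ∈ Metric.ball (1 : ℂ) (1 / 2), ‖dz (dzbar fun w => (ψ w : ℂ)) w‖ ≤ δ) →
    ‖stressEnergy ψ 1 + γ * (γ + 2) / 2‖ ≤ C * (ε + ε ^ 2 + ε * δ) := by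
  obtain ⟨C₀, hC₀, hest⟩ := norm_integral_sq_dz_mul_bump_le
  set X : ℂ → ℂ := fun w => (bump w : ℂ) with hX
  have hXs : ContDiff ℝ (⊤ : ℕ∞) X := contDiff_bump_ofReal
  have hXc : HasCompactSupport X := hasCompactSupport_bump
  have hXt : tsupport X ⊆ Metric.ball 1 (1 / 2) := tsupport_bump.trans closedBall_subset
  have hU : IsOpen (Metric.ball (1 : ℂ) (1 / 2)) := Metric.isOpen_ball
  set X1 : ℂ → ℂ := fun w => w * X w with hX1
  set X2 : ℂ → ℂ := fun w => w ^ 2 * X w with hX2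
  have hX1s : ContDiff ℝ (⊤ : ℕ∞) X1 := contDiff_id.mul hXs
  have hX2s : ContDiff ℝ (⊤ : ℕ∞) X2 := (contDiff_id.pow 2).mul hXs
  have hX1t : tsupport X1 ⊆ tsupport X := tsupport_mul_subset_right
  have hX2t : tsupport X2 ⊆ tsupport X := tsupport_mul_subset_right
  have hX1c : HasCompactSupport X1 := hXc.of_isClosed_subset (isClosed_tsupport _) hX1t
  have hX2c : HasCompactSupport X2 := hXc.of_isClosed_subset (isClosed_tsupport _) hX2t
  have hY1 : ContDiff ℝ 2 (dz X1) := contDiff_dz (contDiff_infty.1 hX1s 3) (by norm_num)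
  have hY1t : tsupport (dz X1) ⊆ tsupport X := tsupport_dz_subset.trans hX1t
  have hY1c : HasCompactSupport (dz X1) := hXc.of_isClosed_subset (isClosed_tsupport _) hY1t
  have hY2 : ContDiff ℝ 2 (dz X2) := contDiff_dz (contDiff_infty.1 hX2s 3) (by norm_num)
  have hY2t : tsupport (dz X2) ⊆ tsupport X := tsupport_dz_subset.trans hX2t
  have hY2c : HasCompactSupport (dz X2) := hXc.of_isClosed_subset (isClosed_tsupport _) hY2t
  have hZ : ContDiff ℝ 1 (dz (dz X2)) := contDiff_dz hY2 (by norm_num)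
  have hZt : tsupport (dz (dz X2)) ⊆ tsupport X := tsupport_dz_subset.trans hY2t
  have hZc : HasCompactSupport (dz (dz X2)) := hXc.of_isClosed_subset (isClosed_tsupport _) hZt
  set I : ℝ := ∫ w, bump w with hI
  have hIpos : 0 < I := integral_bump_pos
  have hIc : ∫ w, X w = (I : ℂ) := integral_ofReal
  refine ⟨(2 * (∫ w, ‖dz (dz X2) w‖) + 2 * |γ| * (∫ w, ‖dz X1 w‖) + 2 * C₀) / I,
    by positivity, ?_⟩
  intro ψ c ε δ hψ hT hε hδ
  have hball0 : ∀ w ∈ Metric.ball (1 : ℂ) (1 / 2), w ≠ 0 := by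
    rintro w hw rfl
    norm_num [Metric.mem_ball, dist_eq_norm] at hw
  set u : ℂ → ℝ := fun w => ψ w - γ * Real.log ‖w‖ - c with hu_def
  set V : ℂ → ℂ := fun w => (u w : ℂ) with hV
  set Ψ : ℂ → ℂ := fun w => (ψ w : ℂ) with hΨ
  have hΨV : Ψ = fun w => (V w + γ * ((Real.log ‖w‖ : ℝ) : ℂ)) + c := by
    ext w; simp [hΨ, hV, hu_def]; ring
  have hlog : ∀ w ∈ Metric.ball (1 : ℂ) (1 / 2), ∀ n : ℕ,
      ContDiffAt ℝ n (fun w : ℂ => ((Real.log ‖w‖ : ℝ) : ℂ)) w :=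
    fun w hw n => contDiffAt_log_norm (hball0 w hw)
  have hVs : ∀ w ∈ Metric.ball (1 : ℂ) (1 / 2), ContDiffAt ℝ 3 V w := by
    intro w hw
    have e : V = fun w => Ψ w - γ * ((Real.log ‖w‖ : ℝ) : ℂ) - c := by
      ext w; simp [hΨ, hV, hu_def]
    rw [e]
    exact ((hψ w hw).sub (contDiffAt_const.mul (hlog w hw 3))).sub contDiffAt_const
  have d1 : ∀ w ∈ Metric.ball (1 : ℂ) (1 / 2), dz Ψ w = dz V w + γ / 2 * w⁻¹ := by
    intro w hw
    have hv : DifferentiableAt ℝ V w := (hVs w hw).differentiableAt (by simp)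
    have hl : DifferentiableAt ℝ (fun w : ℂ => ((Real.log ‖w‖ : ℝ) : ℂ)) w :=
      (hlog w hw 1).differentiableAt (by simp)
    rw [hΨV, dz_add (hv.fun_add (hl.const_mul _)) (by fun_prop),
      dz_add hv (hl.const_mul _), dz_const_mul _ hl, dz_log_norm (hball0 w hw), dz_const]
    have := hball0 w hw
    field_simp
    ring
  have d2 : ∀ w ∈ Metric.ball (1 : ℂ) (1 / 2),
      dz (dz Ψ) w = dz (dz V) w - γ / 2 * (w ^ 2)⁻¹ := by
    intro w hw
    have e : dz Ψ =ᶠ[𝓝 w] fun w => dz V w + γ / 2 * w⁻¹ := by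
      filter_upwards [hU.mem_nhds hw] with x hx using d1 x hx
    have hv : DifferentiableAt ℝ (dz V) w :=
      (contDiffAt_dz (m := 2) (hVs w hw) (by norm_num)).differentiableAt (by simp)
    have hi : DifferentiableAt ℂ (fun w : ℂ => w⁻¹) w := differentiableAt_inv (hball0 w hw)
    rw [dz_congr e, dz_add hv (hi.real_of_complex.const_mul _),
      dz_const_mul _ hi.real_of_complex, dz_of_differentiableAt hi, deriv_inv]
    ring
  have d3 : ∀ w ∈ Metric.ball (1 : ℂ) (1 / 2), dz (dzbar V) w = dz (dzbar Ψ) w := by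
    intro w hw
    have hl2 : dz (dzbar fun w : ℂ => ((Real.log ‖w‖ : ℝ) : ℂ)) w = 0 := by
      rw [dz_dzbar_comm (hlog w hw 2)]
      have e : dz (fun w : ℂ => ((Real.log ‖w‖ : ℝ) : ℂ)) =ᶠ[𝓝 w] fun w => 1 / (2 * w) := by
        filter_upwards [hU.mem_nhds hw] with x hx using dz_log_norm (hball0 x hx)
      rw [dzbar_congr e, dzbar_of_differentiableAt]
      have := hball0 w hw
      exact (differentiableAt_const _).div (by fun_prop) (by simpa using this)
    have e : dzbar Ψ =ᶠ[𝓝 w]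
        fun w => dzbar V w + γ * dzbar (fun w : ℂ => ((Real.log ‖w‖ : ℝ) : ℂ)) w := by
      filter_upwards [hU.mem_nhds hw] with x hx
      have hv : DifferentiableAt ℝ V x := (hVs x hx).differentiableAt (by simp)
      have hl : DifferentiableAt ℝ (fun w : ℂ => ((Real.log ‖w‖ : ℝ) : ℂ)) x :=
        (hlog x hx 1).differentiableAt (by simp)
      rw [hΨV, dzbar_add (hv.fun_add (hl.const_mul _)) (by fun_prop),
        dzbar_add hv (hl.const_mul _), dzbar_const_mul _ hl, dzbar_const, add_zero]
    have hv : DifferentiableAt ℝ (dzbar V) w :=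
      (contDiffAt_dzbar (m := 2) (hVs w hw) (by norm_num)).differentiableAt (by simp)
    have hl : DifferentiableAt ℝ (dzbar fun w : ℂ => ((Real.log ‖w‖ : ℝ) : ℂ)) w :=
      (contDiffAt_dzbar (m := 1) (hlog w hw 2) (by norm_num)).differentiableAt (by simp)
    rw [dz_congr e, dz_add hv (hl.const_mul _), dz_const_mul _ hl, hl2]
    ring
  set H : ℂ → ℂ := fun w => w ^ 2 * stressEnergy ψ w + γ * (γ + 2) / 2 with hH
  have hHd : DifferentiableOn ℂ H (Metric.ball 1 (1 / 2)) :=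
    ((differentiableOn_id.pow 2).mul hT).add_const _
  have mv := integral_holomorphic_mul_bump hHd
  -- With `ψ = γ log|w| + c + u`, the constant in `H` cancels the model tensor, leaving `2w²∂²u - 2γ
  -- w ∂u - 2w²(∂u)²`. The powers of `w` are absorbed in the test functions `X1` and `X2`.
  have eH : (fun w => H w * (bump w : ℂ)) = fun w =>
      2 * (dz (dz V) w * X2 w) - 2 * γ * (dz V w * X1 w) -
        2 * ((w ^ 2 * dz V w ^ 2) * X w) := by
    ext w
    by_cases hw : w ∈ Metric.ball (1 : ℂ) (1 / 2)
    · have h0 := hball0 w hw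
      simp only [hH, stressEnergy]
      rw [d2 w hw, d1 w hw]
      simp only [hX1, hX2, hX]
      field_simp
      ring
    · have h0 := image_eq_zero_of_notMem_tsupport (f := X) fun h => hw (hXt h)
      have h0' : (bump w : ℂ) = 0 := h0
      simp only [hX1, hX2, h0, h0']
      ring
  have hV1 : ∀ w ∈ Metric.ball (1 : ℂ) (1 / 2), ContDiffAt ℝ 1 (dz V) w := fun w hw =>
    contDiffAt_dz (hVs w hw) (by norm_num)
  have hVc : ∀ w ∈ Metric.ball (1 : ℂ) (1 / 2), ContinuousAt (dz (dz V)) w := fun w hw =>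
    (contDiffAt_dz (m := 0) (hV1 w hw) (by norm_num)).continuousAt
  have i1 := integrable_mul_of_tsupport_subset hU hVc hX2s.continuous hX2c (hX2t.trans hXt)
  have i2 := integrable_mul_of_tsupport_subset hU (fun w hw => (hV1 w hw).continuousAt)
    hX1s.continuous hX1c (hX1t.trans hXt)
  have i3 := integrable_mul_of_tsupport_subset (F := fun w => w ^ 2 * dz V w ^ 2) hU
    (fun w hw => (continuousAt_id.pow 2).mul ((hV1 w hw).continuousAt.pow 2))
    hXs.continuous hXc hXt
  have i4 : Integrable fun w => 2 * (dz (dz V) w * X2 w) - 2 * γ * (dz V w * X1 w) :=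
    (i1.const_mul _).sub (i2.const_mul _)
  rw [eH, integral_sub i4 (i3.const_mul _),
    integral_sub (i1.const_mul _) (i2.const_mul _), integral_const_mul, integral_const_mul,
    integral_const_mul] at mv
  have j1 := integral_dz_mul hU hV1 (hX2s.of_le (by simp)) hX2c (hX2t.trans hXt)
  have j2 := integral_dz_mul hU (fun w hw => (hVs w hw).of_le (by norm_num))
    (hY2.of_le (by norm_num)) hY2c (hY2t.trans hXt)
  have j3 := integral_dz_mul hU (fun w hw => (hVs w hw).of_le (by norm_num))
    (hX1s.of_le (by simp)) hX1c (hX1t.trans hXt)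
  have hVε : ∀ w ∈ Metric.ball (1 : ℂ) (1 / 2), ‖V w‖ ≤ ε := fun w hw => by
    change ‖((u w : ℝ) : ℂ)‖ ≤ ε
    rw [Complex.norm_real]
    exact hε w hw
  have k1 := norm_integral_mul_le hVε hZ.continuous hZc (hZt.trans hXt)
  have k2 := norm_integral_mul_le hVε hY1.continuous hY1c (hY1t.trans hXt)
  have k3 := hest u ε δ hVs hε (fun w hw => by
    have := hδ w hw
    rwa [← d3 w hw] at this)
  have hε0 : 0 ≤ ε := (abs_nonneg _).trans (hε 1 (by simp))
  have hδ0 : 0 ≤ δ := (norm_nonneg _).trans (hδ 1 (by simp))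
  have hH1 : H 1 = stressEnergy ψ 1 + γ * (γ + 2) / 2 := by simp [hH]
  change _ = H 1 * ∫ w, X w at mv
  rw [hIc, hH1, j1, j2, neg_neg, j3] at mv
  have mvn := congrArg norm mv
  rw [norm_mul, Complex.norm_real, Real.norm_of_nonneg hIpos.le] at mvn
  have t1 := norm_sub_le (2 * (∫ w, V w * dz (dz X2) w) - 2 * γ * -(∫ w, V w * dz X1 w))
    (2 * ∫ w, (w ^ 2 * dz V w ^ 2) * X w)
  have t2 := norm_sub_le (2 * (∫ w, V w * dz (dz X2) w)) (2 * γ * -(∫ w, V w * dz X1 w))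
  simp only [norm_mul, norm_neg, Complex.norm_ofNat, Complex.norm_real, Real.norm_eq_abs] at t1 t2
  rw [div_mul_eq_mul_div, le_div_iff₀ hIpos, ← mvn]
  have n1 : 0 ≤ ∫ w, ‖dz (dz X2) w‖ := integral_nonneg fun _ => norm_nonneg _
  have n2 : 0 ≤ ∫ w, ‖dz X1 w‖ := integral_nonneg fun _ => norm_nonneg _
  have k2' : 2 * |γ| * ‖∫ w, V w * dz X1 w‖ ≤ 2 * |γ| * (ε * ∫ w, ‖dz X1 w‖) := by gcongr
  have p1 : 0 ≤ (∫ w, ‖dz (dz X2) w‖) * (ε ^ 2 + ε * δ) := by positivity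
  have p2 : 0 ≤ |γ| * (∫ w, ‖dz X1 w‖) * (ε ^ 2 + ε * δ) := by positivity
  have p3 : 0 ≤ C₀ * ε := by positivity
  linarith

end ConicalSphere
end

noncomputable section

namespace ConicalSphere

open scoped ComplexConjugate

/-! ### The stress-energy tensor near a conical singularity -/

theorem schwarzian_const_mul (z w : ℂ) : schwarzian (fun x => z * x) w = 0 := by
  have h : deriv (fun x : ℂ => z * x) = fun _ => z := by ext x; simp
  rw [schwarzian, h, logDeriv_const]
  simp

/-- Blow-up by `w ↦ zw`. Hypothesis `hl` says that `l` is stable under the factors `w` near `1`, so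
one argument serves both `z → 0` and `z → ∞`. Hypothesis `h2` makes the curvature term `κ e^{2ψ}` of
the rescaled potential tend to `0`. -/
theorem tendsto_sq_mul_stressEnergy {l : Filter ℂ} {φ : ℂ → ℝ} {γ c : ℝ} {κ : ℂ}
    (hl : ∀ p : ℂ → Prop, (∀ᶠ z in l, p z) →
      ∀ᶠ z in l, ∀ w ∈ Metric.ball (1 : ℂ) (1 / 2), p (z * w))
    (hl0 : ∀ᶠ z in l, z ≠ 0)
    (hs : ∀ᶠ z in l, ContDiffAt ℝ 4 (fun w => (φ w : ℂ)) z)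
    (hL : ∀ᶠ z in l, dz (dzbar fun w => (φ w : ℂ)) z = κ * Complex.exp (2 * φ z))
    (h1 : Tendsto (fun z => φ z - γ * Real.log ‖z‖) l (𝓝 c))
    (h2 : Tendsto (fun z => φ z + Real.log ‖z‖) l atBot) :
    Tendsto (fun z => z ^ 2 * stressEnergy φ z) l (𝓝 (-(γ * (γ + 2) / 2))) := by
  obtain ⟨C, hC, hest⟩ := stressEnergy_estimate γ
  rw [Metric.tendsto_nhds]
  intro e he
  -- Since `η ≤ 1`, the error `C(η + η² + η·η)` is at most `3Cη`, which is below `e`.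
  set η : ℝ := min 1 (e / (4 * (C + 1))) with hη
  have hη0 : 0 < η := by positivity
  have hη1 : η ≤ 1 := min_le_left _ _
  have hη2 : η ≤ e / (4 * (C + 1)) := min_le_right _ _
  have hCη : C * (η + η ^ 2 + η * η) < e := by
    rw [le_div_iff₀ (by positivity)] at hη2
    have : η ^ 2 ≤ η := by nlinarith
    have : C * (η + η ^ 2 + η * η) ≤ C * (3 * η) := by gcongr; linarith
    nlinarith
  have q1 := hl _ (hs.and hL)
  have q2 := hl _ (h1.eventually (Metric.closedBall_mem_nhds c hη0))
  -- Evaluated at `zw`, the exponential carries a factor `‖w‖² ≥ 1/4`; the `4` compensates for it.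
  have h3 : Tendsto (fun z => ‖κ‖ * (4 * Real.exp (2 * (φ z + Real.log ‖z‖)))) l (𝓝 0) := by
    have := Real.tendsto_exp_atBot.comp ((tendsto_const_mul_atBot_of_pos two_pos).2 h2)
    simpa using (this.const_mul 4).const_mul ‖κ‖
  have q3 := hl _ (h3.eventually (ge_mem_nhds hη0))
  filter_upwards [q1, q2, q3, hl0] with z hz1 hz2 hz3 hz0
  have hU : IsOpen (Metric.ball (1 : ℂ) (1 / 2)) := Metric.isOpen_ball
  have h1U : (1 : ℂ) ∈ Metric.ball (1 : ℂ) (1 / 2) := by simp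
  have hball0 : ∀ w ∈ Metric.ball (1 : ℂ) (1 / 2), 1 / 2 ≤ ‖w‖ := by
    intro w hw
    rw [Metric.mem_ball', dist_eq_norm] at hw
    have := norm_le_norm_add_norm_sub' 1 w
    simp at this
    linarith
  set ψ : ℂ → ℝ := fun w => φ (z * w) + Real.log ‖z‖ with hψ
  set Φ : ℂ → ℂ := fun w => (φ w : ℂ) with hΦ
  have hmul : ∀ w : ℂ, DifferentiableAt ℂ (fun w => z * w) w := fun w => by fun_prop
  have hder : ∀ w : ℂ, deriv (fun w => z * w) w = z := fun w => by simp
  have hΨ : (fun w => (ψ w : ℂ)) = fun w => Φ (z * w) + ((Real.log ‖z‖ : ℝ) : ℂ) := by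
    ext w; simp [hψ, hΦ]
  have hΨs : ∀ w ∈ Metric.ball (1 : ℂ) (1 / 2), ContDiffAt ℝ 4 (fun w => (ψ w : ℂ)) w := by
    intro w hw
    rw [hΨ]
    exact ((hz1 w hw).1.comp w (contDiffAt_const.mul contDiffAt_id)).add contDiffAt_const
  have hΨL : ∀ w ∈ Metric.ball (1 : ℂ) (1 / 2),
      dz (dzbar fun w => (ψ w : ℂ)) w = κ * Complex.exp (2 * ψ w) := by
    intro w hw
    have e1 : (dzbar fun w => (ψ w : ℂ)) =ᶠ[𝓝 w] fun w => conj z * dzbar Φ (z * w) := by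
      filter_upwards [hU.mem_nhds hw] with x hx
      have d : DifferentiableAt ℝ Φ (z * x) := (hz1 x hx).1.differentiableAt (by simp)
      have d' : DifferentiableAt ℝ (fun w => Φ (z * w)) x :=
        d.comp x (hmul x).real_of_complex
      rw [hΨ, dzbar_add d' (by fun_prop), dzbar_const, dzbar_comp_holomorphic d (hmul x), hder]
      ring
    have d : DifferentiableAt ℝ (dzbar Φ) (z * w) :=
      (contDiffAt_dzbar (m := 3) (hz1 w hw).1 (by norm_num)).differentiableAt (by simp)
    have d' : DifferentiableAt ℝ (fun w => dzbar Φ (z * w)) w :=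
      d.comp w (hmul w).real_of_complex
    rw [dz_congr e1, dz_const_mul _ d', dz_comp_holomorphic d (hmul w), hder, (hz1 w hw).2]
    have : Complex.exp (2 * ψ w) = Complex.exp (2 * φ (z * w)) * (conj z * z) := by
      have e2 : Complex.exp ((Real.log ‖z‖ : ℝ) : ℂ) = ‖z‖ := by
        rw [← Complex.ofReal_exp, Real.exp_log (norm_pos_iff.2 hz0)]
      rw [hψ]
      push_cast
      rw [mul_add, Complex.exp_add, two_mul ((Real.log ‖z‖ : ℝ) : ℂ), Complex.exp_add, e2,
        mul_comm (conj z), Complex.mul_conj, Complex.normSq_eq_norm_sq]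
      push_cast
      ring
    rw [this]
    ring
  have hT : DifferentiableOn ℂ (stressEnergy ψ) (Metric.ball (1 : ℂ) (1 / 2)) := fun w hw =>
    (differentiableAt_stressEnergy_of_liouville (hΨs w hw)
      (by filter_upwards [hU.mem_nhds hw] with x hx using hΨL x hx)).differentiableWithinAt
  have hpull : stressEnergy ψ 1 = z ^ 2 * stressEnergy φ z := by
    have e1 : ψ = fun w => φ ((fun w => z * w) w) + Real.log ‖deriv (fun w => z * w) w‖ := by
      ext w; rw [hder]
    have h := (hz1 1 h1U).1
    rw [e1, stressEnergy_pull (h.of_le (by norm_num)) (by fun_prop) (by rwa [hder]), hder,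
      schwarzian_const_mul]
    simp only [mul_one]
    ring
  -- This additive constant turns `ψ(w) - γ log|w| - const` into `φ(zw) - γ log|zw| - c`.
  have hfin := hest ψ (c + (γ + 1) * Real.log ‖z‖) η η
    (fun w hw => (hΨs w hw).of_le (by norm_num)) hT (fun w hw => ?_) (fun w hw => ?_)
  · rw [dist_eq_norm, sub_neg_eq_add, ← hpull]
    exact hfin.trans_lt hCη
  · have := hz2 w hw
    have hw0 : w ≠ 0 := norm_pos_iff.1 (by linarith [hball0 w hw])
    rw [Real.dist_eq, norm_mul,
      Real.log_mul (norm_ne_zero_iff.2 hz0) (norm_ne_zero_iff.2 hw0)] at this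
    convert this using 2
    simp only [hψ]; ring
  · refine le_trans ?_ (hz3 w hw)
    have hw1 := hball0 w hw
    rw [hΨL w hw, norm_mul, Complex.norm_exp]
    gcongr
    have e1 : ((2 : ℂ) * ψ w).re = 2 * (φ (z * w) + Real.log ‖z‖) := by
      simp [hψ]
    rw [e1, norm_mul, Real.log_mul (norm_ne_zero_iff.2 hz0) (by positivity),
      ← add_assoc, mul_add 2 (_ + _), Real.exp_add, two_mul (Real.log ‖w‖), Real.exp_add,
      Real.exp_log (by linarith)]
    nlinarith [Real.exp_pos (2 * (φ (z * w) + Real.log ‖z‖)), mul_self_nonneg (‖w‖ - 1 / 2),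
      mul_le_mul hw1 hw1 (by norm_num) (by linarith)]

theorem eventually_ball_mul_nhdsNE (p : ℂ → Prop) (hp : ∀ᶠ z in 𝓝[≠] (0 : ℂ), p z) :
    ∀ᶠ z in 𝓝[≠] (0 : ℂ), ∀ w ∈ Metric.ball (1 : ℂ) (1 / 2), p (z * w) := by
  rw [eventually_nhdsWithin_iff, Metric.eventually_nhds_iff] at hp ⊢
  obtain ⟨r, hr, h⟩ := hp
  refine ⟨r / 2, by positivity, fun z hz hz0 w hw => h ?_ ?_⟩
  · rw [dist_zero_right] at hz ⊢
    rw [Metric.mem_ball, dist_eq_norm] at hw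
    have := norm_le_norm_add_norm_sub' w 1
    simp at this
    rw [norm_mul]
    nlinarith [norm_nonneg z, norm_nonneg w]
  · refine mul_ne_zero hz0 ?_
    rintro rfl
    norm_num [Metric.mem_ball, dist_eq_norm] at hw

theorem eventually_ball_mul_cobounded (p : ℂ → Prop)
    (hp : ∀ᶠ z in Bornology.cobounded ℂ, p z) :
    ∀ᶠ z in Bornology.cobounded ℂ, ∀ w ∈ Metric.ball (1 : ℂ) (1 / 2), p (z * w) := by
  rw [← comap_norm_atTop, eventually_comap] at hp ⊢
  obtain ⟨r, hr⟩ := eventually_atTop.1 hp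
  filter_upwards [eventually_ge_atTop (2 * |r|)] with b hb z hz w hw
  refine hr ‖z * w‖ ?_ (z * w) rfl
  rw [Metric.mem_ball', dist_eq_norm] at hw
  have := norm_le_norm_add_norm_sub' 1 w
  simp at this
  rw [norm_mul, hz]
  nlinarith [le_abs_self r, abs_nonneg r]

end ConicalSphere
end

noncomputable section

namespace ConicalSphere

open scoped ComplexConjugate

/-! ### Entire extensions -/

/-- Boundedness makes each singularity removable. The induction redefines `D` at one point at a time
by its limit there, which leaves the germs at the other points unchanged. -/
theorem exists_entire_extension (S : Finset ℂ) : ∀ (D : ℂ → ℂ),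
    (∀ z ∉ S, DifferentiableAt ℂ D z) →
    (∀ a ∈ S, D =O[𝓝[≠] a] fun _ => (1 : ℂ)) →
    ∃ E : ℂ → ℂ, Differentiable ℂ E ∧ ∀ z ∉ S, E z = D z := by
  induction S using Finset.induction_on with
  | empty => exact fun D hD _ => ⟨D, fun z => hD z (by simp), fun _ _ => rfl⟩
  | insert a S ha ih =>
    intro D hD hb
    have hnear : ∀ᶠ z in 𝓝[≠] a, DifferentiableAt ℂ D z := by
      have h1 : ∀ᶠ z in 𝓝 a, z ∉ S :=
        (S.finite_toSet.isClosed.isOpen_compl).mem_nhds (by simpa using ha)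
      filter_upwards [nhdsWithin_le_nhds h1, self_mem_nhdsWithin] with z hz1 hz2
      exact hD z (by simpa using ⟨hz2, hz1⟩)
    have hbd : IsBoundedUnder (· ≤ ·) (𝓝[≠] a) fun z => ‖D z - D a‖ := by
      have h := (hb a (by simp)).sub (isBigO_const_const (D a) (one_ne_zero (α := ℂ)) (𝓝[≠] a))
      exact (isBigO_one_iff ℂ).1 h
    have hlim := Complex.tendsto_limUnder_of_differentiable_on_punctured_nhds_of_bounded_under
      hnear hbd
    set D' := Function.update D a (limUnder (𝓝[≠] a) D) with hD'
    have heq : ∀ z ≠ a, D' =ᶠ[𝓝 z] D := fun z hz => by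
      filter_upwards [isOpen_ne.mem_nhds hz] with x hx
      exact Function.update_of_ne hx _ _
    have hDa : DifferentiableAt ℂ D' a := by
      refine (Complex.analyticAt_of_differentiable_on_punctured_nhds_of_continuousAt
        ?_ ?_).differentiableAt
      · filter_upwards [hnear, self_mem_nhdsWithin] with z hz1 hz2
        exact hz1.congr_of_eventuallyEq (heq z hz2)
      · exact continuousAt_update_same.2 hlim
    have h1 : ∀ z ∉ S, DifferentiableAt ℂ D' z := fun z hz => by
      by_cases hza : z = a
      · exact hza ▸ hDa
      · exact (hD z (by simpa using ⟨hza, hz⟩)).congr_of_eventuallyEq (heq z hza)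
    have h2 : ∀ b ∈ S, D' =O[𝓝[≠] b] fun _ => (1 : ℂ) := fun b hbS => by
      have hba : b ≠ a := fun h => ha (h ▸ hbS)
      have h3 : D =ᶠ[𝓝[≠] b] D' := nhdsWithin_le_nhds (heq b hba).symm
      exact (hb b (by simp [hbS])).congr' h3 EventuallyEq.rfl
    obtain ⟨E, hE, hEq⟩ := ih D' h1 h2
    refine ⟨E, hE, fun z hz => ?_⟩
    simp only [Finset.mem_insert, not_or] at hz
    rw [hEq z hz.2, hD', Function.update_of_ne hz.1]

/-! ### The stress-energy tensor of the three-point metric -/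

theorem stressEnergy_translate {φ : ℂ → ℝ} {a z : ℂ}
    (h : ContDiffAt ℝ 2 (fun w => (φ w : ℂ)) (a + z)) :
    stressEnergy (fun w => φ (a + w)) z = stressEnergy φ (a + z) := by
  have hd : deriv (fun x => a + x) = fun _ : ℂ => (1 : ℂ) := by ext x; simp
  have e : (fun w => φ (a + w)) =
      fun w => φ ((fun x => a + x) w) + Real.log ‖deriv (fun x => a + x) w‖ := by
    ext w; simp [hd]
  have hs : schwarzian (fun x => a + x) z = 0 := by
    rw [schwarzian, hd, logDeriv_const]; simp
  rw [e, stressEnergy_pull h (by fun_prop) (by simp [hd]), hs, hd]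
  simp

/-- The stress-energy tensor of the metric with weights `s0`, `s1`, `sinf` at `0`, `1`, `∞`. -/
def triTensor (s0 s1 sinf z : ℂ) : ℂ :=
  (sinf * z ^ 2 + (s1 - sinf - s0) * z + s0) / (2 * z ^ 2 * (z - 1) ^ 2)

/-- The function `z²(z-1)²T` extends to an entire function of quadratic growth, hence a quadratic
polynomial. Its values at `0` and `1` and its leading coefficient are the three limits. -/
theorem eq_triTensor_of_tendsto {T : ℂ → ℂ} {s0 s1 sinf : ℂ}
    (hT : ∀ z, z ≠ 0 → z ≠ 1 → DifferentiableAt ℂ T z)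
    (h0 : Tendsto (fun z => z ^ 2 * T z) (𝓝[≠] 0) (𝓝 (s0 / 2)))
    (h1 : Tendsto (fun z => z ^ 2 * T (1 + z)) (𝓝[≠] 0) (𝓝 (s1 / 2)))
    (hinf : Tendsto (fun z => z ^ 2 * T z) (Bornology.cobounded ℂ) (𝓝 (sinf / 2)))
    {z : ℂ} (hz0 : z ≠ 0) (hz1 : z ≠ 1) : T z = triTensor s0 s1 sinf z := by
  set D : ℂ → ℂ := fun z => z ^ 2 * (z - 1) ^ 2 * T z with hD
  have l0 : Tendsto D (𝓝[≠] 0) (𝓝 (s0 / 2)) := by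
    have : Tendsto (fun z : ℂ => (z - 1) ^ 2) (𝓝[≠] 0) (𝓝 1) := by
      have : ContinuousAt (fun z : ℂ => (z - 1) ^ 2) 0 := by fun_prop
      simpa using this.tendsto.mono_left nhdsWithin_le_nhds
    simpa [hD, mul_comm, mul_left_comm, mul_assoc] using this.mul h0
  have l1 : Tendsto D (𝓝[≠] 1) (𝓝 (s1 / 2)) := by
    have h1' : Tendsto (fun z => (z - 1) ^ 2 * T z) (𝓝[≠] 1) (𝓝 (s1 / 2)) := by
      have ht : Tendsto (fun z : ℂ => z - 1) (𝓝[≠] 1) (𝓝[≠] 0) := by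
        refine tendsto_nhdsWithin_iff.2 ⟨?_, ?_⟩
        · have : ContinuousAt (fun z : ℂ => z - 1) 1 := by fun_prop
          simpa using this.tendsto.mono_left nhdsWithin_le_nhds
        · filter_upwards [self_mem_nhdsWithin] with z hz
          exact sub_ne_zero.2 hz
      have := h1.comp ht
      simpa [Function.comp_def] using this
    have : Tendsto (fun z : ℂ => z ^ 2) (𝓝[≠] 1) (𝓝 1) := by
      have : ContinuousAt (fun z : ℂ => z ^ 2) 1 := by fun_prop
      simpa using this.tendsto.mono_left nhdsWithin_le_nhds
    simpa [hD, mul_comm, mul_left_comm, mul_assoc] using this.mul h1'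
  obtain ⟨E, hE, hEq⟩ := exists_entire_extension {0, 1} D (fun z hz => by
      simp only [Finset.mem_insert, Finset.mem_singleton, not_or] at hz
      have := hT z hz.1 hz.2
      fun_prop)
    (fun a ha => by
      simp only [Finset.mem_insert, Finset.mem_singleton] at ha
      rcases ha with rfl | rfl
      · exact l0.isBigO_one ℂ
      · exact l1.isBigO_one ℂ)
  have hEq' : ∀ z, z ≠ 0 → z ≠ 1 → E z = D z := fun z h0 h1 => hEq z (by simp [h0, h1])
  have E0 : E 0 = s0 / 2 := by
    refine tendsto_nhds_unique (hE.continuous.continuousAt.tendsto.mono_left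
      (nhdsWithin_le_nhds (s := {0}ᶜ))) (l0.congr' ?_)
    filter_upwards [self_mem_nhdsWithin, nhdsWithin_le_nhds (isOpen_ne.mem_nhds zero_ne_one)]
      with x hx0 hx1 using (hEq' x hx0 hx1).symm
  have E1 : E 1 = s1 / 2 := by
    refine tendsto_nhds_unique (hE.continuous.continuousAt.tendsto.mono_left
      (nhdsWithin_le_nhds (s := {1}ᶜ))) (l1.congr' ?_)
    filter_upwards [self_mem_nhdsWithin, nhdsWithin_le_nhds (isOpen_ne.mem_nhds one_ne_zero)]
      with x hx0 hx1 using (hEq' x hx1 hx0).symm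
  -- The second divided difference: `E` equals its linear interpolant at `0` and `1` plus `z(z-1)
  -- k`. It is entire with limit `sinf / 2` at infinity, hence constant.
  set k : ℂ → ℂ := dslope (dslope E 0) 1 with hk
  have hkd : Differentiable ℂ k := by
    rw [← differentiableOn_univ] at hE ⊢
    rw [hk, Complex.differentiableOn_dslope univ_mem, Complex.differentiableOn_dslope univ_mem]
    exact hE
  have hform : ∀ z, z ≠ 0 → z ≠ 1 →
      k z = ((E z - E 0) * z⁻¹ - (E 1 - E 0)) * (z - 1)⁻¹ := by
    intro z hz0 hz1
    rw [hk, dslope_of_ne _ hz1, slope_def_field, dslope_of_ne _ hz0, slope_def_field,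
      dslope_of_ne _ one_ne_zero, slope_def_field]
    simp [div_eq_mul_inv]
  have hinv : Tendsto (fun z : ℂ => z⁻¹) (Bornology.cobounded ℂ) (𝓝 0) :=
    tendsto_inv₀_cobounded
  have hne : ∀ a : ℂ, ∀ᶠ z in Bornology.cobounded ℂ, z ≠ a :=
    fun a => Bornology.eventually_ne_cobounded a
  have hklim : Tendsto k (Bornology.cobounded ℂ) (𝓝 (sinf / 2)) := by
    have hsub : Tendsto (fun z : ℂ => (1 - z⁻¹)) (Bornology.cobounded ℂ) (𝓝 1) := by
      simpa using hinv.const_sub 1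
    have hsubi : Tendsto (fun z : ℂ => (1 - z⁻¹)⁻¹) (Bornology.cobounded ℂ) (𝓝 1) := by
      simpa using hsub.inv₀ one_ne_zero
    have t1 := hsub.mul hinf
    have t2 := (hinv.mul (hinv.mul hsubi)).const_mul (E 0)
    have t3 := (hinv.mul hsubi).const_mul (E 1 - E 0)
    have t := (t1.sub t2).sub t3
    simp only [one_mul, mul_zero, zero_mul, sub_zero] at t
    refine t.congr' ?_
    filter_upwards [hne 0, hne 1] with z hz0 hz1
    rw [hform z hz0 hz1, hEq' z hz0 hz1]
    have h1 : z - 1 ≠ 0 := sub_ne_zero.2 hz1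
    have h2 : (1 - z⁻¹)⁻¹ = z * (z - 1)⁻¹ := by
      rw [show 1 - z⁻¹ = (z - 1) * z⁻¹ by field_simp, mul_inv, inv_inv, mul_comm]
    rw [h2]
    simp only [hD]
    field_simp
  have hkc : k z = sinf / 2 := by
    rw [Metric.cobounded_eq_cocompact] at hklim
    exact hkd.apply_eq_of_tendsto_cocompact z hklim
  have h1 : z - 1 ≠ 0 := sub_ne_zero.2 hz1
  rw [hform z hz0 hz1, hEq' z hz0 hz1, E0, E1] at hkc
  simp only [hD] at hkc
  rw [triTensor]
  field_simp at hkc ⊢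
  linear_combination hkc

theorem IsTriPotential.stressEnergy_eq {β : TriDivisor} {φ : ℂ → ℝ} (hφ : IsTriPotential β φ)
    (hb0 : -1 < β.b0) (hb1 : -1 < β.b1) (hbinf : -1 < β.binf)
    {z : ℂ} (hz0 : z ≠ 0) (hz1 : z ≠ 1) :
    stressEnergy φ z = triTensor (-β.b0 * (2 + β.b0)) (-β.b1 * (2 + β.b1))
      (-β.binf * (2 + β.binf)) z := by
  have hop : IsOpen ({0, 1}ᶜ : Set ℂ) := (Set.toFinite _).isClosed.isOpen_compl
  set κ : ℂ := -((2 * Real.pi * (β.degree + 2) : ℝ) : ℂ) / 4 with hκ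
  have hs : ∀ z : ℂ, z ≠ 0 → z ≠ 1 → ContDiffAt ℝ 4 (fun w => (φ w : ℂ)) z := by
    intro z h0 h1
    have : ContDiffAt ℝ 4 φ z := by
      have hmem : z ∈ ({0, 1}ᶜ : Set ℂ) := by simp [h0, h1]
      exact contDiffAt_infty.1 (hφ.smooth.contDiffAt (hop.mem_nhds hmem)) 4
    exact Complex.ofRealCLM.contDiff.contDiffAt.comp z this
  have hL : ∀ z : ℂ, z ≠ 0 → z ≠ 1 →
      dz (dzbar fun w => (φ w : ℂ)) z = κ * Complex.exp (2 * φ z) := by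
    intro z h0 h1
    have h := hφ.liouville z h0 h1
    have e : Complex.exp (2 * φ z) * (Real.exp (-2 * φ z) : ℂ) = 1 := by
      rw [Complex.ofReal_exp, ← Complex.exp_add]; simp
    rw [hκ, ← h]
    linear_combination (-dz (dzbar fun w => (φ w : ℂ)) z) * e
  have hne : ∀ a : ℂ, ∀ᶠ z in Bornology.cobounded ℂ, z ≠ a :=
    fun a => Bornology.eventually_ne_cobounded a
  have hlog0 : Tendsto (fun z : ℂ => Real.log ‖z‖) (𝓝[≠] 0) atBot :=
    Real.tendsto_log_nhdsGT_zero.comp tendsto_norm_nhdsNE_zero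
  have hloginf : Tendsto (fun z : ℂ => Real.log ‖z‖) (Bornology.cobounded ℂ) atTop :=
    Real.tendsto_log_atTop.comp tendsto_norm_cobounded_atTop
  have hn1 : ∀ᶠ z in 𝓝[≠] (0 : ℂ), z ≠ 1 :=
    nhdsWithin_le_nhds (isOpen_ne.mem_nhds zero_ne_one)
  refine eq_triTensor_of_tendsto (fun z h0 h1 => ?_) ?_ ?_ ?_ hz0 hz1
  · refine differentiableAt_stressEnergy_of_liouville (hs z h0 h1) (κ := κ) ?_
    filter_upwards [isOpen_ne.mem_nhds h0, isOpen_ne.mem_nhds h1] with x hx0 hx1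
    exact hL x hx0 hx1
  · obtain ⟨c, hc⟩ := hφ.asymp_zero
    have h := tendsto_sq_mul_stressEnergy (κ := κ) eventually_ball_mul_nhdsNE
      self_mem_nhdsWithin
      (by filter_upwards [self_mem_nhdsWithin, hn1] with x h0 h1 using hs x h0 h1)
      (by filter_upwards [self_mem_nhdsWithin, hn1] with x h0 h1 using hL x h0 h1) hc
      (by
        -- Here `φ + log|z|` behaves like `(1 + β₀) log|z|`, which tends to `-∞` precisely because
        -- `β₀ > -1`.
        have := hc.add_atBot (hlog0.const_mul_atBot (by linarith : 0 < 1 + β.b0))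
        refine this.congr fun z => ?_
        ring)
    convert h using 2; ring
  · obtain ⟨c, hc⟩ := hφ.asymp_one
    have h01 : ∀ x : ℂ, x ≠ 0 → 1 + x ≠ 1 := fun x hx h => hx (by simpa using h)
    have hn1' : ∀ᶠ z in 𝓝[≠] (0 : ℂ), 1 + z ≠ 0 := by
      have : ContinuousAt (fun z : ℂ => 1 + z) 0 := by fun_prop
      exact nhdsWithin_le_nhds (this.eventually_ne (by simp))
    have hc' : Tendsto (fun z => φ (1 + z) - β.b1 * Real.log ‖z‖) (𝓝[≠] 0) (𝓝 c) := by
      have ht : Tendsto (fun z : ℂ => 1 + z) (𝓝[≠] 0) (𝓝[≠] 1) := by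
        refine tendsto_nhdsWithin_iff.2 ⟨?_, ?_⟩
        · have : ContinuousAt (fun z : ℂ => 1 + z) 0 := by fun_prop
          simpa using this.tendsto.mono_left nhdsWithin_le_nhds
        · filter_upwards [self_mem_nhdsWithin] with z hz using h01 z hz
      simpa [Function.comp_def] using hc.comp ht
    have hmul : ∀ w : ℂ, DifferentiableAt ℂ (fun w => 1 + w) w := fun w => by fun_prop
    have hder : ∀ w : ℂ, deriv (fun w => 1 + w) w = 1 := fun w => by simp
    have h := tendsto_sq_mul_stressEnergy (φ := fun w => φ (1 + w)) (κ := κ)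
      eventually_ball_mul_nhdsNE self_mem_nhdsWithin
      (by
        filter_upwards [self_mem_nhdsWithin, hn1'] with x h0 h1
        exact (hs (1 + x) h1 (h01 x h0)).comp x (contDiffAt_const.add contDiffAt_id))
      (by
        filter_upwards [self_mem_nhdsWithin, hn1'] with x h0 h1
        rw [← hL (1 + x) h1 (h01 x h0)]
        have e : (dzbar fun w => (φ (1 + w) : ℂ)) =ᶠ[𝓝 x]
            fun w => dzbar (fun w => (φ w : ℂ)) (1 + w) := by
          have c1 : ContinuousAt (fun z : ℂ => 1 + z) x := by fun_prop
          filter_upwards [isOpen_ne.mem_nhds h0, c1.eventually_ne h1] with y hy0 hy1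
          have := dzbar_comp_holomorphic (g := fun w => (φ w : ℂ))
            ((hs (1 + y) hy1 (h01 y hy0)).differentiableAt (by simp)) (hmul y)
          rw [this, hder]; simp
        have hd := (contDiffAt_dzbar (m := 3) (hs (1 + x) h1 (h01 x h0))
          (by norm_num)).differentiableAt (by simp)
        rw [dz_congr e, dz_comp_holomorphic hd (hmul x), hder, mul_one])
      hc'
      (by
        have := hc'.add_atBot (hlog0.const_mul_atBot (by linarith : 0 < 1 + β.b1))
        refine this.congr fun z => ?_
        ring)
    refine Tendsto.congr' ?_ (by convert h using 2; ring)
    filter_upwards [self_mem_nhdsWithin, hn1'] with x h0 h1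
    rw [stressEnergy_translate ((hs (1 + x) h1 (h01 x h0)).of_le (by norm_num))]
  · obtain ⟨c, hc⟩ := hφ.asymp_infty
    -- At infinity `γ = -(β_∞ + 2)`, and `γ(γ+2) = β_∞(β_∞+2)`, so the weight has the same form as
    -- at the finite points.
    have hc' : Tendsto (fun z => φ z - (-(β.binf + 2)) * Real.log ‖z‖)
        (Bornology.cobounded ℂ) (𝓝 c) := by
      refine hc.congr fun z => ?_
      ring
    have h := tendsto_sq_mul_stressEnergy (κ := κ) eventually_ball_mul_cobounded (hne 0)
      (by filter_upwards [hne 0, hne 1] with x h0 h1 using hs x h0 h1)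
      (by filter_upwards [hne 0, hne 1] with x h0 h1 using hL x h0 h1) hc'
      (by
        have := hc.add_atBot (hloginf.const_mul_atTop_of_neg (by linarith : -(1 + β.binf) < 0))
        refine this.congr fun z => ?_
        ring)
    convert h using 2; push_cast; ring

end ConicalSphere
end

noncomputable section

namespace ConicalSphere

/-! ### Pullbacks of tensors by analytic functions -/

/-- The pullback `τ(f) f'² + S(f)` of a stress-energy tensor `τ` by `f`. -/
def pullTensor (τ f : ℂ → ℂ) (x : ℂ) : ℂ := τ (f x) * deriv f x ^ 2 + schwarzian f x

theorem pullTensor_congr {τ f g : ℂ → ℂ} {x : ℂ} (h : f =ᶠ[𝓝 x] g) :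
    pullTensor τ f x = pullTensor τ g x := by
  have h1 : deriv f =ᶠ[𝓝 x] deriv g := h.deriv
  have h2 : logDeriv (deriv f) =ᶠ[𝓝 x] logDeriv (deriv g) := by
    filter_upwards [h1.eventuallyEq_nhds] with y hy using (logDeriv_congr_nhds hy).self_of_nhds
  rw [pullTensor, pullTensor, schwarzian, schwarzian, h.self_of_nhds, h1.self_of_nhds,
    h2.self_of_nhds, h2.deriv_eq]

/-- The cocycle law. It comes from `log (f ∘ h)' = log f' ∘ h + log h'`, differentiated once for
`f''/f'` and once more for the Schwarzian. -/
theorem schwarzian_comp {f h : ℂ → ℂ} {x : ℂ} (hf : AnalyticAt ℂ f (h x))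
    (hh : AnalyticAt ℂ h x) (hf' : deriv f (h x) ≠ 0) (hh' : deriv h x ≠ 0) :
    schwarzian (fun x => f (h x)) x =
      schwarzian f (h x) * deriv h x ^ 2 + schwarzian h x := by
  have hLf : AnalyticAt ℂ (logDeriv (deriv f)) (h x) := analyticAt_logDeriv hf.deriv hf'
  have hLh : AnalyticAt ℂ (logDeriv (deriv h)) x := analyticAt_logDeriv hh.deriv hh'
  have e1 : ∀ᶠ y in 𝓝 x, deriv (fun x => f (h x)) y = deriv f (h y) * deriv h y := by
    filter_upwards [hh.continuousAt.eventually hf.eventually_analyticAt,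
      hh.eventually_analyticAt] with y hy1 hy2
    exact deriv_comp y hy1.differentiableAt hy2.differentiableAt
  have e2 : logDeriv (deriv fun x => f (h x)) =ᶠ[𝓝 x]
      fun y => logDeriv (deriv f) (h y) * deriv h y + logDeriv (deriv h) y := by
    filter_upwards [e1.eventually_nhds, hh.continuousAt.eventually hf.eventually_analyticAt,
      hh.eventually_analyticAt, hh.deriv.continuousAt.eventually_ne hh',
      (hf.deriv.continuousAt.comp hh.continuousAt).eventually_ne hf'] with y hy1 hy2 hy3 hy4 hy5
    rw [(logDeriv_congr_nhds hy1).self_of_nhds, logDeriv_mul (f := fun y => deriv f (h y)) y hy5 hy4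
      (hy2.deriv.differentiableAt.comp y hy3.differentiableAt) hy3.deriv.differentiableAt]
    have := logDeriv_comp (f := deriv f) (g := h) hy2.deriv.differentiableAt hy3.differentiableAt
    simp only [Function.comp_def] at this
    rw [this]
  have d1 : HasDerivAt (fun y => logDeriv (deriv f) (h y))
      (deriv (logDeriv (deriv f)) (h x) * deriv h x) x :=
    hLf.differentiableAt.hasDerivAt.comp x hh.differentiableAt.hasDerivAt
  have d2 := (d1.mul hh.deriv.differentiableAt.hasDerivAt).add hLh.differentiableAt.hasDerivAt
  have d3 : deriv (fun y => logDeriv (deriv f) (h y) * deriv h y + logDeriv (deriv h) y) x = _ :=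
    d2.deriv
  rw [schwarzian, e2.deriv_eq, e2.self_of_nhds, d3, schwarzian, schwarzian]
  have : deriv (deriv h) x = logDeriv (deriv h) x * deriv h x := by
    rw [logDeriv_apply]; field_simp
  rw [this]
  ring

theorem schwarzian_inv (z : ℂ) (hz : z ≠ 0) : schwarzian (fun z => z⁻¹) z = 0 := by
  have h1 : deriv (fun z : ℂ => z⁻¹) = fun z => (-1) * z ^ (-2 : ℤ) := by
    ext z; rw [deriv_inv, show (-2 : ℤ) = -((2 : ℕ) : ℤ) from rfl, zpow_neg, zpow_natCast]; ring
  have h2 : logDeriv (deriv fun z : ℂ => z⁻¹) = fun z => (-2) * z⁻¹ := by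
    ext z
    rw [h1, logDeriv_const_mul _ _ (by norm_num), logDeriv_zpow]
    push_cast; ring
  have h3 : HasDerivAt (fun z : ℂ => (-2) * z⁻¹) ((-2) * (-(z ^ 2)⁻¹)) z :=
    (hasDerivAt_inv hz).const_mul _
  rw [schwarzian, h2, h3.deriv]
  field_simp
  ring

/-- Inversion in the target: `τ(1/w) w⁻⁴` is `τ` in the coordinate `1/w`, the Schwarzian of a Möbius
map being zero. A pole of `f` thus becomes a zero of `1/f`. -/
theorem pullTensor_inv {τ f : ℂ → ℂ} {x : ℂ} (hf : AnalyticAt ℂ f x) (hf0 : f x ≠ 0)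
    (hf' : deriv f x ≠ 0) :
    pullTensor (fun w => τ w⁻¹ * (w ^ 4)⁻¹) (fun x => (f x)⁻¹) x = pullTensor τ f x := by
  have hd : deriv (fun z : ℂ => z⁻¹) (f x) ≠ 0 := by
    rw [deriv_inv]; simpa using hf0
  have hd2 : deriv (fun x => (f x)⁻¹) x = -(f x ^ 2)⁻¹ * deriv f x := by
    rw [deriv_fun_inv'' hf.differentiableAt hf0]; ring
  rw [pullTensor, schwarzian_comp (f := fun z => z⁻¹) (h := f) (analyticAt_inv hf0) hf hd hf',
    schwarzian_inv _ hf0, hd2, pullTensor, inv_inv]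
  field_simp
  ring

theorem pullTensor_comp_inv {τ f : ℂ → ℂ} {t : ℂ} (ht : t ≠ 0) (hf : AnalyticAt ℂ f t⁻¹)
    (hf' : deriv f t⁻¹ ≠ 0) :
    pullTensor τ (fun t => f t⁻¹) t = pullTensor τ f t⁻¹ * (t ^ 4)⁻¹ := by
  have hd : deriv (fun z : ℂ => z⁻¹) t ≠ 0 := by
    rw [deriv_inv]; simpa using ht
  have hd2 : deriv (fun t => f t⁻¹) t = deriv f t⁻¹ * -(t ^ 2)⁻¹ := by
    have := deriv_comp t hf.differentiableAt (differentiableAt_inv ht)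
    rw [deriv_inv] at this
    exact this
  rw [pullTensor, schwarzian_comp (h := fun z => z⁻¹) hf (analyticAt_inv ht) hf' hd,
    schwarzian_inv _ ht, hd2, pullTensor, deriv_inv]
  field_simp
  ring

/-! ### Local expansions -/

theorem analyticAt_dslope {g : ℂ → ℂ} {a : ℂ} (hg : AnalyticAt ℂ g a) :
    AnalyticAt ℂ (dslope g a) a := by
  obtain ⟨p, hp⟩ := hg
  exact ⟨_, hp.has_fpower_series_dslope_fslope⟩

theorem isBigO_one_of_analyticAt {g : ℂ → ℂ} {a : ℂ} (hg : AnalyticAt ℂ g a) :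
    g =O[𝓝[≠] a] fun _ => (1 : ℂ) :=
  (hg.continuousAt.tendsto.mono_left nhdsWithin_le_nhds).isBigO_one ℂ

theorem isBigO_sub_div_of_analyticAt {g : ℂ → ℂ} {a : ℂ} (hg : AnalyticAt ℂ g a) :
    (fun x => (g x - g a) / (x - a)) =O[𝓝[≠] a] fun _ => (1 : ℂ) := by
  refine (isBigO_one_of_analyticAt (analyticAt_dslope hg)).congr' ?_ EventuallyEq.rfl
  filter_upwards [self_mem_nhdsWithin] with x hx
  rw [dslope_of_ne _ hx, slope_def_field]

theorem isBigO_taylor_iff {g : ℂ → ℂ} {a c d : ℂ} (hg : AnalyticAt ℂ g a) :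
    (fun x => g x - c - d * (x - a)) =O[𝓝[≠] a] (fun x => (x - a) ^ 2) ↔
      c = g a ∧ d = deriv g a := by
  have key : (fun x => g x - g a - deriv g a * (x - a)) =O[𝓝[≠] a] fun x => (x - a) ^ 2 := by
    have h := (isBigO_sub_div_of_analyticAt (analyticAt_dslope hg)).mul
      (isBigO_refl (fun x => (x - a) ^ 2) (𝓝[≠] a))
    refine h.congr' ?_ (by simp)
    filter_upwards [self_mem_nhdsWithin] with x hx
    have hx' : x - a ≠ 0 := sub_ne_zero.2 hx
    rw [dslope_of_ne _ hx, slope_def_field, dslope_same]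
    field_simp
  have hsq : Tendsto (fun x : ℂ => (x - a)) (𝓝[≠] a) (𝓝 0) := by
    have : ContinuousAt (fun x : ℂ => x - a) a := by fun_prop
    simpa using this.tendsto.mono_left nhdsWithin_le_nhds
  constructor
  · intro h
    have h1 := h.sub key
    have hc : c = g a := by
      have t1 : Tendsto (fun x => (g a - c) + (deriv g a - d) * (x - a)) (𝓝[≠] a)
          (𝓝 ((g a - c) + (deriv g a - d) * 0)) := (hsq.const_mul _).const_add _
      have t2 := h1.trans_tendsto (by simpa using hsq.pow 2)
      have := tendsto_nhds_unique t1 (t2.congr fun x => by ring)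
      rw [mul_zero, add_zero, sub_eq_zero] at this
      exact this.symm
    refine ⟨hc, ?_⟩
    have h2 := h1.mul (isBigO_refl (fun x => (x - a)⁻¹) (𝓝[≠] a))
    have t3 : Tendsto (fun x => (deriv g a - d)) (𝓝[≠] a) (𝓝 0) := by
      refine IsBigO.trans_tendsto (h2.congr' ?_ ?_) hsq
      · filter_upwards [self_mem_nhdsWithin] with x hx
        have hx' : x - a ≠ 0 := sub_ne_zero.2 hx
        rw [hc]; field_simp; ring
      · filter_upwards [self_mem_nhdsWithin] with x hx
        have hx' : x - a ≠ 0 := sub_ne_zero.2 hx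
        field_simp
    have := tendsto_nhds_unique t3 tendsto_const_nhds
    exact (sub_eq_zero.1 this.symm).symm
  · rintro ⟨rfl, rfl⟩
    exact key

/-- Uniqueness of the first two coefficients after the factor `(x-a)^m` is divided out; this
identifies the `c` and `d` of `HasCoeffs` with the value and derivative of the regular factor. -/
theorem isBigO_zpow_mul_taylor_iff {g : ℂ → ℂ} {a c d : ℂ} (m : ℤ) (hg : AnalyticAt ℂ g a)
    (hc : c ≠ 0) :
    (fun x => (x - a) ^ m * g x - c * (x - a) ^ m * (1 + d / c * (x - a))) =O[𝓝[≠] a]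
      (fun x => (x - a) ^ (m + 2)) ↔ c = g a ∧ d = deriv g a := by
  rw [← isBigO_taylor_iff hg]
  have e1 : ∀ x : ℂ, (x - a) ^ m * g x - c * (x - a) ^ m * (1 + d / c * (x - a)) =
      (x - a) ^ m * (g x - c - d * (x - a)) := fun x => by field_simp; ring
  simp only [e1]
  constructor
  · intro h
    have := (isBigO_refl (fun x => (x - a) ^ (-m)) (𝓝[≠] a)).mul h
    refine this.congr' ?_ ?_
    · filter_upwards [self_mem_nhdsWithin] with x hx
      have hx' : x - a ≠ 0 := sub_ne_zero.2 hx
      rw [← mul_assoc, ← zpow_add₀ hx']; simp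
    · filter_upwards [self_mem_nhdsWithin] with x hx
      have hx' : x - a ≠ 0 := sub_ne_zero.2 hx
      rw [← zpow_add₀ hx']; simp
  · intro h
    refine ((isBigO_refl (fun x => (x - a) ^ m) (𝓝[≠] a)).mul h).congr' EventuallyEq.rfl ?_
    filter_upwards [self_mem_nhdsWithin] with x hx
    have hx' : x - a ≠ 0 := sub_ne_zero.2 hx
    rw [zpow_add₀ hx']; norm_cast

/-- The residue of the pullback tensor at a zero `c t^N (1 + (d/c) t + ⋯)`. -/
def residue (N : ℕ) (c d s h : ℂ) : ℂ :=
  d / c * ((N ^ 2 * s + 1 - N ^ 2) / N) + if N = 1 then c * h else 0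

/-- Put `M = N - 1` and `ℓ = g'/g`. The term `(s/2)(y'/y)²` with `y'/y = N/(x-a) + ℓ` contributes
`sN² / 2` and `sNℓ(a)`. The Schwarzian, from `y''/y' = M/(x-a) + m`, contributes `(1-N²)/2` and `-M
m(a)`, where `m(a) = (N+1)/N · ℓ(a)`. The term `h y'²/y` is of order `(x-a)^{N-2}`, so it has a pole
only when `N = 1`. -/
theorem pullTensor_expansion {y g τ : ℂ → ℂ} {a s h : ℂ} {N : ℕ} (hN : 1 ≤ N)
    (hg : AnalyticAt ℂ g a) (hg0 : g a ≠ 0) (hy : ∀ᶠ x in 𝓝[≠] a, y x = (x - a) ^ N * g x)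
    (hτ : (fun w => τ w - (s / (2 * w ^ 2) + h / w)) =O[𝓝[≠] 0] fun _ => (1 : ℂ)) :
    (fun x => pullTensor τ y x - ((N ^ 2 * s + 1 - N ^ 2) / (2 * (x - a) ^ 2) +
      residue N (g a) (deriv g a) s h / (x - a))) =O[𝓝[≠] a] fun _ => (1 : ℂ) := by
  obtain ⟨M, rfl⟩ : ∃ M, N = M + 1 := ⟨N - 1, by omega⟩
  set Y : ℂ → ℂ := fun x => (x - a) ^ (M + 1) * g x with hY
  have hxa : AnalyticAt ℂ (fun x => x - a) a := by fun_prop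
  set ℓ : ℂ → ℂ := logDeriv g with hℓ
  have hℓa : AnalyticAt ℂ ℓ a := analyticAt_logDeriv hg hg0
  -- The regular factor of the derivative: `Y' = (x-a)^M k` with `k(a) = N g(a) ≠ 0`.
  set k : ℂ → ℂ := fun x => (M + 1) * g x + (x - a) * deriv g x with hk
  have hka : AnalyticAt ℂ k a := (analyticAt_const.mul hg).add (hxa.mul hg.deriv)
  have hM1 : (M + 1 : ℂ) ≠ 0 := by exact_mod_cast Nat.succ_ne_zero M
  have hk0 : k a ≠ 0 := by simp [hk, hM1, hg0]
  set m : ℂ → ℂ := logDeriv k with hm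
  have hma : AnalyticAt ℂ m a := analyticAt_logDeriv hka hk0
  have hk' : deriv k a = (M + 2) * deriv g a := by
    have h1 : HasDerivAt k ((M + 1) * deriv g a + (1 * deriv g a + (a - a) * deriv (deriv g) a))
        a := (hg.differentiableAt.hasDerivAt.const_mul _).add
      (((hasDerivAt_id a).sub_const a).mul hg.deriv.differentiableAt.hasDerivAt)
    rw [h1.deriv]; ring
  have hmval : m a = (M + 2) / (M + 1) * ℓ a := by
    rw [hm, logDeriv_apply, hk', hℓ, logDeriv_apply]
    simp only [hk, sub_self, zero_mul, add_zero]
    field_simp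
  -- derivatives of `Y` off `a`
  have dY : ∀ᶠ x in 𝓝 a, deriv Y x = (x - a) ^ M * k x := by
    filter_upwards [hg.eventually_analyticAt] with x hx
    have h1 := (((hasDerivAt_id x).sub_const a).pow (M + 1)).mul hx.differentiableAt.hasDerivAt
    have h2 : deriv Y x = _ := h1.deriv
    rw [h2]
    simp only [hk, id, Pi.pow_apply]
    push_cast
    ring
  have dL : ∀ᶠ x in 𝓝[≠] a, logDeriv (deriv Y) x = M * (x - a)⁻¹ + m x := by
    filter_upwards [nhdsWithin_le_nhds dY.eventually_nhds, self_mem_nhdsWithin,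
      nhdsWithin_le_nhds hka.eventually_analyticAt,
      nhdsWithin_le_nhds (hka.continuousAt.eventually_ne hk0)] with x hx1 hx2 hx3 hx4
    have hx' : x - a ≠ 0 := sub_ne_zero.2 hx2
    rw [(logDeriv_congr_nhds hx1).self_of_nhds, logDeriv_mul (f := fun x => (x - a) ^ M) x (pow_ne_zero _ hx')
      hx4 (by fun_prop) hx3.differentiableAt, logDeriv_fun_pow (by fun_prop)]
    simp [logDeriv_apply, hm]
  have dL' : ∀ᶠ x in 𝓝[≠] a, deriv (logDeriv (deriv Y)) x =
      -M * ((x - a) ^ 2)⁻¹ + deriv m x := by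
    filter_upwards [eventually_eventually_nhdsWithin.2 dL, self_mem_nhdsWithin,
      nhdsWithin_le_nhds hma.eventually_analyticAt] with x hx1 hx2 hx3
    have hx' : x - a ≠ 0 := sub_ne_zero.2 hx2
    have hev : logDeriv (deriv Y) =ᶠ[𝓝 x] fun x => M * (x - a)⁻¹ + m x := by
      rwa [isOpen_compl_singleton.nhdsWithin_eq hx2] at hx1
    have h1 := ((((hasDerivAt_id x).sub_const a).inv hx').const_mul (M : ℂ)).add
      hx3.differentiableAt.hasDerivAt
    have h2 : deriv (fun x => M * (x - a)⁻¹ + m x) x = _ := h1.deriv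
    rw [hev.deriv_eq, h2]
    simp only [id]
    ring
  set ρ : ℂ → ℂ := fun w => τ w - (s / (2 * w ^ 2) + h / w) with hρ
  have hYt : Tendsto Y (𝓝[≠] a) (𝓝[≠] 0) := by
    refine tendsto_nhdsWithin_iff.2 ⟨?_, ?_⟩
    · have : AnalyticAt ℂ Y a := (hxa.pow _).mul hg
      have := this.continuousAt.tendsto
      simp only [hY, sub_self, zero_pow (Nat.succ_ne_zero M), zero_mul] at this
      exact this.mono_left nhdsWithin_le_nhds
    · filter_upwards [self_mem_nhdsWithin,
        nhdsWithin_le_nhds (hg.continuousAt.eventually_ne hg0)] with x hx1 hx2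
      exact mul_ne_zero (pow_ne_zero _ (sub_ne_zero.2 hx1)) hx2
  have b1 : (fun x => ρ (Y x) * ((x - a) ^ M * k x) ^ 2) =O[𝓝[≠] a] fun _ => (1 : ℂ) := by
    have := (hτ.comp_tendsto hYt).mul (isBigO_one_of_analyticAt (((hxa.pow M).mul hka).pow 2))
    simpa using this
  have b2 : (fun x => s / 2 * ℓ x ^ 2 + deriv m x - m x ^ 2 / 2) =O[𝓝[≠] a]
      fun _ => (1 : ℂ) := by
    refine isBigO_one_of_analyticAt ?_
    have := hma.deriv
    fun_prop
  have b3 := (isBigO_sub_div_of_analyticAt hℓa).const_mul_left (s * (M + 1))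
  have b4 := (isBigO_sub_div_of_analyticAt hma).const_mul_left (M : ℂ)
  have b5 : (fun x => h * ((x - a) ^ M * k x) ^ 2 / Y x -
      (if M + 1 = 1 then g a * h else 0) / (x - a)) =O[𝓝[≠] a] fun _ => (1 : ℂ) := by
    have hq : AnalyticAt ℂ (fun x => k x ^ 2 / g x) a := (hka.pow 2).div hg hg0
    rcases Nat.eq_zero_or_pos M with rfl | hM
    · have h1 := (isBigO_sub_div_of_analyticAt hq).const_mul_left h
      refine h1.congr' ?_ EventuallyEq.rfl
      filter_upwards [self_mem_nhdsWithin,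
        nhdsWithin_le_nhds (hg.continuousAt.eventually_ne hg0)] with x hx1 hx2
      have hx' : x - a ≠ 0 := sub_ne_zero.2 hx1
      have hka : k a = g a := by simp [hk]
      simp only [hY, hka, zero_add, pow_one, pow_zero, one_mul, if_true]
      field_simp
    · obtain ⟨K, rfl⟩ : ∃ K, M = K + 1 := ⟨M - 1, by omega⟩
      have h1 := (isBigO_one_of_analyticAt ((hxa.pow K).mul hq)).const_mul_left h
      refine h1.congr' ?_ EventuallyEq.rfl
      filter_upwards [self_mem_nhdsWithin,
        nhdsWithin_le_nhds (hg.continuousAt.eventually_ne hg0)] with x hx1 hx2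
      have hx' : x - a ≠ 0 := sub_ne_zero.2 hx1
      simp only [hY, Pi.mul_apply, Pi.pow_apply]
      rw [if_neg (by omega), zero_div, sub_zero]
      field_simp
      ring
  -- The bounded remainders are the error of `τ`, the regular terms, the two cross terms with `ℓ`
  -- and `m` replaced by their increments from `a`, and the `h` term less its residue.
  refine ((((b1.add b2).add b3).sub b4).add b5).congr' ?_ EventuallyEq.rfl
  filter_upwards [eventually_eventually_nhdsWithin.2 hy, nhdsWithin_le_nhds dY, dL, dL',
    self_mem_nhdsWithin, nhdsWithin_le_nhds (hg.continuousAt.eventually_ne hg0)]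
    with x hx1 hx2 hx3 hx4 hx5 hx6
  have hx' : x - a ≠ 0 := sub_ne_zero.2 hx5
  have hev : y =ᶠ[𝓝 x] Y := by rwa [isOpen_compl_singleton.nhdsWithin_eq hx5] at hx1
  have hkx : k x = g x * ((M + 1) + (x - a) * ℓ x) := by
    simp only [hk, hℓ, logDeriv_apply]; field_simp
  rw [pullTensor_congr hev, pullTensor, schwarzian, hx2, hx3, hx4]
  have hτY : τ (Y x) = ρ (Y x) + (s / (2 * Y x ^ 2) + h / Y x) := by simp [hρ]
  have hYx : Y x = (x - a) ^ (M + 1) * g x := rfl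
  have hres : residue (M + 1) (g a) (deriv g a) s h =
      s * (M + 1) * ℓ a - M * m a + if M + 1 = 1 then g a * h else 0 := by
    rw [residue, hmval, hℓ, logDeriv_apply]
    push_cast
    field_simp
    ring
  have e1 : s / (2 * Y x ^ 2) * ((x - a) ^ M * k x) ^ 2 =
      s / 2 * ((M + 1) + (x - a) * ℓ x) ^ 2 / (x - a) ^ 2 := by
    rw [hYx, hkx]
    field_simp
    ring
  rw [hτY, hres, add_mul, add_mul, e1]
  generalize (if M + 1 = 1 then g a * h else 0) = δ
  push_cast
  field_simp
  ring

end ConicalSphere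
end

noncomputable section

namespace ConicalSphere

/-! ### Orders and degree of the Wronskian -/

/-- The Wronskian `A' B - A B'`. -/
def wron (A B : ℂ[X]) : ℂ[X] := derivative A * B - A * derivative B

theorem wron_sub_C_mul (A B : ℂ[X]) (v : ℂ) : wron (A - C v * B) B = wron A B := by
  simp only [wron, derivative_sub, derivative_mul, derivative_C]; ring

theorem wron_comm (A B : ℂ[X]) : wron B A = -wron A B := by
  simp only [wron]; ring

/-- With `A = (X-a)^n p`, the Wronskian is `(X-a)^{n-1} q` where `q(a) = n p(a) B(a) ≠ 0`. As it is
unchanged by `A ↦ A - vB`, this measures the ramification of `A/B` over any finite value. -/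
theorem rootMultiplicity_wron_add_one {A B : ℂ[X]} {a : ℂ} (hA : A ≠ 0) (hAa : A.eval a = 0)
    (hB : B.eval a ≠ 0) : (wron A B).rootMultiplicity a + 1 = A.rootMultiplicity a := by
  set n := A.rootMultiplicity a with hn
  have hn0 : 0 < n := (rootMultiplicity_pos hA).2 hAa
  obtain ⟨p, hp, hpa⟩ := exists_eq_pow_rootMultiplicity_mul_and_not_dvd A hA a
  rw [← hn] at hp
  have hpa' : p.eval a ≠ 0 := fun h => hpa (dvd_iff_isRoot.2 h)
  set q : ℂ[X] := ((n : ℂ[X]) * p + (X - C a) * derivative p) * B -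
    p * (X - C a) * derivative B with hq
  have hqa : q.eval a ≠ 0 := by
    simp [hq, hn0.ne', hpa', hB]
  have key : wron A B * (X - C a) ^ 1 = q * (X - C a) ^ n := by
    obtain ⟨m, hm⟩ : ∃ m, n = m + 1 := ⟨n - 1, by omega⟩
    rw [wron, hp, hq, hm]
    simp only [derivative_mul, derivative_X_sub_C_pow, Nat.add_sub_cancel]
    push_cast
    simp only [map_add, map_natCast, map_one]
    ring
  have hq0 : q ≠ 0 := by rintro h; simp [h] at hqa
  have hW : wron A B ≠ 0 := by
    intro h
    rw [h, zero_mul] at key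
    exact mul_ne_zero hq0 (pow_ne_zero _ (X_sub_C_ne_zero a)) key.symm
  have h1 := rootMultiplicity_mul_X_sub_C_pow (a := a) (n := 1) hW
  rw [key, rootMultiplicity_mul_X_sub_C_pow hq0, rootMultiplicity_eq_zero hqa] at h1
  omega

/-- The top coefficient is `(deg A - deg B)` times the product of the leading coefficients. Working
with `X · wron A B` keeps the degrees free of truncated subtraction. -/
theorem wron_ne_zero_and_natDegree {A B : ℂ[X]} (hA : A ≠ 0) (hB : B ≠ 0)
    (h : A.natDegree ≠ B.natDegree) :
    wron A B ≠ 0 ∧ (wron A B).natDegree + 1 = A.natDegree + B.natDegree := by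
  have hX : ∀ p : ℂ[X], (X * derivative p).natDegree ≤ p.natDegree ∧
      (X * derivative p).coeff p.natDegree = p.natDegree * p.leadingCoeff := by
    intro p
    rcases Nat.eq_zero_or_pos p.natDegree with h0 | h0
    · rw [eq_C_of_natDegree_eq_zero h0]; simp
    · constructor
      · refine natDegree_mul_le.trans ?_
        have := natDegree_derivative_le p
        rw [natDegree_X]; omega
      · obtain ⟨m, hm⟩ : ∃ m, p.natDegree = m + 1 := ⟨p.natDegree - 1, by omega⟩
        rw [leadingCoeff, hm, coeff_X_mul, coeff_derivative]
        push_cast; ring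
  have hco : (X * wron A B).coeff (A.natDegree + B.natDegree) =
      (A.natDegree - B.natDegree) * (A.leadingCoeff * B.leadingCoeff) := by
    have e : X * wron A B = (X * derivative A) * B - A * (X * derivative B) := by
      rw [wron]; ring
    rw [e, coeff_sub, coeff_mul_add_eq_of_natDegree_le (hX A).1 le_rfl,
      coeff_mul_add_eq_of_natDegree_le le_rfl (hX B).1, (hX A).2, (hX B).2]
    simp only [coeff_natDegree]
    ring
  have hco0 : (X * wron A B).coeff (A.natDegree + B.natDegree) ≠ 0 := by
    rw [hco]
    refine mul_ne_zero (sub_ne_zero.2 (by exact_mod_cast h)) ?_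
    exact mul_ne_zero (leadingCoeff_ne_zero.2 hA) (leadingCoeff_ne_zero.2 hB)
  have hW : wron A B ≠ 0 := by
    intro h0; simp [h0] at hco0
  refine ⟨hW, ?_⟩
  have hle : (X * wron A B).natDegree ≤ A.natDegree + B.natDegree := by
    have e : X * wron A B = (X * derivative A) * B - A * (X * derivative B) := by
      rw [wron]; ring
    rw [e]
    refine (natDegree_sub_le _ _).trans (max_le ?_ ?_)
    · exact natDegree_mul_le.trans (Nat.add_le_add_right (hX A).1 _)
    · exact natDegree_mul_le.trans (Nat.add_le_add_left (hX B).1 _)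
  have := natDegree_eq_of_le_of_coeff_ne_zero hle hco0
  rw [natDegree_X_mul hW] at this
  exact this

/-! ### Rational functions -/

section
variable {f : RatFunc ℂ}

theorem ratFun_eq (f : RatFunc ℂ) (x : ℂ) : ratFun f x = f.num.eval x / f.denom.eval x := rfl

theorem num_eval_ne_zero {a : ℂ} (h : f.denom.eval a = 0) : f.num.eval a ≠ 0 := by
  obtain ⟨u, v, huv⟩ := f.isCoprime_num_denom
  intro h'
  have := congrArg (eval a) huv
  simp [h, h'] at this

theorem num_sub_ne_zero (hf : 1 ≤ ratDegree f) (v : ℂ) : f.num - C v * f.denom ≠ 0 := by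
  intro h
  rw [sub_eq_zero] at h
  have hu : IsUnit f.denom :=
    f.isCoprime_num_denom.isUnit_of_dvd' (h ▸ dvd_mul_left _ _) dvd_rfl
  have h1 : f.denom = 1 := f.monic_denom.eq_one_of_isUnit hu
  rw [ratDegree, h, h1] at hf
  simp at hf

theorem num_ne_zero (hf : 1 ≤ ratDegree f) : f.num ≠ 0 := by
  simpa using num_sub_ne_zero hf 0

theorem sphereMap_coe_of_eq_zero {a : ℂ} (h : f.denom.eval a = 0) : sphereMap f a = ∞ := by
  simp only [sphereMap, h, if_true]

theorem sphereMap_coe_of_ne_zero {a : ℂ} (h : f.denom.eval a ≠ 0) :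
    sphereMap f a = ((ratFun f a : ℂ) : OnePoint ℂ) := by
  simp only [sphereMap, h, if_false]

theorem sphereMap_coe_eq_infty_iff {a : ℂ} : sphereMap f a = ∞ ↔ f.denom.eval a = 0 := by
  refine ⟨fun h => ?_, sphereMap_coe_of_eq_zero⟩
  by_contra h'
  rw [sphereMap_coe_of_ne_zero h'] at h
  exact coe_ne_infty _ h

theorem sphereMap_coe_eq_coe_iff {a v : ℂ} : sphereMap f a = (v : OnePoint ℂ) ↔
    f.denom.eval a ≠ 0 ∧ (f.num - C v * f.denom).eval a = 0 := by
  by_cases h : f.denom.eval a = 0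
  · rw [sphereMap_coe_of_eq_zero h]
    simp [h]
  · rw [sphereMap_coe_of_ne_zero h, OnePoint.coe_eq_coe, ratFun_eq, div_eq_iff h]
    simp [h, sub_eq_zero]

theorem sphereMap_infty_of_lt (h : f.denom.natDegree < f.num.natDegree) :
    sphereMap f ∞ = ∞ := by
  change (if f.denom.natDegree < f.num.natDegree then _ else _) = _
  rw [if_pos h]

theorem sphereMap_infty_of_not_lt (h : ¬f.denom.natDegree < f.num.natDegree) :
    sphereMap f ∞ = ((f.num.coeff f.denom.natDegree : ℂ) : OnePoint ℂ) := by
  change (if f.denom.natDegree < f.num.natDegree then _ else _) = _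
  rw [if_neg h, f.monic_denom.leadingCoeff, div_one]

theorem sphereMap_infty_eq_infty_iff :
    sphereMap f ∞ = ∞ ↔ f.denom.natDegree < f.num.natDegree := by
  refine ⟨fun h => ?_, sphereMap_infty_of_lt⟩
  by_contra h'
  rw [sphereMap_infty_of_not_lt h'] at h
  exact coe_ne_infty _ h

/-- The denominator is monic, so subtracting `v` times it cancels the coefficient in degree `deg Q`.
-/
theorem natDegree_lt_of_sphereMap_infty (hf : 1 ≤ ratDegree f) {v : ℂ}
    (h : sphereMap f ∞ = (v : OnePoint ℂ)) :
    f.num.natDegree ≤ f.denom.natDegree ∧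
      (f.num - C v * f.denom).natDegree < f.denom.natDegree := by
  have h1 : ¬f.denom.natDegree < f.num.natDegree := fun h' => by
    rw [sphereMap_infty_of_lt h'] at h
    exact infty_ne_coe _ h
  rw [sphereMap_infty_of_not_lt h1, OnePoint.coe_eq_coe] at h
  have h2 : f.num.natDegree ≤ f.denom.natDegree := not_lt.1 h1
  refine ⟨h2, lt_of_le_of_ne ?_ fun h3 => ?_⟩
  · exact (natDegree_sub_le _ _).trans (max_le h2 (natDegree_C_mul_le _ _))
  · refine num_sub_ne_zero hf v (leadingCoeff_eq_zero.1 ?_)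
    rw [leadingCoeff, h3, coeff_sub, coeff_C_mul, h, coeff_natDegree,
      f.monic_denom.leadingCoeff]
    ring

theorem eq_infty_or_eq_coe (p : OnePoint ℂ) : p = ∞ ∨ ∃ v : ℂ, p = v := by
  induction p using OnePoint.rec with
  | infty => exact Or.inl rfl
  | coe v => exact Or.inr ⟨v, rfl⟩

theorem mult_infty_infty (h : sphereMap f ∞ = ∞) :
    mult f ∞ = f.num.natDegree - f.denom.natDegree := by
  unfold mult; rw [h]

theorem mult_infty_coe {v : ℂ} (h : sphereMap f ∞ = (v : OnePoint ℂ)) :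
    mult f ∞ = f.denom.natDegree - (f.num - C v * f.denom).natDegree := by
  unfold mult; rw [h]

theorem mult_coe_infty {a : ℂ} (h : sphereMap f a = ∞) :
    mult f a = f.denom.rootMultiplicity a := by
  unfold mult; rw [h]

theorem mult_coe_coe {a v : ℂ} (h : sphereMap f a = (v : OnePoint ℂ)) :
    mult f a = (f.num - C v * f.denom).rootMultiplicity a := by
  unfold mult; rw [h]

theorem one_le_mult (hf : 1 ≤ ratDegree f) (p : OnePoint ℂ) : 1 ≤ mult f p := by
  induction p using OnePoint.rec with
  | infty =>
    obtain h | ⟨v, h⟩ := eq_infty_or_eq_coe (sphereMap f ∞)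
    · rw [mult_infty_infty h]
      have := sphereMap_infty_eq_infty_iff.1 h
      omega
    · rw [mult_infty_coe h]
      have := (natDegree_lt_of_sphereMap_infty hf h).2
      omega
  | coe a =>
    obtain h | ⟨v, h⟩ := eq_infty_or_eq_coe (sphereMap f a)
    · rw [mult_coe_infty h]
      exact (rootMultiplicity_pos f.denom_ne_zero).2 (sphereMap_coe_eq_infty_iff.1 h)
    · rw [mult_coe_coe h]
      exact (rootMultiplicity_pos (num_sub_ne_zero hf v)).2 (sphereMap_coe_eq_coe_iff.1 h).2

theorem rootMultiplicity_wron_of_coe {a v : ℂ} (hf : 1 ≤ ratDegree f)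
    (h : sphereMap f a = (v : OnePoint ℂ)) :
    (wron f.num f.denom).rootMultiplicity a + 1 = mult f a := by
  obtain ⟨h1, h2⟩ := sphereMap_coe_eq_coe_iff.1 h
  rw [mult_coe_coe h, ← wron_sub_C_mul _ _ v]
  exact rootMultiplicity_wron_add_one (num_sub_ne_zero hf v) h2 h1

theorem rootMultiplicity_neg' (p : ℂ[X]) (a : ℂ) :
    (-p).rootMultiplicity a = p.rootMultiplicity a := by
  simp only [← count_roots, roots_neg]

theorem rootMultiplicity_wron_of_infty {a : ℂ} (h : sphereMap f a = ∞) :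
    (wron f.num f.denom).rootMultiplicity a + 1 = mult f a := by
  have h1 := sphereMap_coe_eq_infty_iff.1 h
  rw [mult_coe_infty h, ← neg_neg (wron f.num f.denom), ← wron_comm, rootMultiplicity_neg']
  exact rootMultiplicity_wron_add_one f.denom_ne_zero h1 (num_eval_ne_zero h1)

/-- The polynomial whose roots are the finite marked points. -/
def markedPoly (f : RatFunc ℂ) : ℂ[X] := f.num * f.denom * (f.num - f.denom)

/-! ### Marked points and the Riemann–Hurwitz count. -/

theorem num_sub_denom_ne_zero (hf : 1 ≤ ratDegree f) : f.num - f.denom ≠ 0 := by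
  simpa using num_sub_ne_zero hf 1

theorem markedPoly_ne_zero (hf : 1 ≤ ratDegree f) : markedPoly f ≠ 0 :=
  mul_ne_zero (mul_ne_zero (num_ne_zero hf) f.denom_ne_zero) (num_sub_denom_ne_zero hf)

theorem coe_mem_marked_iff {a : ℂ} : (a : OnePoint ℂ) ∈ marked f ↔ (markedPoly f).eval a = 0 := by
  have h0 := sphereMap_coe_eq_coe_iff (f := f) (a := a) (v := 0)
  have h1 := sphereMap_coe_eq_coe_iff (f := f) (a := a) (v := 1)
  have hi := sphereMap_coe_eq_infty_iff (f := f) (a := a)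
  simp only [marked, threePoints, Set.mem_preimage, Set.mem_insert_iff, Set.mem_singleton_iff,
    h0, h1, hi, markedPoly, eval_mul, eval_sub, mul_eq_zero, map_zero, zero_mul, sub_zero,
    map_one, one_mul]
  tauto

/-- The polynomials `P`, `Q` and `P - Q` are pairwise without common roots, so only one of them
vanishes at `a`, and its multiplicity there is the local multiplicity of `f`. -/
theorem rootMultiplicity_markedPoly (hf : 1 ≤ ratDegree f) {a : ℂ}
    (ha : (a : OnePoint ℂ) ∈ marked f) :
    (markedPoly f).rootMultiplicity a = (wron f.num f.denom).rootMultiplicity a + 1 := by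
  have e : (markedPoly f).rootMultiplicity a = f.num.rootMultiplicity a +
      f.denom.rootMultiplicity a + (f.num - f.denom).rootMultiplicity a := by
    rw [markedPoly, rootMultiplicity_mul (markedPoly_ne_zero hf),
      rootMultiplicity_mul (mul_ne_zero (num_ne_zero hf) f.denom_ne_zero)]
  rw [e]
  rcases ha with h | h | h
  · rw [rootMultiplicity_wron_of_coe hf h, mult_coe_coe h]
    obtain ⟨h1, h2⟩ := sphereMap_coe_eq_coe_iff.1 h
    simp only [map_zero, zero_mul, sub_zero] at h2 ⊢
    rw [rootMultiplicity_eq_zero (p := f.denom) h1,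
      rootMultiplicity_eq_zero (p := f.num - f.denom) (by simp [IsRoot, h1, h2]),
      add_zero, add_zero]
  · rw [rootMultiplicity_wron_of_coe hf h, mult_coe_coe h]
    obtain ⟨h1, h2⟩ := sphereMap_coe_eq_coe_iff.1 h
    simp only [map_one, one_mul] at h2 ⊢
    have h3 : f.num.eval a ≠ 0 := by
      simp only [eval_sub, sub_eq_zero] at h2
      rwa [h2]
    rw [rootMultiplicity_eq_zero (p := f.denom) h1, rootMultiplicity_eq_zero (p := f.num) h3]
    omega
  · rw [rootMultiplicity_wron_of_infty h, mult_coe_infty h]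
    have h1 := sphereMap_coe_eq_infty_iff.1 h
    have h2 := num_eval_ne_zero h1
    rw [rootMultiplicity_eq_zero (p := f.num) h2,
      rootMultiplicity_eq_zero (p := f.num - f.denom) (by simp [IsRoot, h1, h2])]
    omega

theorem wron_eval_ne_zero (hf : IsBelyi f) {a : ℂ} (ha : (a : OnePoint ℂ) ∉ marked f)
    (hW : wron f.num f.denom ≠ 0) : (wron f.num f.denom).eval a ≠ 0 := by
  have hr := hf.2 a ha
  have h1 := one_le_mult hf.1 a
  have hm : (wron f.num f.denom).rootMultiplicity a + 1 = mult f a := by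
    obtain h | ⟨v, h⟩ := eq_infty_or_eq_coe (sphereMap f a)
    · exact rootMultiplicity_wron_of_infty h
    · exact rootMultiplicity_wron_of_coe hf.1 h
  rw [ramOrd] at hr
  intro h0
  have := (rootMultiplicity_pos hW).2 h0
  omega

/-- Because `f(∞)` is one of the three values, one of `P`, `Q`, `P - Q` has degree `r < deg f` and
the other two have degree `deg f`. The sum is `2 deg f + r`, and the Wronskian has degree `deg f + r
- 1`. -/
theorem degree_count (hf : 1 ≤ ratDegree f) (hinf : sphereMap f ∞ ∈ threePoints) :
    wron f.num f.denom ≠ 0 ∧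
    f.num.natDegree + f.denom.natDegree + (f.num - f.denom).natDegree =
      (wron f.num f.denom).natDegree + ratDegree f + 1 := by
  rcases hinf with h | h | h
  · obtain ⟨h1, h2⟩ := natDegree_lt_of_sphereMap_infty hf h
    simp only [map_zero, zero_mul, sub_zero] at h2
    obtain ⟨w1, w2⟩ := wron_ne_zero_and_natDegree (num_ne_zero hf) f.denom_ne_zero h2.ne
    refine ⟨w1, ?_⟩
    rw [natDegree_sub_eq_right_of_natDegree_lt h2, ratDegree, max_eq_right h1]
    omega
  · obtain ⟨h1, h2⟩ := natDegree_lt_of_sphereMap_infty hf h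
    simp only [map_one, one_mul] at h2
    obtain ⟨w1, w2⟩ :=
      wron_ne_zero_and_natDegree (num_sub_denom_ne_zero hf) f.denom_ne_zero h2.ne
    have e : wron (f.num - f.denom) f.denom = wron f.num f.denom := by
      simpa using wron_sub_C_mul f.num f.denom 1
    have h3 : f.num.natDegree = f.denom.natDegree := by
      have := natDegree_add_eq_right_of_natDegree_lt h2
      rwa [sub_add_cancel] at this
    rw [e] at w1 w2
    refine ⟨w1, ?_⟩
    rw [ratDegree, max_eq_right h1]
    omega
  · have h1 := sphereMap_infty_eq_infty_iff.1 h
    obtain ⟨w1, w2⟩ := wron_ne_zero_and_natDegree (num_ne_zero hf) f.denom_ne_zero h1.ne'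
    refine ⟨w1, ?_⟩
    rw [natDegree_sub_eq_left_of_natDegree_lt h1, ratDegree, max_eq_left h1.le]
    omega

/-- All roots of the Wronskian are marked, by the Belyi condition. Summing over the marked points
the excess of one in multiplicity gives the difference of the two degrees. -/
theorem card_roots_markedPoly (hf : IsBelyi f) (hinf : sphereMap f ∞ ∈ threePoints) :
    (markedPoly f).roots.toFinset.card = ratDegree f + 1 := by
  obtain ⟨hW, hdeg⟩ := degree_count hf.1 hinf
  have hM := markedPoly_ne_zero hf.1
  have hmem : ∀ a, a ∈ (markedPoly f).roots.toFinset ↔ (a : OnePoint ℂ) ∈ marked f := fun a => by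
    rw [Multiset.mem_toFinset, mem_roots hM, coe_mem_marked_iff, IsRoot]
  have h1 : ∑ a ∈ (markedPoly f).roots.toFinset, (markedPoly f).roots.count a =
      (markedPoly f).natDegree := by
    rw [Multiset.toFinset_sum_count_eq, IsAlgClosed.card_roots_eq_natDegree]
  have h2 : ∑ a ∈ (markedPoly f).roots.toFinset, (wron f.num f.denom).roots.count a =
      (wron f.num f.denom).natDegree := by
    rw [Multiset.sum_count_eq_card, IsAlgClosed.card_roots_eq_natDegree]
    intro a ha
    rw [hmem]
    by_contra h
    exact wron_eval_ne_zero hf h hW ((mem_roots hW).1 ha)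
  have h3 : ∑ a ∈ (markedPoly f).roots.toFinset, (markedPoly f).roots.count a =
      ∑ a ∈ (markedPoly f).roots.toFinset, ((wron f.num f.denom).roots.count a + 1) := by
    refine Finset.sum_congr rfl fun a ha => ?_
    rw [count_roots, count_roots, rootMultiplicity_markedPoly hf.1 ((hmem a).1 ha)]
  rw [Finset.sum_add_distrib, h1, h2, Finset.sum_const, smul_eq_mul, mul_one, markedPoly,
    natDegree_mul (mul_ne_zero (num_ne_zero hf.1) f.denom_ne_zero) (num_sub_denom_ne_zero hf.1),
    natDegree_mul (num_ne_zero hf.1) f.denom_ne_zero, hdeg] at h3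
  rw [markedPoly]
  omega

theorem marked_eq (hf : 1 ≤ ratDegree f) (hinf : sphereMap f ∞ ∈ threePoints) :
    marked f = insert ∞ ((fun a : ℂ => (a : OnePoint ℂ)) '' (markedPoly f).roots.toFinset) := by
  ext p
  induction p using OnePoint.rec with
  | infty => simpa [marked] using hinf
  | coe a =>
    rw [coe_mem_marked_iff]
    simp [markedPoly_ne_zero hf]

theorem marked_finite_ncard (hf : IsBelyi f) (hinf : sphereMap f ∞ ∈ threePoints) :
    (marked f).Finite ∧ (marked f).ncard = ratDegree f + 2 := by
  have hfin : ((fun a : ℂ => (a : OnePoint ℂ)) '' (markedPoly f).roots.toFinset).Finite :=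
    (Finset.finite_toSet _).image _
  rw [marked_eq hf.1 hinf]
  refine ⟨hfin.insert _, ?_⟩
  rw [Set.ncard_insert_of_notMem (by simp) hfin,
    Set.ncard_image_of_injective _ OnePoint.coe_injective, Set.ncard_coe_finset,
    card_roots_markedPoly hf hinf]

end
end ConicalSphere
end

noncomputable section

namespace ConicalSphere

/-! ### Expansions of the three-point tensor -/

theorem isBigO_one_of_eq_analyticAt {F G : ℂ → ℂ} {b : ℂ} (hG : AnalyticAt ℂ G b)
    (h : ∀ᶠ w in 𝓝[≠] b, F w = G w) : F =O[𝓝[≠] b] fun _ => (1 : ℂ) :=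
  (isBigO_one_of_analyticAt hG).congr' (h.mono fun _ hw => hw.symm) EventuallyEq.rfl

theorem triTensor_expansion_zero (s0 s1 sinf : ℂ) :
    (fun w => triTensor s0 s1 sinf w - (s0 / (2 * w ^ 2) + ((s0 + s1 - sinf) / 2) / w))
      =O[𝓝[≠] 0] fun _ => (1 : ℂ) := by
  refine isBigO_one_of_eq_analyticAt
    (G := fun w => s1 / (2 * (w - 1) ^ 2) - (s0 + s1 - sinf) / 2 / (w - 1)) ?_ ?_
  · refine AnalyticAt.sub ?_ ?_ <;> refine AnalyticAt.fun_div (by fun_prop) (by fun_prop) ?_ <;>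
      norm_num
  · filter_upwards [self_mem_nhdsWithin, nhdsWithin_le_nhds (isOpen_ne.mem_nhds zero_ne_one)]
      with w h0 h1
    have h0' : w ≠ 0 := h0
    have h1' : w - 1 ≠ 0 := sub_ne_zero.2 h1
    rw [triTensor]
    field_simp
    ring

theorem triTensor_expansion_one (s0 s1 sinf : ℂ) :
    (fun w => triTensor s0 s1 sinf (1 + w) -
      (s1 / (2 * w ^ 2) + (-((s0 + s1 - sinf) / 2)) / w)) =O[𝓝[≠] 0] fun _ => (1 : ℂ) := by
  refine isBigO_one_of_eq_analyticAt
    (G := fun w => s0 / (2 * (1 + w) ^ 2) + (s0 + s1 - sinf) / 2 / (1 + w)) ?_ ?_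
  · refine AnalyticAt.add ?_ ?_ <;> refine AnalyticAt.fun_div (by fun_prop) (by fun_prop) ?_ <;>
      norm_num
  · have hc : ContinuousAt (fun w : ℂ => 1 + w) 0 := by fun_prop
    filter_upwards [self_mem_nhdsWithin,
      nhdsWithin_le_nhds (hc.eventually_ne (y := 0) (by simp))] with w h0 h1
    have h0' : w ≠ 0 := h0
    rw [triTensor, add_sub_cancel_left]
    field_simp
    ring

theorem triTensor_expansion_infty (s0 s1 sinf : ℂ) :
    (fun w => triTensor s0 s1 sinf w⁻¹ * (w ^ 4)⁻¹ -
      (sinf / (2 * w ^ 2) + ((s1 + sinf - s0) / 2) / w)) =O[𝓝[≠] 0] fun _ => (1 : ℂ) := by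
  refine isBigO_one_of_eq_analyticAt
    (G := fun w => s1 / (2 * (w - 1) ^ 2) - (s1 + sinf - s0) / 2 / (w - 1)) ?_ ?_
  · refine AnalyticAt.sub ?_ ?_ <;> refine AnalyticAt.fun_div (by fun_prop) (by fun_prop) ?_ <;>
      norm_num
  · filter_upwards [self_mem_nhdsWithin, nhdsWithin_le_nhds (isOpen_ne.mem_nhds zero_ne_one)]
      with w h0 h1
    have h0' : w ≠ 0 := h0
    have h1' : w - 1 ≠ 0 := sub_ne_zero.2 h1
    have h2 : w⁻¹ - 1 = -(w - 1) * w⁻¹ := by field_simp; ring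
    rw [triTensor, h2]
    field_simp
    ring

/-- The stress-energy tensor of the metric representing the divisor `β`. -/
def TriDivisor.tensor (β : TriDivisor) : ℂ → ℂ :=
  triTensor (β.weight ((0 : ℂ) : OnePoint ℂ) : ℂ) (β.weight ((1 : ℂ) : OnePoint ℂ) : ℂ)
    (β.weight ∞ : ℂ)

theorem TriDivisor.tensor_expansion_coe (β : TriDivisor) {v : ℂ}
    (hv : (v : OnePoint ℂ) ∈ threePoints) :
    (fun w => β.tensor (v + w) - ((β.weight (v : OnePoint ℂ) : ℂ) / (2 * w ^ 2) +
      (β.schwarzParam (v : OnePoint ℂ) : ℂ) / w)) =O[𝓝[≠] 0] fun _ => (1 : ℂ) := by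
  rcases hv with h | h | h
  · rw [OnePoint.coe_eq_coe] at h
    subst h
    simpa [TriDivisor.schwarzParam, TriDivisor.tensor] using triTensor_expansion_zero
      (β.weight ((0 : ℂ) : OnePoint ℂ) : ℂ) (β.weight ((1 : ℂ) : OnePoint ℂ) : ℂ) (β.weight ∞ : ℂ)
  · rw [OnePoint.coe_eq_coe] at h
    subst h
    simpa [TriDivisor.schwarzParam, TriDivisor.tensor] using triTensor_expansion_one
      (β.weight ((0 : ℂ) : OnePoint ℂ) : ℂ) (β.weight ((1 : ℂ) : OnePoint ℂ) : ℂ) (β.weight ∞ : ℂ)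
  · exact absurd h (coe_ne_infty v)

theorem TriDivisor.tensor_expansion_infty (β : TriDivisor) :
    (fun w => β.tensor w⁻¹ * (w ^ 4)⁻¹ - ((β.weight ∞ : ℂ) / (2 * w ^ 2) +
      (β.schwarzParam ∞ : ℂ) / w)) =O[𝓝[≠] 0] fun _ => (1 : ℂ) := by
  simpa [TriDivisor.schwarzParam, TriDivisor.tensor] using triTensor_expansion_infty
    (β.weight ((0 : ℂ) : OnePoint ℂ) : ℂ) (β.weight ((1 : ℂ) : OnePoint ℂ) : ℂ) (β.weight ∞ : ℂ)

theorem IsTriPotential.stressEnergy_eq_tensor {β : TriDivisor} {φ : ℂ → ℝ}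
    (hφ : IsTriPotential β φ) (hb0 : -1 < β.b0) (hb1 : -1 < β.b1) (hbinf : -1 < β.binf)
    {z : ℂ} (hz0 : z ≠ 0) (hz1 : z ≠ 1) : stressEnergy φ z = β.tensor z := by
  rw [hφ.stressEnergy_eq hb0 hb1 hbinf hz0 hz1]
  simp [TriDivisor.tensor, TriDivisor.weight, TriDivisor.at]

/-! ### Expansions of the pullback tensor in a local chart -/

section
variable {F g : ℂ → ℂ} {b : ℂ} {N : ℕ}

theorem pullTensor_sub_const (τ F : ℂ → ℂ) (v x : ℂ) :
    pullTensor (fun w => τ (v + w)) (fun x => F x - v) x = pullTensor τ F x := by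
  have : deriv (fun x => F x - v) = deriv F := by ext x; simp
  simp [pullTensor, schwarzian, this]

theorem expansion_of_sub_eq {τ : ℂ → ℂ} {v s h : ℂ} (hN : 1 ≤ N) (hg : AnalyticAt ℂ g b)
    (hg0 : g b ≠ 0) (hF : ∀ᶠ x in 𝓝[≠] b, F x - v = (x - b) ^ N * g x)
    (hτ : (fun w => τ (v + w) - (s / (2 * w ^ 2) + h / w)) =O[𝓝[≠] 0] fun _ => (1 : ℂ)) :
    (fun x => pullTensor τ F x - ((N ^ 2 * s + 1 - N ^ 2) / (2 * (x - b) ^ 2) +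
      residue N (g b) (deriv g b) s h / (x - b))) =O[𝓝[≠] b] fun _ => (1 : ℂ) := by
  have := pullTensor_expansion hN hg hg0 hF hτ
  simpa only [pullTensor_sub_const] using this

theorem coeffs_of_sub_eq {v c d : ℂ} (hg : AnalyticAt ℂ g b)
    (hF : ∀ᶠ x in 𝓝[≠] b, F x - v = (x - b) ^ N * g x) (hc : c ≠ 0) :
    (fun x => F x - v - c * (x - b) ^ (N : ℤ) * (1 + d / c * (x - b))) =O[𝓝[≠] b]
      (fun x => (x - b) ^ ((N : ℤ) + 2)) ↔ c = g b ∧ d = deriv g b := by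
  rw [← isBigO_zpow_mul_taylor_iff N hg hc]
  refine isBigO_congr ?_ EventuallyEq.rfl
  filter_upwards [hF] with x hx
  rw [hx, zpow_natCast]

theorem deriv_inv_of_analyticAt (hg : AnalyticAt ℂ g b) (hg0 : g b ≠ 0) :
    deriv (fun x => (g x)⁻¹) b = -deriv g b / g b ^ 2 :=
  deriv_fun_inv'' hg.differentiableAt hg0

theorem expansion_of_eq_inv {τ : ℂ → ℂ} {s h : ℂ} (hN : 1 ≤ N) (hg : AnalyticAt ℂ g b)
    (hg0 : g b ≠ 0) (hF : ∀ᶠ x in 𝓝[≠] b, F x = (x - b) ^ (-(N : ℤ)) * g x)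
    (hFd : ∀ᶠ x in 𝓝[≠] b, AnalyticAt ℂ F x ∧ deriv F x ≠ 0)
    (hτ : (fun w => τ w⁻¹ * (w ^ 4)⁻¹ - (s / (2 * w ^ 2) + h / w)) =O[𝓝[≠] 0]
      fun _ => (1 : ℂ)) :
    (fun x => pullTensor τ F x - ((N ^ 2 * s + 1 - N ^ 2) / (2 * (x - b) ^ 2) +
      residue N (g b)⁻¹ (-deriv g b / g b ^ 2) s h / (x - b))) =O[𝓝[≠] b] fun _ => (1 : ℂ) := by
  have hy : ∀ᶠ x in 𝓝[≠] b, (F x)⁻¹ = (x - b) ^ N * (g x)⁻¹ := by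
    filter_upwards [hF] with x hx
    rw [hx, mul_inv, zpow_neg, inv_inv, zpow_natCast]
  have h1 := pullTensor_expansion hN (hg.fun_inv hg0) (inv_ne_zero hg0) hy hτ
  rw [deriv_inv_of_analyticAt hg hg0] at h1
  refine h1.congr' ?_ EventuallyEq.rfl
  filter_upwards [hF, hFd, self_mem_nhdsWithin,
    nhdsWithin_le_nhds (hg.continuousAt.eventually_ne hg0)] with x hx1 hx2 hx3 hx4
  have hF0 : F x ≠ 0 := by
    rw [hx1]
    exact mul_ne_zero (zpow_ne_zero _ (sub_ne_zero.2 hx3)) hx4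
  rw [pullTensor_inv hx2.1 hF0 hx2.2]

theorem coeffs_of_eq_inv {c d : ℂ} (hg : AnalyticAt ℂ g b)
    (hF : ∀ᶠ x in 𝓝[≠] b, F x = (x - b) ^ (-(N : ℤ)) * g x) (hc : c ≠ 0) :
    (fun x => F x - c * (x - b) ^ (-(N : ℤ)) * (1 + d / c * (x - b))) =O[𝓝[≠] b]
      (fun x => (x - b) ^ (-(N : ℤ) + 2)) ↔ c = g b ∧ d = deriv g b := by
  rw [← isBigO_zpow_mul_taylor_iff (-(N : ℤ)) hg hc]
  refine isBigO_congr ?_ EventuallyEq.rfl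
  filter_upwards [hF] with x hx
  rw [hx]

end

/-! ### Charts on the sphere -/

section
variable {f : RatFunc ℂ}

/-- The rational function in the coordinate `x` at a finite point and `1 / x` at `∞`. -/
def chart (f : RatFunc ℂ) : OnePoint ℂ → ℂ → ℂ
  | ∞ => fun t => ratFun f t⁻¹
  | (_ : ℂ) => ratFun f

/-- The coordinate of a point in its chart. -/
def center : OnePoint ℂ → ℂ
  | ∞ => 0
  | (a : ℂ) => a

theorem analyticAt_eval (p : ℂ[X]) (a : ℂ) : AnalyticAt ℂ (fun x => p.eval x) a :=
  p.differentiable.analyticAt a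

/-- The reversed polynomial is nonzero at `0` for `p ≠ 0`, so this separates the pole at infinity
from the regular factor. -/
theorem eval_inv_eq (p : ℂ[X]) {t : ℂ} (ht : t ≠ 0) :
    p.eval t⁻¹ = t ^ (-(p.natDegree : ℤ)) * p.reverse.eval t := by
  let _ : Invertible t⁻¹ := invertibleOfNonzero (inv_ne_zero ht)
  have := eval₂_reverse_mul_pow (RingHom.id ℂ) t⁻¹ p
  rw [invOf_eq_inv, inv_inv] at this
  rw [← eval₂_id, ← this, eval₂_id, zpow_neg, zpow_natCast, inv_pow, mul_comm]

theorem reverse_eval_zero_ne_zero {p : ℂ[X]} (hp : p ≠ 0) : p.reverse.eval 0 ≠ 0 := by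
  rwa [← coeff_zero_eq_eval_zero, coeff_zero_reverse, leadingCoeff_ne_zero]

theorem ratFun_sub_eq {x : ℂ} (v : ℂ) (hx : f.denom.eval x ≠ 0) :
    ratFun f x - v = (f.num - C v * f.denom).eval x / f.denom.eval x := by
  rw [ratFun_eq]
  simp only [eval_sub, eval_mul, eval_C]
  field_simp

theorem eventually_eval_ne_zero {p : ℂ[X]} (hp : p ≠ 0) (a : ℂ) :
    ∀ᶠ x in 𝓝[≠] a, p.eval x ≠ 0 := by
  have : ({x | p.eval x = 0} : Set ℂ).Finite := by
    refine (p.roots.toFinset.finite_toSet).subset fun x hx => ?_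
    simpa [hp] using hx
  have h2 := (this.subset Set.sdiff_subset : ({x | p.eval x = 0} \ {a}).Finite)
  have h3 : ∀ᶠ x in 𝓝 a, x ∉ {x | p.eval x = 0} \ {a} :=
    h2.isClosed.isOpen_compl.mem_nhds (by simp)
  filter_upwards [nhdsWithin_le_nhds h3, self_mem_nhdsWithin] with x hx1 hx2 hx3
  exact hx1 ⟨hx3, hx2⟩

theorem exists_chart_sub_eq (hf : 1 ≤ ratDegree f) {p : OnePoint ℂ} {v : ℂ}
    (h : sphereMap f p = (v : OnePoint ℂ)) : ∃ g : ℂ → ℂ, AnalyticAt ℂ g (center p) ∧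
      g (center p) ≠ 0 ∧ ∀ᶠ x in 𝓝[≠] (center p),
        chart f p x - v = (x - center p) ^ mult f p * g x := by
  have hA0 := num_sub_ne_zero hf v
  set A := f.num - C v * f.denom with hA
  induction p using OnePoint.rec with
  | infty =>
    obtain ⟨h1, h2⟩ := natDegree_lt_of_sphereMap_infty hf h
    rw [← hA] at h2
    change ∃ g : ℂ → ℂ, AnalyticAt ℂ g 0 ∧ g 0 ≠ 0 ∧ ∀ᶠ x in 𝓝[≠] 0,
      ratFun f x⁻¹ - v = (x - 0) ^ mult f ∞ * g x
    have hQ0 := reverse_eval_zero_ne_zero f.denom_ne_zero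
    refine ⟨fun t => A.reverse.eval t / f.denom.reverse.eval t,
      (analyticAt_eval _ _).fun_div (analyticAt_eval _ _) hQ0,
      div_ne_zero (reverse_eval_zero_ne_zero hA0) hQ0, ?_⟩
    filter_upwards [self_mem_nhdsWithin,
      nhdsWithin_le_nhds ((analyticAt_eval f.denom.reverse 0).continuousAt.eventually_ne hQ0)]
      with t ht hQt
    have ht' : t ≠ 0 := ht
    have hd : f.denom.eval t⁻¹ ≠ 0 := by
      rw [eval_inv_eq _ ht']; exact mul_ne_zero (zpow_ne_zero _ ht') hQt
    rw [ratFun_sub_eq v hd, ← hA, eval_inv_eq _ ht', eval_inv_eq _ ht', mult_infty_coe h, ← hA,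
      sub_zero, ← zpow_natCast, Nat.cast_sub h2.le, zpow_sub₀ ht', zpow_neg, zpow_neg]
    have := zpow_ne_zero (A.natDegree : ℤ) ht'
    have := zpow_ne_zero (f.denom.natDegree : ℤ) ht'
    field_simp
  | coe a =>
    obtain ⟨h1, h2⟩ := sphereMap_coe_eq_coe_iff.1 h
    change ∃ g : ℂ → ℂ, AnalyticAt ℂ g a ∧ g a ≠ 0 ∧ ∀ᶠ x in 𝓝[≠] a,
      ratFun f x - v = (x - a) ^ mult f a * g x
    obtain ⟨q, hq, hqa⟩ := exists_eq_pow_rootMultiplicity_mul_and_not_dvd A hA0 a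
    have hqa' : q.eval a ≠ 0 := fun h => hqa (dvd_iff_isRoot.2 h)
    refine ⟨fun x => q.eval x / f.denom.eval x,
      (analyticAt_eval _ _).fun_div (analyticAt_eval _ _) h1, div_ne_zero hqa' h1, ?_⟩
    filter_upwards [eventually_eval_ne_zero f.denom_ne_zero a] with x hx
    have e : A.eval x = (x - a) ^ A.rootMultiplicity a * q.eval x := by
      conv_lhs => rw [hq]
      simp
    rw [ratFun_sub_eq v hx, ← hA, e, mult_coe_coe h, ← hA, mul_div_assoc]

theorem exists_chart_eq_inv (hf : 1 ≤ ratDegree f) {p : OnePoint ℂ}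
    (h : sphereMap f p = ∞) : ∃ g : ℂ → ℂ, AnalyticAt ℂ g (center p) ∧
      g (center p) ≠ 0 ∧ ∀ᶠ x in 𝓝[≠] (center p),
        chart f p x = (x - center p) ^ (-(mult f p : ℤ)) * g x := by
  have hP0 := num_ne_zero hf
  induction p using OnePoint.rec with
  | infty =>
    have h1 := sphereMap_infty_eq_infty_iff.1 h
    change ∃ g : ℂ → ℂ, AnalyticAt ℂ g 0 ∧ g 0 ≠ 0 ∧ ∀ᶠ x in 𝓝[≠] 0,
      ratFun f x⁻¹ = (x - 0) ^ (-(mult f ∞ : ℤ)) * g x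
    have hQ0 := reverse_eval_zero_ne_zero f.denom_ne_zero
    refine ⟨fun t => f.num.reverse.eval t / f.denom.reverse.eval t,
      (analyticAt_eval _ _).fun_div (analyticAt_eval _ _) hQ0,
      div_ne_zero (reverse_eval_zero_ne_zero hP0) hQ0, ?_⟩
    filter_upwards [self_mem_nhdsWithin] with t ht
    have ht' : t ≠ 0 := ht
    rw [ratFun_eq, eval_inv_eq _ ht', eval_inv_eq _ ht', mult_infty_infty h,
      sub_zero, Nat.cast_sub h1.le, neg_sub, zpow_sub₀ ht', zpow_neg, zpow_neg]
    have := zpow_ne_zero (f.num.natDegree : ℤ) ht'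
    have := zpow_ne_zero (f.denom.natDegree : ℤ) ht'
    field_simp
  | coe a =>
    have h1 := sphereMap_coe_eq_infty_iff.1 h
    change ∃ g : ℂ → ℂ, AnalyticAt ℂ g a ∧ g a ≠ 0 ∧ ∀ᶠ x in 𝓝[≠] a,
      ratFun f x = (x - a) ^ (-(mult f a : ℤ)) * g x
    obtain ⟨q, hq, hqa⟩ :=
      exists_eq_pow_rootMultiplicity_mul_and_not_dvd f.denom f.denom_ne_zero a
    have hqa' : q.eval a ≠ 0 := fun h => hqa (dvd_iff_isRoot.2 h)
    refine ⟨fun x => f.num.eval x / q.eval x,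
      (analyticAt_eval _ _).fun_div (analyticAt_eval _ _) hqa',
      div_ne_zero (num_eval_ne_zero h1) hqa', ?_⟩
    refine Eventually.of_forall fun x => ?_
    have e : f.denom.eval x = (x - a) ^ f.denom.rootMultiplicity a * q.eval x := by
      conv_lhs => rw [hq]
      simp
    rw [ratFun_eq, e, mult_coe_infty h, zpow_neg, zpow_natCast, div_eq_mul_inv, mul_inv]
    ring

theorem ramOrd_add_one (hf : 1 ≤ ratDegree f) (p : OnePoint ℂ) : ramOrd f p + 1 = mult f p := by
  have := one_le_mult hf p
  rw [ramOrd]; omega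

theorem isBigO_cobounded_iff {F G : ℂ → ℂ} : F =O[Bornology.cobounded ℂ] G ↔
    (fun t => F t⁻¹) =O[𝓝[≠] 0] fun t => G t⁻¹ := by
  have h : Bornology.cobounded ℂ = map (fun t : ℂ => t⁻¹) (𝓝[≠] 0) :=
    inv_nhdsNE_zero.symm
  rw [h, isBigO_map]
  rfl

theorem hasCoeffs_coe_iff (hf : 1 ≤ ratDegree f) {p : OnePoint ℂ} {v : ℂ}
    (h : sphereMap f p = (v : OnePoint ℂ)) (c d : ℂ) : HasCoeffs f p c d ↔ c ≠ 0 ∧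
      (fun x => chart f p x - v - c * (x - center p) ^ (mult f p : ℤ) *
        (1 + d / c * (x - center p))) =O[𝓝[≠] (center p)]
        (fun x => (x - center p) ^ ((mult f p : ℤ) + 2)) := by
  have hN : ((ramOrd f p : ℤ) + 1) = (mult f p : ℤ) := by exact_mod_cast ramOrd_add_one hf p
  unfold HasCoeffs
  rw [hN, h]
  refine and_congr_right fun _ => ?_
  induction p using OnePoint.rec with
  | infty =>
    change _ =O[Bornology.cobounded ℂ] _ ↔ _
    rw [isBigO_cobounded_iff]
    change _ ↔ (fun x => ratFun f x⁻¹ - v - c * (x - 0) ^ (mult f ∞ : ℤ) *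
        (1 + d / c * (x - 0))) =O[𝓝[≠] 0] (fun x => (x - 0) ^ ((mult f ∞ : ℤ) + 2))
    have e : -(mult f ∞ : ℤ) - 2 = -((mult f ∞ : ℤ) + 2) := by ring
    simp only [e, inv_zpow, zpow_neg, inv_inv, sub_zero]
  | coe a => exact Iff.rfl

theorem hasCoeffs_infty_iff (hf : 1 ≤ ratDegree f) {p : OnePoint ℂ}
    (h : sphereMap f p = ∞) (c d : ℂ) : HasCoeffs f p c d ↔ c ≠ 0 ∧
      (fun x => chart f p x - c * (x - center p) ^ (-(mult f p : ℤ)) *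
        (1 + d / c * (x - center p))) =O[𝓝[≠] (center p)]
        (fun x => (x - center p) ^ (-(mult f p : ℤ) + 2)) := by
  have hN : ((ramOrd f p : ℤ) + 1) = (mult f p : ℤ) := by exact_mod_cast ramOrd_add_one hf p
  unfold HasCoeffs
  rw [hN, h]
  refine and_congr_right fun _ => ?_
  induction p using OnePoint.rec with
  | infty =>
    change _ =O[Bornology.cobounded ℂ] _ ↔ _
    rw [isBigO_cobounded_iff]
    change _ ↔ (fun x => ratFun f x⁻¹ - c * (x - 0) ^ (-(mult f ∞ : ℤ)) *
        (1 + d / c * (x - 0))) =O[𝓝[≠] 0] (fun x => (x - 0) ^ (-(mult f ∞ : ℤ) + 2))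
    have e : (mult f ∞ : ℤ) - 2 = -(-(mult f ∞ : ℤ) + 2) := by ring
    simp only [e, inv_zpow', neg_neg, inv_inv, sub_zero]
  | coe a => exact Iff.rfl

/-! ### Unmarked points -/

theorem finite_coe_marked (hf : 1 ≤ ratDegree f) :
    {a : ℂ | (a : OnePoint ℂ) ∈ marked f}.Finite := by
  refine ((markedPoly f).roots.toFinset.finite_toSet).subset fun a ha => ?_
  have := coe_mem_marked_iff.1 ha
  simpa [markedPoly_ne_zero hf] using this

theorem eventually_unmarked (hf : 1 ≤ ratDegree f) (a : ℂ) :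
    ∀ᶠ x in 𝓝[≠] a, ((x : ℂ) : OnePoint ℂ) ∉ marked f := by
  filter_upwards [eventually_eval_ne_zero (markedPoly_ne_zero hf) a] with x hx
  rwa [coe_mem_marked_iff]

theorem eventually_unmarked_cobounded (hf : 1 ≤ ratDegree f) :
    ∀ᶠ x in Bornology.cobounded ℂ, ((x : ℂ) : OnePoint ℂ) ∉ marked f :=
  Bornology.isBounded_def.1 (finite_coe_marked hf).isBounded

/-- The derivative is the Wronskian over the squared denominator, and the Wronskian vanishes only at
marked points. -/
theorem ratFun_of_unmarked (hf : IsBelyi f) (hinf : sphereMap f ∞ ∈ threePoints) {x : ℂ}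
    (hx : (x : OnePoint ℂ) ∉ marked f) : AnalyticAt ℂ (ratFun f) x ∧ ratFun f x ≠ 0 ∧
      ratFun f x ≠ 1 ∧ deriv (ratFun f) x ≠ 0 := by
  have hW := wron_eval_ne_zero hf hx (degree_count hf.1 hinf).1
  rw [coe_mem_marked_iff, markedPoly] at hx
  simp only [eval_mul, eval_sub, mul_eq_zero, not_or] at hx
  obtain ⟨⟨h1, h2⟩, h3⟩ := hx
  refine ⟨(analyticAt_eval _ _).fun_div (analyticAt_eval _ _) h2, div_ne_zero h1 h2, ?_, ?_⟩
  · rw [ratFun_eq, Ne, div_eq_one_iff_eq h2]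
    exact fun h => h3 (sub_eq_zero.2 h)
  · have hd : HasDerivAt (ratFun f) _ x :=
      (f.num.hasDerivAt x).fun_div (f.denom.hasDerivAt x) h2
    rw [hd.deriv]
    refine div_ne_zero ?_ (pow_ne_zero 2 h2)
    simpa [wron] using hW

theorem eventually_chart_regular (hf : IsBelyi f) (hinf : sphereMap f ∞ ∈ threePoints)
    (p : OnePoint ℂ) : ∀ᶠ x in 𝓝[≠] (center p),
      AnalyticAt ℂ (chart f p) x ∧ deriv (chart f p) x ≠ 0 := by
  induction p using OnePoint.rec with
  | infty =>
    change ∀ᶠ x in 𝓝[≠] (0 : ℂ), AnalyticAt ℂ (fun t => ratFun f t⁻¹) x ∧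
      deriv (fun t => ratFun f t⁻¹) x ≠ 0
    filter_upwards [tendsto_inv₀_nhdsNE_zero.eventually (eventually_unmarked_cobounded hf.1),
      self_mem_nhdsWithin] with t ht ht0
    have ht0' : t ≠ 0 := ht0
    obtain ⟨h1, -, -, h2⟩ := ratFun_of_unmarked hf hinf ht
    refine ⟨h1.comp (analyticAt_inv ht0'), ?_⟩
    have h3 := deriv_comp t h1.differentiableAt (differentiableAt_inv ht0')
    have h4 : deriv (fun t => ratFun f t⁻¹) t = _ := h3
    rw [h4, deriv_inv]
    exact mul_ne_zero h2 (by simpa using ht0')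
  | coe a =>
    filter_upwards [eventually_unmarked hf.1 a] with x hx
    obtain ⟨h1, -, -, h2⟩ := ratFun_of_unmarked hf hinf hx
    exact ⟨h1, h2⟩

/-- A weight is `1 - (β+1)²`, and pullback multiplies `β + 1` by the local multiplicity. This
matches the double pole coefficient of `pullTensor_expansion`. -/
theorem pullWeight_eq (hf : 1 ≤ ratDegree f) (β : TriDivisor) (p : OnePoint ℂ) :
    (pullWeight f β p : ℂ) = (mult f p : ℂ) ^ 2 * (β.weight (sphereMap f p) : ℂ) + 1 -
      (mult f p : ℂ) ^ 2 := by
  rw [← ramOrd_add_one hf p]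
  simp only [pullWeight, pullOrder, TriDivisor.weight]
  push_cast
  ring

/-- All four cases, finite or infinite point and finite or infinite value, in one chart. At a pole
the residue is that of the zero of `1/f`, whose first two coefficients are `c⁻¹` and `-d/c²`. -/
theorem marked_expansion (hf : IsBelyi f) (hinf : sphereMap f ∞ ∈ threePoints) (β : TriDivisor)
    {p : OnePoint ℂ} (hp : p ∈ marked f) : ∃ c d H : ℂ, c ≠ 0 ∧
      (∀ c' d', HasCoeffs f p c' d' ↔ c' = c ∧ d' = d) ∧
      ((fun x => pullTensor β.tensor (chart f p) x - ((pullWeight f β p : ℂ) /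
        (2 * (x - center p) ^ 2) + H / (x - center p))) =O[𝓝[≠] (center p)]
          fun _ => (1 : ℂ)) ∧
      (sphereMap f p ≠ ∞ → H = residue (mult f p) c d (β.weight (sphereMap f p))
        (β.schwarzParam (sphereMap f p))) ∧
      (sphereMap f p = ∞ → H = residue (mult f p) c⁻¹ (-d / c ^ 2) (β.weight ∞)
        (β.schwarzParam ∞)) := by
  have hN := one_le_mult hf.1 p
  have hw := pullWeight_eq hf.1 β p
  obtain h | ⟨v, h⟩ := eq_infty_or_eq_coe (sphereMap f p)
  · obtain ⟨g, hg, hg0, hgF⟩ := exists_chart_eq_inv hf.1 h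
    refine ⟨g (center p), deriv g (center p), _, hg0, fun c' d' => ?_, ?_, fun h' => absurd h h',
      fun _ => rfl⟩
    · rw [hasCoeffs_infty_iff hf.1 h]
      constructor
      · rintro ⟨hc, hO⟩
        exact (coeffs_of_eq_inv hg hgF hc).1 hO
      · intro hcd
        have hc : c' ≠ 0 := hcd.1 ▸ hg0
        exact ⟨hc, (coeffs_of_eq_inv hg hgF hc).2 hcd⟩
    · rw [hw, h]
      exact expansion_of_eq_inv hN hg hg0 hgF (eventually_chart_regular hf hinf p)
        β.tensor_expansion_infty
  · obtain ⟨g, hg, hg0, hgF⟩ := exists_chart_sub_eq hf.1 h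
    have hv : (v : OnePoint ℂ) ∈ threePoints := h ▸ hp
    refine ⟨g (center p), deriv g (center p), _, hg0, fun c' d' => ?_, ?_, fun _ => rfl,
      fun h' => absurd (h.symm.trans h') (coe_ne_infty v)⟩
    · rw [hasCoeffs_coe_iff hf.1 h]
      constructor
      · rintro ⟨hc, hO⟩
        exact (coeffs_of_sub_eq hg hgF hc).1 hO
      · intro hcd
        have hc : c' ≠ 0 := hcd.1 ▸ hg0
        exact ⟨hc, (coeffs_of_sub_eq hg hgF hc).2 hcd⟩
    · rw [hw, h]
      exact expansion_of_sub_eq hN hg hg0 hgF (β.tensor_expansion_coe hv)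

end
end ConicalSphere
end

noncomputable section

namespace ConicalSphere

/-! ### Partial fractions -/

/-- Removing all principal parts leaves bounded singularities, hence an entire function; it tends to
`0` at infinity, so it vanishes by Liouville's theorem. -/
theorem eq_sum_of_local_expansions (S : Finset ℂ) (R : ℂ → ℂ) (s h : ℂ → ℂ)
    (hR : ∀ x ∉ S, DifferentiableAt ℂ R x)
    (hloc : ∀ a ∈ S, (fun x => R x - (s a / (2 * (x - a) ^ 2) + h a / (x - a))) =O[𝓝[≠] a]
      fun _ => (1 : ℂ))
    (hinf : Tendsto R (Bornology.cobounded ℂ) (𝓝 0)) {x : ℂ} (hx : x ∉ S) :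
    R x = ∑ a ∈ S, (s a / (2 * (x - a) ^ 2) + h a / (x - a)) := by
  set t : ℂ → ℂ → ℂ := fun a x => s a / (2 * (x - a) ^ 2) + h a / (x - a) with ht
  have hta : ∀ a b, b ≠ a → AnalyticAt ℂ (t a) b := by
    intro a b hab
    have hab' : b - a ≠ 0 := sub_ne_zero.2 hab
    refine AnalyticAt.add ?_ ?_ <;> refine AnalyticAt.fun_div (by fun_prop) (by fun_prop) ?_
    · exact mul_ne_zero two_ne_zero (pow_ne_zero 2 hab')
    · exact hab'
  obtain ⟨E, hE, hEq⟩ := exists_entire_extension S (fun x => R x - ∑ a ∈ S, t a x)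
    (fun z hz => (hR z hz).sub (DifferentiableAt.fun_sum fun a ha =>
      (hta a z fun e => hz (e ▸ ha)).differentiableAt))
    (fun a ha => by
      have h1 : (fun x => ∑ b ∈ S.erase a, t b x) =O[𝓝[≠] a] fun _ => (1 : ℂ) :=
        (IsBigO.sum fun b hb => isBigO_one_of_analyticAt
          (hta b a (Finset.ne_of_mem_erase hb).symm)).congr_left fun x => Finset.sum_apply x _ t
      refine ((hloc a ha).sub h1).congr_left fun x => ?_
      rw [← Finset.add_sum_erase S _ ha, sub_sub])
  have hlim : Tendsto (fun x => R x - ∑ a ∈ S, t a x) (Bornology.cobounded ℂ) (𝓝 0) := by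
    have h1 : Tendsto (fun x => ∑ a ∈ S, t a x) (Bornology.cobounded ℂ)
        (𝓝 (∑ a ∈ S, (0 : ℂ))) := by
      refine tendsto_finsetSum S fun a _ => ?_
      have h2 : Tendsto (fun x : ℂ => (x - a)⁻¹) (Bornology.cobounded ℂ) (𝓝 0) := by
        refine tendsto_inv₀_cobounded.comp ?_
        simp [sub_eq_add_neg]
      have h3 := ((h2.pow 2).const_mul (s a / 2)).add (h2.const_mul (h a))
      simp only [ne_eq, OfNat.ofNat_ne_zero, not_false_eq_true, zero_pow, mul_zero,
        add_zero] at h3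
      refine h3.congr fun x => ?_
      simp only [ht, div_eq_mul_inv, mul_inv, inv_pow]
      ring
    simpa using hinf.sub h1
  have hE0 : Tendsto E (Bornology.cobounded ℂ) (𝓝 0) := by
    refine hlim.congr' ?_
    have : ∀ᶠ x in Bornology.cobounded ℂ, x ∉ (S : Set ℂ) :=
      Bornology.isBounded_def.1 S.finite_toSet.isBounded
    filter_upwards [this] with x hx using (hEq x hx).symm
  rw [Metric.cobounded_eq_cocompact] at hE0
  have := hE.apply_eq_of_tendsto_cocompact x hE0
  rw [hEq x hx, sub_eq_zero] at this
  exact this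

/-! ### The stress-energy tensor of the pullback metric, also at infinity. -/

theorem stressEnergy_pullPotential {β : TriDivisor} {φ : ℂ → ℝ} (hφ : IsTriPotential β φ)
    (hb0 : -1 < β.b0) (hb1 : -1 < β.b1) (hbinf : -1 < β.binf) {f : RatFunc ℂ} (hf : IsBelyi f)
    (hinf : sphereMap f ∞ ∈ threePoints) {x : ℂ} (hx : (x : OnePoint ℂ) ∉ marked f) :
    stressEnergy (pullPotential f φ) x = pullTensor β.tensor (ratFun f) x := by
  obtain ⟨h1, h2, h3, h4⟩ := ratFun_of_unmarked hf hinf hx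
  have hop : IsOpen ({0, 1}ᶜ : Set ℂ) := (Set.toFinite _).isClosed.isOpen_compl
  have hmem : ratFun f x ∈ ({0, 1}ᶜ : Set ℂ) := by simp [h2, h3]
  have hs : ContDiffAt ℝ 2 φ (ratFun f x) :=
    contDiffAt_infty.1 (hφ.smooth.contDiffAt (hop.mem_nhds hmem)) 2
  have hs' : ContDiffAt ℝ 2 (fun w => (φ w : ℂ)) (ratFun f x) :=
    Complex.ofRealCLM.contDiff.contDiffAt.comp _ hs
  have := stressEnergy_pull hs' h1 h4
  rw [hφ.stressEnergy_eq_tensor hb0 hb1 hbinf h2 h3] at this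
  exact this

theorem differentiableAt_pullTensor (β : TriDivisor) {f : RatFunc ℂ} (hf : IsBelyi f)
    (hinf : sphereMap f ∞ ∈ threePoints) {x : ℂ} (hx : (x : OnePoint ℂ) ∉ marked f) :
    DifferentiableAt ℂ (pullTensor β.tensor (ratFun f)) x := by
  obtain ⟨h1, h2, h3, h4⟩ := ratFun_of_unmarked hf hinf hx
  have hτ : DifferentiableAt ℂ β.tensor (ratFun f x) := by
    have h5 : 2 * ratFun f x ^ 2 * (ratFun f x - 1) ^ 2 ≠ 0 :=
      mul_ne_zero (mul_ne_zero two_ne_zero (pow_ne_zero 2 h2))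
        (pow_ne_zero 2 (sub_ne_zero.2 h3))
    unfold TriDivisor.tensor triTensor
    exact DifferentiableAt.fun_div (by fun_prop) (by fun_prop) h5
  have hL := analyticAt_logDeriv h1.deriv h4
  have hS : DifferentiableAt ℂ (schwarzian (ratFun f)) x :=
    hL.deriv.differentiableAt.sub ((hL.differentiableAt.pow 2).div_const 2)
  exact ((hτ.comp x h1.differentiableAt).mul (h1.deriv.differentiableAt.pow 2)).add hS

/-- In the coordinate `t = 1/x` the tensor gains a factor `t⁻⁴`. Removing it turns `s/(2t²) + h/t +
O(1)` into `s t²/2 + h t³ + O(t⁴)`, so the parameter at infinity is a residue in `t`. -/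
theorem pullTensor_expansion_cobounded {τ : ℂ → ℂ} {f : RatFunc ℂ} (hf : IsBelyi f)
    (hinf : sphereMap f ∞ ∈ threePoints) {s h : ℂ}
    (H : (fun t => pullTensor τ (chart f ∞) t - (s / (2 * (t - center ∞) ^ 2) +
      h / (t - center ∞))) =O[𝓝[≠] (center ∞)] fun _ => (1 : ℂ)) :
    (fun x : ℂ => pullTensor τ (ratFun f) x - (s / (2 * x ^ 2) + h / x ^ 3))
      =O[Bornology.cobounded ℂ] fun x : ℂ => x ^ (-4 : ℤ) := by
  have H' : (fun t => pullTensor τ (fun t => ratFun f t⁻¹) t - (s / (2 * (t - 0) ^ 2) +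
      h / (t - 0))) =O[𝓝[≠] 0] fun _ => (1 : ℂ) := H
  rw [isBigO_cobounded_iff]
  refine (H'.mul (isBigO_refl (fun t : ℂ => t ^ 4) (𝓝[≠] 0))).congr' ?_ ?_
  · filter_upwards [tendsto_inv₀_nhdsNE_zero.eventually (eventually_unmarked_cobounded hf.1),
      self_mem_nhdsWithin] with t ht ht0
    have ht0' : t ≠ 0 := ht0
    obtain ⟨h1, -, -, h2⟩ := ratFun_of_unmarked hf hinf ht
    rw [pullTensor_comp_inv ht0' h1 h2]
    field_simp
    ring
  · refine Eventually.of_forall fun t => ?_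
    simp only [inv_zpow', neg_neg, one_mul]
    norm_cast

theorem tendsto_zero_of_expansion_cobounded {R : ℂ → ℂ} {s h : ℂ}
    (H : (fun x : ℂ => R x - (s / (2 * x ^ 2) + h / x ^ 3))
      =O[Bornology.cobounded ℂ] fun x : ℂ => x ^ (-4 : ℤ)) :
    Tendsto R (Bornology.cobounded ℂ) (𝓝 0) := by
  have hi : Tendsto (fun x : ℂ => x⁻¹) (Bornology.cobounded ℂ) (𝓝 0) := tendsto_inv₀_cobounded
  have h1 := H.trans_tendsto (by
    have := hi.pow 4
    rw [zero_pow (by norm_num)] at this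
    refine this.congr fun x => ?_
    rw [zpow_neg, inv_pow]; norm_cast)
  have h2 := ((hi.pow 2).const_mul (s / 2)).add ((hi.pow 3).const_mul h)
  have h3 := h1.add h2
  simp only [ne_eq, OfNat.ofNat_ne_zero, not_false_eq_true, zero_pow, mul_zero, add_zero] at h3
  refine h3.congr fun x => ?_
  simp only [div_eq_mul_inv, mul_inv, inv_pow]
  ring

theorem residue_one (c d s h : ℂ) : residue 1 c d s h = d / c * s + c * h := by
  simp [residue]

theorem residue_of_one_lt {N : ℕ} (hN : 1 < N) (c d s h : ℂ) :
    residue N c d s h = d / c * ((N ^ 2 * s + 1 - N ^ 2) / N) := by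
  simp [residue, hN.ne']

end ConicalSphere
end

theorem mainTheorem4 (β : TriDivisor)
    (hb0 : -1 < β.b0 ∧ β.b0 ≤ 0) (hb1 : -1 < β.b1 ∧ β.b1 ≤ 0)
    (hbinf : -1 < β.binf ∧ β.binf ≤ 0)
    (φ : ℂ → ℝ) (hφ : IsTriPotential β φ)
    (f : RatFunc ℂ) (hf : IsBelyi f) (hfinf : sphereMap f ∞ ∈ threePoints) :
    -- there are exactly `deg f + 2` marked points
    (marked f).Finite ∧ (marked f).ncard = ratDegree f + 2 ∧
    ∃ h : OnePoint ℂ → ℂ,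
      -- the stress-energy tensor off the marked points
      (∀ x : ℂ, (x : OnePoint ℂ) ∉ marked f →
        stressEnergy (pullPotential f φ) x =
          ∑ᶠ a ∈ {a : ℂ | (a : OnePoint ℂ) ∈ marked f},
            ((pullWeight f β (a : OnePoint ℂ) : ℂ) / (2 * (x - a) ^ 2)
              + h (a : OnePoint ℂ) / (x - a))) ∧
      -- the stress-energy tensor at infinity
      ((fun x : ℂ => stressEnergy (pullPotential f φ) x
          - ((pullWeight f β ∞ : ℂ) / (2 * x ^ 2) + h ∞ / x ^ 3))
        =O[Bornology.cobounded ℂ] fun x : ℂ => x ^ (-4 : ℤ)) ∧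
      -- the accessory parameters
      ∀ p ∈ marked f,
        (∃ c d : ℂ, HasCoeffs f p c d) ∧
        ∀ c d : ℂ, HasCoeffs f p c d →
          (sphereMap f p ≠ ∞ → ramOrd f p = 0 →
            h p = d / c * (β.weight (sphereMap f p) : ℂ)
              + c * (β.schwarzParam (sphereMap f p) : ℂ)) ∧
          (sphereMap f p ≠ ∞ → 0 < ramOrd f p →
            h p = -(d / c) * (((pullOrder f β p * (pullOrder f β p + 2) : ℝ) : ℂ)
              / ((ramOrd f p : ℂ) + 1))) ∧
          (sphereMap f p = ∞ → ramOrd f p = 0 →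
            h p = -(d / c) * (β.weight ∞ : ℂ) + 1 / c * (β.schwarzParam ∞ : ℂ)) ∧
          (sphereMap f p = ∞ → 0 < ramOrd f p →
            h p = d / c * (((pullOrder f β p * (pullOrder f β p + 2) : ℝ) : ℂ)
              / ((ramOrd f p : ℂ) + 1))) := by
  obtain ⟨hfin, hcard⟩ := marked_finite_ncard hf hfinf
  -- Membership is moved inside the existential so that the parameters can be chosen as functions on
  -- the whole sphere; the value `0` at unmarked points is arbitrary.
  have hex : ∀ p : OnePoint ℂ, ∃ c d H : ℂ, p ∈ marked f → c ≠ 0 ∧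
      (∀ c' d', HasCoeffs f p c' d' ↔ c' = c ∧ d' = d) ∧
      ((fun x => pullTensor β.tensor (chart f p) x - ((pullWeight f β p : ℂ) /
        (2 * (x - center p) ^ 2) + H / (x - center p))) =O[𝓝[≠] (center p)]
          fun _ => (1 : ℂ)) ∧
      (sphereMap f p ≠ ∞ → H = residue (mult f p) c d (β.weight (sphereMap f p))
        (β.schwarzParam (sphereMap f p))) ∧
      (sphereMap f p = ∞ → H = residue (mult f p) c⁻¹ (-d / c ^ 2) (β.weight ∞)
        (β.schwarzParam ∞)) := by
    intro p
    by_cases hp : p ∈ marked f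
    · obtain ⟨c, d, H, h⟩ := marked_expansion hf hfinf β hp
      exact ⟨c, d, H, fun _ => h⟩
    · exact ⟨0, 0, 0, fun h => absurd h hp⟩
  choose cc dd h hh using hex
  have hO := pullTensor_expansion_cobounded hf hfinf (hh ∞ hfinf).2.2.1
  refine ⟨hfin, hcard, h, fun x hx => ?_, ?_, fun p hp => ?_⟩
  · have hS := finite_coe_marked hf.1
    rw [stressEnergy_pullPotential hφ hb0.1 hb1.1 hbinf.1 hf hfinf hx,
      finsum_mem_eq_finite_toFinset_sum _ hS]
    refine eq_sum_of_local_expansions hS.toFinset _ (fun a => (pullWeight f β a : ℂ))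
      (fun a => h a) (fun z hz => differentiableAt_pullTensor β hf hfinf (by simpa using hz))
      (fun a ha => (hh a (by simpa using ha)).2.2.1)
      (tendsto_zero_of_expansion_cobounded hO) (by simpa using hx)
  · refine hO.congr' ?_ EventuallyEq.rfl
    filter_upwards [eventually_unmarked_cobounded hf.1] with x hx
    rw [stressEnergy_pullPotential hφ hb0.1 hb1.1 hbinf.1 hf hfinf hx]
  · obtain ⟨hc0, huniq, -, hres, hresinf⟩ := hh p hp
    refine ⟨⟨cc p, dd p, (huniq _ _).2 ⟨rfl, rfl⟩⟩, fun c d hcd => ?_⟩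
    obtain ⟨rfl, rfl⟩ := (huniq c d).1 hcd
    have hmult := ramOrd_add_one hf.1 p
    -- This rewrites the numerator in `residue` through the order of the pullback metric; its minus
    -- sign is the one in the ramified formula at finite values.
    have hw : (mult f p : ℂ) ^ 2 * (β.weight (sphereMap f p) : ℂ) + 1 - (mult f p : ℂ) ^ 2 =
        -((pullOrder f β p * (pullOrder f β p + 2) : ℝ) : ℂ) := by
      rw [← pullWeight_eq hf.1, pullWeight]
      push_cast
      ring
    have hm : ((ramOrd f p : ℂ) + 1) = mult f p := by exact_mod_cast hmult
    refine ⟨fun hv hr => ?_, fun hv hr => ?_, fun hv hr => ?_, fun hv hr => ?_⟩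
    · rw [hres hv, ← hmult, hr, residue_one]
    · rw [hres hv, residue_of_one_lt (by omega), hw, hm]
      ring
    · rw [hresinf hv, ← hmult, hr, residue_one]
      field_simp
    · rw [hv] at hw
      -- For `1/f` the ratio of the two coefficients is `-d/c`, which cancels the minus sign of
      -- `hw`.
      rw [hresinf hv, residue_of_one_lt (by omega), hw, hm]
      field_simp
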